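/- There are universal constants $C,D>0$ and $c\in\mathbb N$ such that the following holds for all real $0<\varepsilon<1$ and $\kappa>0$. Write $L=\max\{1,\log_2(1/\kappa)\}$ and $$F(n)=\Big(\frac{L\,\log_2 n}{\varepsilon}\Big)^{D L^2/\varepsilon}.$$ There is a deterministic word-RAM algorithm, consisting of a preprocessing program and a query program, that does the following for every $n\ge 2$, every word length $w\ge c\log_2 n$, and every set of $n$ points $(x_1,y_1),\dots,(x_n,y_n)$ in the plane (given in arbitrary order) whose coordinates are nonnegative integers less than $2^w$, the $x_i$ being pairwise distinct and the $y_i$ being pairwise distinct. The preprocessing takes at most $$C\,F(n)\,n^{1+\kappa}$$ steps. Afterwards, in any sequence of queries, each query is given by an axis-parallel rectangle $R=[a_1,a_2]\times[b_1,b_2]$ with nonnegative integer borders less than $2^w$ and is answered in at most $$C\,F(n)$$ steps by a number $r$ with $(1-\varepsilon)\,\mathrm{LIS}(R)\le r\le \mathrm{LIS}(R)$. Here $\mathrm{LIS}(R)$ is the largest size of a set of input points inside $R$ any two of which are ordered in the same way by their $x$-coordinates and by their $y$-coordinates. The word RAM has unit-cost addition, subtraction, multiplication, division, remainder, comparison and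 indirect memory access on $w$-bit words. -/

import Mathlib

namespace QueryLIS

/-! ### The problem -/

/-- Any two different points of `T` are ordered the same way by `x` and by `y`. -/
def IsIncreasing (T : Finset (ℕ × ℕ)) : Prop :=
  ∀ p ∈ T, ∀ q ∈ T, p ≠ q → (p.1 < q.1 ∧ p.2 < q.2) ∨ (q.1 < p.1 ∧ q.2 < p.2)

instance (T : Finset (ℕ × ℕ)) : Decidable (IsIncreasing T) := by
  unfold IsIncreasing; infer_instance

/-- The length of a longest increasing subsequence of a finite set of points. -/
def lis (S : Finset (ℕ × ℕ)) : ℕ :=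
  (S.powerset.filter IsIncreasing).sup Finset.card

/-- An axis-parallel rectangle `[x₁, x₂] × [y₁, y₂]`. -/
structure Rect where
  x₁ : ℕ
  x₂ : ℕ
  y₁ : ℕ
  y₂ : ℕ

/-- The points of the input that lie in the rectangle. -/
def Rect.points (R : Rect) {n : ℕ} (pts : Fin n → ℕ × ℕ) : Finset (ℕ × ℕ) :=
  (Finset.univ.image pts).filter
    fun p => R.x₁ ≤ p.1 ∧ p.1 ≤ R.x₂ ∧ R.y₁ ≤ p.2 ∧ p.2 ≤ R.y₂

/-- The borders of the rectangle fit into words of `w` bits. -/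
def Rect.Fits (R : Rect) (w : ℕ) : Prop :=
  R.x₁ < 2 ^ w ∧ R.x₂ < 2 ^ w ∧ R.y₁ < 2 ^ w ∧ R.y₂ < 2 ^ w

/-! ### The word RAM, with words of `w` bits

Programs are finite objects. Every literal, every register access, every memory access, every
arithmetic operation, and every command and every test of a loop costs one step. -/

/-- The binary word operations (`sub` stops at `0`, division by `0` gives `0`). -/
inductive Op
  | add | sub | mul | div | mod | lt | eq

def Op.apply : Op → ℕ → ℕ → ℕ
  | .add, a, b => a + b
  | .sub, a, b => a - b
  | .mul, a, b => a * b
  | .div, a, b => a / b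
  | .mod, a, b => a % b
  | .lt, a, b => if a < b then 1 else 0
  | .eq, a, b => if a = b then 1 else 0

inductive Expr
  | lit (k : ℕ)
  | reg (i : ℕ)
  | load (a : Expr)
  | bin (o : Op) (a b : Expr)

inductive Cmd
  | skip
  | assign (i : ℕ) (e : Expr)
  | store (a e : Expr)
  | seq (c d : Cmd)
  | ite (e : Expr) (c d : Cmd)
  | loop (e : Expr) (c : Cmd)

/-- Contents of the registers and of the memory cells. -/
structure State where
  reg : ℕ → ℕ
  mem : ℕ → ℕ

/-- The value of an expression; all results are reduced to `w` bits. -/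
def Expr.eval (w : ℕ) (s : State) : Expr → ℕ
  | .lit k => k % 2 ^ w
  | .reg i => s.reg i
  | .load a => s.mem (a.eval w s)
  | .bin o a b => o.apply (a.eval w s) (b.eval w s) % 2 ^ w

/-- The number of steps taken by the evaluation of an expression. -/
def Expr.cost : Expr → ℕ
  | .lit _ => 1
  | .reg _ => 1
  | .load a => a.cost + 1
  | .bin _ a b => a.cost + b.cost + 1

/-- `Exec w c s t s'`: with words of `w` bits, the command `c` started in state `s` halts in
state `s'` after exactly `t` steps. A test counts as true if its value is not `0`. -/
inductive Exec (w : ℕ) : Cmd → State → ℕ → State → Prop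
  | skip (s : State) : Exec w .skip s 1 s
  | assign (s : State) (i : ℕ) (e : Expr) :
      Exec w (.assign i e) s (e.cost + 1) ⟨Function.update s.reg i (e.eval w s), s.mem⟩
  | store (s : State) (a e : Expr) :
      Exec w (.store a e) s (a.cost + e.cost + 1)
        ⟨s.reg, Function.update s.mem (a.eval w s) (e.eval w s)⟩
  | seq {c d : Cmd} {s s' s'' : State} {t t' : ℕ} (hc : Exec w c s t s')
      (hd : Exec w d s' t' s'') : Exec w (.seq c d) s (t + t' + 1) s''
  | ite_true {e : Expr} {c d : Cmd} {s s' : State} {t : ℕ} (he : e.eval w s ≠ 0)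
      (hc : Exec w c s t s') : Exec w (.ite e c d) s (e.cost + t + 1) s'
  | ite_false {e : Expr} {c d : Cmd} {s s' : State} {t : ℕ} (he : e.eval w s = 0)
      (hd : Exec w d s t s') : Exec w (.ite e c d) s (e.cost + t + 1) s'
  | loop_true {e : Expr} {c : Cmd} {s s' s'' : State} {t t' : ℕ} (he : e.eval w s ≠ 0)
      (hc : Exec w c s t s') (hl : Exec w (.loop e c) s' t' s'') :
      Exec w (.loop e c) s (e.cost + t + t' + 1) s''
  | loop_false {e : Expr} {c : Cmd} {s : State} (he : e.eval w s = 0) :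
      Exec w (.loop e c) s (e.cost + 1) s

/-- The machine is deterministic. -/
theorem Exec.unique {w : ℕ} {c : Cmd} {s s₁ s₂ : State} {t₁ t₂ : ℕ}
    (h₁ : Exec w c s t₁ s₁) (h₂ : Exec w c s t₂ s₂) : t₁ = t₂ ∧ s₁ = s₂ := by
  induction h₁ generalizing t₂ s₂ with
  | skip => cases h₂; exact ⟨rfl, rfl⟩
  | assign => cases h₂; exact ⟨rfl, rfl⟩
  | store => cases h₂; exact ⟨rfl, rfl⟩
  | seq _ _ ihc ihd =>
    cases h₂ with
    | seq hc hd =>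
      obtain ⟨rfl, rfl⟩ := ihc hc
      obtain ⟨rfl, rfl⟩ := ihd hd
      exact ⟨rfl, rfl⟩
  | ite_true he _ ih =>
    cases h₂ with
    | ite_true _ hc => obtain ⟨rfl, rfl⟩ := ih hc; exact ⟨rfl, rfl⟩
    | ite_false he' _ => exact absurd he' he
  | ite_false he _ ih =>
    cases h₂ with
    | ite_true he' _ => exact absurd he he'
    | ite_false _ hd => obtain ⟨rfl, rfl⟩ := ih hd; exact ⟨rfl, rfl⟩
  | loop_true he _ _ ihc ihl =>
    cases h₂ with
    | loop_true _ hc hl =>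
      obtain ⟨rfl, rfl⟩ := ihc hc
      obtain ⟨rfl, rfl⟩ := ihl hl
      exact ⟨rfl, rfl⟩
    | loop_false he' => exact absurd he' he
  | loop_false he =>
    cases h₂ with
    | loop_true he' _ _ => exact absurd he he'
    | loop_false _ => exact ⟨rfl, rfl⟩

/-! ### Data structures for the problem -/

/-- A preprocessing program and a query program. -/
structure Algorithm where
  pre : Cmd
  query : Cmd

/-- The initial state: register `0` holds `n`, memory cells `2 * i` and `2 * i + 1` hold the
coordinates of the `i`-th point, everything else is `0`. -/
def inputState {n : ℕ} (pts : Fin n → ℕ × ℕ) : State where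
  reg i := if i = 0 then n else 0
  mem a := if h : a / 2 < n then
      (if a % 2 = 0 then (pts ⟨a / 2, h⟩).1 else (pts ⟨a / 2, h⟩).2)
    else 0

/-- A query puts the borders of the rectangle into the registers `0, 1, 2, 3`; all other
registers and the memory stay as they are. -/
def State.withQuery (s : State) (R : Rect) : State where
  reg i := match i with
    | 0 => R.x₁
    | 1 => R.x₂
    | 2 => R.y₁
    | 3 => R.y₂
    | i => s.reg i
  mem := s.mem

/-- The states in which the machine can be after the preprocessing and any finite number of
queries. -/
inductive Algorithm.Reach (A : Algorithm) (w : ℕ) {n : ℕ} (pts : Fin n → ℕ × ℕ) : State → Prop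
  | pre {t : ℕ} {s : State} (h : Exec w A.pre (inputState pts) t s) : A.Reach w pts s
  | query {s s' : State} {R : Rect} {t : ℕ} (hs : A.Reach w pts s) (hR : R.Fits w)
      (h : Exec w A.query (s.withQuery R) t s') : A.Reach w pts s'

/-- On the input `pts`, with words of `w` bits, the preprocessing halts within `Tpre` steps, and
after it every query, in every sequence of queries, halts within `Tquery` steps with a number in
register `0` that approximates the answer from below within a factor `1 - ε`. -/
def Algorithm.Approximates (A : Algorithm) (w : ℕ) {n : ℕ} (pts : Fin n → ℕ × ℕ)
    (ε Tpre Tquery : ℝ) : Prop :=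
  (∃ t s, Exec w A.pre (inputState pts) t s ∧ (t : ℝ) ≤ Tpre) ∧
  ∀ s, A.Reach w pts s → ∀ R : Rect, R.Fits w →
    ∃ t s', Exec w A.query (s.withQuery R) t s' ∧ (t : ℝ) ≤ Tquery ∧
      (1 - ε) * (lis (R.points pts) : ℝ) ≤ (s'.reg 0 : ℝ) ∧ s'.reg 0 ≤ lis (R.points pts)

/-- `log (1 / κ)`, read as `1` when it is smaller than `1`. -/
noncomputable def logInv (κ : ℝ) : ℝ := max 1 (Real.logb 2 (1 / κ))

/-- `(log (1 / κ) * log n / ε) ^ (D * (log (1 / κ)) ^ 2 / ε)`. -/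
noncomputable def overhead (D ε κ : ℝ) (n : ℕ) : ℝ :=
  (logInv κ * Real.logb 2 n / ε) ^ (D * logInv κ ^ 2 / ε)

end QueryLIS

/-!
The data structure approximates the answers of all queries by composing precomputed answers for
aligned blocks of columns.

Ranks replace the coordinates, so that the points become a permutation `f` of `0, …, n - 1`, and a
query asks for the length of a longest increasing subsequence of a window of columns `[lo, hi)` and
heights `[e₁, e₂)` (`lis_points_eq_windowLis`). Lengths are rounded down to a grid of distinguished
lengths with relative gaps `1 / q` (`grid`, `exists_grid_le`), of which only `O(q log n)` are at most
`n` (`gridSize_le_of_lt_two_pow`). For a set of consecutive columns and a starting height `e₁`, a row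
(`IsRow`) lists, for every grid length, a height at which an increasing subsequence of this length
can end; the heights are optimal up to a certain number of factors `1 + 1 / q` of the lengths.

Two neighbouring sets of columns are composed in `IsExtension.isRow`. An optimal subsequence crosses
from the left to the right at some height; up to this height it is covered by an entry of the row on
the left, and from there on by the row on the right whose starting height is the next one that occurs
as the height of a point. Therefore it suffices to keep, for every block on the right, one row for
each of its points. The lengths of the two parts add up, and rounding the sum costs one further
factor. All pairs of grid lengths are tried, and the row on the right is found by binary search among
the sorted heights of the block (`runs_extendRow`).

The preprocessing computes, for all `h ≤ H = ⌈log n⌉`, the rows of all aligned blocks of length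
`2 ^ h`. Those of single columns are exact; any other is obtained from the empty row by two
extensions, by the halves of the block (`runs_parentRow`), so that at most `2 * H` factors are lost. There are `n` rows on each level, so the
time is `n` times a polynomial in `log n` and `q` (`runs_preprocess`). A query splits its interval of
columns into at most `2 * H + 2` aligned blocks, first of increasing and then of decreasing length,
and extends the empty row by them (`runs_ascend`, `runs_descend`). Altogether `4 * H + 2` factors are
lost (`runs_answer`), and for `q = 4 * (H + 1) * 2 ^ a` with `2 ^ a ≥ 1 / ε` the result is at least
`1 - ε` times the answer (`one_sub_mul_le_of_le_pow`).

Both running times are bounded by powers of `z = log n / ε` with a constant exponent, apart from the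
factor `n` for the preprocessing. Since `z ≥ 1`, such powers are below the overhead granted
(`pow_le_overhead`), and `n ≤ n ^ (1 + κ)`.
-/

namespace QueryLIS

/-! ### Reasoning about programs -/

/-- Started in `s`, the command `c` halts, and its running time and its final state satisfy `Q`. -/
def Runs (w : ℕ) (c : Cmd) (s : State) (Q : ℕ → State → Prop) : Prop :=
  ∃ t s', Exec w c s t s' ∧ Q t s'

/-- Assignment of `v` to register `i`. -/
def State.set (s : State) (i v : ℕ) : State := ⟨Function.update s.reg i v, s.mem⟩

/-- Assignment of `v` to memory cell `a`. -/
def State.put (s : State) (a v : ℕ) : State := ⟨s.reg, Function.update s.mem a v⟩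

@[simp] theorem State.set_reg (s : State) (i v j : ℕ) :
    (s.set i v).reg j = if j = i then v else s.reg j := by
  simp [State.set, Function.update_apply]

@[simp] theorem State.set_mem (s : State) (i v : ℕ) : (s.set i v).mem = s.mem := rfl

@[simp] theorem State.put_reg (s : State) (i v : ℕ) : (s.put i v).reg = s.reg := rfl

theorem State.put_mem (s : State) (a v b : ℕ) :
    (s.put a v).mem b = if b = a then v else s.mem b := by
  simp [State.put, Function.update_apply]

instance : Add Expr := ⟨.bin .add⟩
instance : Sub Expr := ⟨.bin .sub⟩
instance : Mul Expr := ⟨.bin .mul⟩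
instance : Div Expr := ⟨.bin .div⟩
instance : Mod Expr := ⟨.bin .mod⟩

section Eval

variable (w : ℕ) (s : State) (a b : Expr)

theorem eval_lit (k : ℕ) : (Expr.lit k).eval w s = k % 2 ^ w := rfl
theorem eval_reg (i : ℕ) : (Expr.reg i).eval w s = s.reg i := rfl
theorem eval_load : (Expr.load a).eval w s = s.mem (a.eval w s) := rfl
theorem eval_add : (a + b).eval w s = (a.eval w s + b.eval w s) % 2 ^ w := rfl
theorem eval_sub : (a - b).eval w s = (a.eval w s - b.eval w s) % 2 ^ w := rfl
theorem eval_mul : (a * b).eval w s = (a.eval w s * b.eval w s) % 2 ^ w := rfl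
theorem eval_div : (a / b).eval w s = (a.eval w s / b.eval w s) % 2 ^ w := rfl
theorem eval_mod : (a % b).eval w s = (a.eval w s % b.eval w s) % 2 ^ w := rfl

theorem eval_lt (hw : 1 < 2 ^ w) :
    (Expr.bin .lt a b).eval w s = if a.eval w s < b.eval w s then 1 else 0 := by
  simp only [Expr.eval, Op.apply]
  split_ifs
  · exact Nat.mod_eq_of_lt hw
  · exact Nat.zero_mod _

theorem eval_lt_ne_zero (hw : 1 < 2 ^ w) :
    (Expr.bin .lt a b).eval w s ≠ 0 ↔ a.eval w s < b.eval w s := by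
  rw [eval_lt _ _ _ _ hw]; split_ifs with h <;> simp [h]

theorem eval_lt_eq_zero (hw : 1 < 2 ^ w) :
    (Expr.bin .lt a b).eval w s = 0 ↔ b.eval w s ≤ a.eval w s := by
  rw [eval_lt _ _ _ _ hw]; split_ifs with h <;> simp [h]
  omega

theorem eval_eq (hw : 1 < 2 ^ w) :
    (Expr.bin .eq a b).eval w s = if a.eval w s = b.eval w s then 1 else 0 := by
  simp only [Expr.eval, Op.apply]
  split_ifs
  · exact Nat.mod_eq_of_lt hw
  · exact Nat.zero_mod _

theorem cost_lit (k : ℕ) : (Expr.lit k).cost = 1 := rfl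
theorem cost_reg (i : ℕ) : (Expr.reg i).cost = 1 := rfl
theorem cost_load : (Expr.load a).cost = a.cost + 1 := rfl
theorem cost_bin (o : Op) : (Expr.bin o a b).cost = a.cost + b.cost + 1 := rfl
theorem cost_add : (a + b).cost = a.cost + b.cost + 1 := rfl
theorem cost_sub : (a - b).cost = a.cost + b.cost + 1 := rfl
theorem cost_mul : (a * b).cost = a.cost + b.cost + 1 := rfl
theorem cost_div : (a / b).cost = a.cost + b.cost + 1 := rfl
theorem cost_mod : (a % b).cost = a.cost + b.cost + 1 := rfl

end Eval

/-- The commands of a list, one after the other. -/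
def Cmd.block : List Cmd → Cmd
  | [] => .skip
  | c :: l => .seq c (Cmd.block l)

variable {w : ℕ} {s : State} {Q Q' : ℕ → State → Prop} {c d : Cmd} {e : Expr}

theorem Runs.mono (h : Runs w c s Q) (hQ : ∀ t s', Q t s' → Q' t s') : Runs w c s Q' := by
  obtain ⟨t, s', h, hq⟩ := h
  exact ⟨t, s', h, hQ _ _ hq⟩

theorem runs_skip (h : Q 1 s) : Runs w .skip s Q := ⟨_, _, .skip s, h⟩

theorem runs_nil (h : Q 1 s) : Runs w (.block []) s Q := runs_skip h

theorem runs_assign {i : ℕ} (v : ℕ) (hv : e.eval w s = v) (h : Q (e.cost + 1) (s.set i v)) :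
    Runs w (.assign i e) s Q := by
  subst hv
  exact ⟨_, _, .assign s i e, h⟩

theorem runs_store {a : Expr} (b v : ℕ) (hb : a.eval w s = b) (hv : e.eval w s = v)
    (h : Q (a.cost + e.cost + 1) (s.put b v)) : Runs w (.store a e) s Q := by
  subst hv hb
  exact ⟨_, _, .store s a e, h⟩

theorem runs_seq (h : Runs w c s fun t s' => Runs w d s' fun t' => Q (t + t' + 1)) :
    Runs w (.seq c d) s Q := by
  obtain ⟨t, s', h, t', s'', h', hq⟩ := h
  exact ⟨_, _, .seq h h', hq⟩

theorem runs_cons {l : List Cmd}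
    (h : Runs w c s fun t s' => Runs w (.block l) s' fun t' => Q (t + t' + 1)) :
    Runs w (.block (c :: l)) s Q := runs_seq h

theorem runs_ite (h₁ : e.eval w s ≠ 0 → Runs w c s fun t => Q (e.cost + t + 1))
    (h₂ : e.eval w s = 0 → Runs w d s fun t => Q (e.cost + t + 1)) :
    Runs w (.ite e c d) s Q := by
  by_cases he : e.eval w s = 0
  · obtain ⟨t, s', h, hq⟩ := h₂ he
    exact ⟨_, _, .ite_false he h, hq⟩
  · obtain ⟨t, s', h, hq⟩ := h₁ he
    exact ⟨_, _, .ite_true he h, hq⟩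

/-- A loop whose body leads from `I (i + 1)` to `I i` stops after at most `i` rounds if it cannot
continue from `I 0`. -/
theorem runs_loop (I : ℕ → State → Prop) (T : ℕ) {N : ℕ} (hI : I N s)
    (hbody : ∀ i s, I (i + 1) s → e.eval w s ≠ 0 → Runs w c s fun t s' => t ≤ T ∧ I i s')
    (hzero : ∀ s, I 0 s → e.eval w s = 0) :
    Runs w (.loop e c) s fun t s' =>
      t ≤ N * (T + e.cost + 1) + e.cost + 1 ∧ e.eval w s' = 0 ∧ ∃ i ≤ N, I i s' := by
  induction N generalizing s with
  | zero => exact ⟨_, _, .loop_false (hzero s hI), by simp, hzero s hI, 0, le_rfl, hI⟩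
  | succ N ih =>
    by_cases he : e.eval w s = 0
    · exact ⟨_, _, .loop_false he, by omega, he, _, le_rfl, hI⟩
    · obtain ⟨t, s', h, ht, hs'⟩ := hbody N s hI he
      obtain ⟨t', s'', h', ht', he', i, hi, hs''⟩ := ih hs'
      exact ⟨_, _, .loop_true he h h', by rw [Nat.succ_mul]; omega, he', i, by omega, hs''⟩

/-- A loop whose body leads from `I i` to `I (i + 1)` for `i < N`, run to `I N`. -/
theorem runs_loop_up (I : ℕ → State → Prop) (T N : ℕ) (hI : I 0 s)
    (hbody : ∀ i s, i < N → I i s →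
      e.eval w s ≠ 0 ∧ Runs w c s fun t s' => t ≤ T ∧ I (i + 1) s')
    (hend : ∀ s, I N s → e.eval w s = 0) :
    Runs w (.loop e c) s fun t s' => t ≤ N * (T + e.cost + 1) + e.cost + 1 ∧ I N s' := by
  suffices H : ∀ k i s, i + k = N → I i s → Runs w (.loop e c) s fun t s' =>
      t ≤ k * (T + e.cost + 1) + e.cost + 1 ∧ I N s' from H N 0 s (by omega) hI
  intro k
  induction k with
  | zero =>
    intro i s hi hs
    obtain rfl : i = N := by omega
    exact ⟨_, _, .loop_false (hend s hs), by simp, hs⟩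
  | succ k ih =>
    intro i s hi hs
    obtain ⟨he, t, s', h, ht, hs'⟩ := hbody i s (by omega) hs
    obtain ⟨t', s'', h', ht', hs''⟩ := ih (i + 1) s' (by omega) hs'
    exact ⟨_, _, .loop_true he h h', by rw [Nat.succ_mul]; omega, hs''⟩

/-- `for i = 0, …, N - 1 do c`, with the value of the expression `e` for `N`. -/
def Cmd.for (i : ℕ) (e : Expr) (c : Cmd) : Cmd :=
  .seq (.assign i (.lit 0)) (.loop (.bin .lt (.reg i) e) (.seq c (.assign i (.reg i + .lit 1))))

/-- The invariant `I k` of a counting loop speaks of the states with `k` in the counter `i`. -/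
theorem runs_for {i : ℕ} (I : ℕ → State → Prop) (T N : ℕ) (hN : N < 2 ^ w)
    (hI : I 0 (s.set i 0)) (he : ∀ k s, k ≤ N → s.reg i = k → I k s → e.eval w s = N)
    (hbody : ∀ k s, k < N → s.reg i = k → I k s → Runs w c s fun t s' =>
      t ≤ T ∧ s'.reg i = k ∧ I (k + 1) (s'.set i (k + 1))) :
    Runs w (.for i e c) s fun t s' => t ≤ N * (T + e.cost + 8) + e.cost + 6 ∧
      s'.reg i = N ∧ I N s' := by
  by_cases hw : 1 < 2 ^ w
  · refine runs_seq (runs_assign 0 (by simp [eval_lit]) ?_)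
    refine (runs_loop_up (fun k s => k ≤ N ∧ s.reg i = k ∧ I k s) (T + 5) N
      ⟨by simp, by simp, hI⟩ ?_ ?_).mono ?_
    · rintro k s hk ⟨-, hik, hs⟩
      refine ⟨by simp [eval_lt _ _ _ _ hw, eval_reg, hik, he k s hk.le hik hs, hk], ?_⟩
      refine runs_seq ((hbody k s hk hik hs).mono ?_)
      rintro t s' ⟨ht, hik', hs'⟩
      refine runs_assign (k + 1) ?_ ⟨?_, by omega, by simp, hs'⟩
      · rw [eval_add, eval_reg, eval_lit, hik', Nat.mod_eq_of_lt hw, Nat.mod_eq_of_lt (by omega)]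
      · simp only [cost_add, cost_reg, cost_lit]; omega
    · rintro s ⟨-, hik, hs⟩
      simp [eval_lt _ _ _ _ hw, eval_reg, hik, he N s le_rfl hik hs]
    · rintro t s' ⟨ht, -, h⟩
      refine ⟨?_, h⟩
      simp only [cost_bin, cost_reg, cost_lit] at ht ⊢
      have : N * (T + 5 + (1 + e.cost + 1) + 1) = N * (T + e.cost + 8) := by ring
      omega
  · obtain rfl : N = 0 := by omega
    refine runs_seq (runs_assign 0 (by simp [eval_lit]) ?_)
    have hev : Expr.eval w (s.set i 0) (.bin .lt (.reg i) e) = 0 := by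
      simp [Expr.eval, Op.apply, he 0 _ le_rfl (by simp) hI]
    exact ⟨_, _, .loop_false hev, by simp only [cost_bin, cost_reg, cost_lit]; omega, by simp, hI⟩

/-! ### The layout of the memory -/

/-- The cells behind the input are split into eight interleaved arrays: `cell n k v` is the address
of the entry `v` of the array `k`. The arrays `0`, `1` and `2` hold the sorted levels of the
`x`-coordinates, of the `y`-coordinates and of the permutation, array `3` holds the grid of lengths,
and array `4` holds the rows; the others are not used. -/
def cell (n k v : ℕ) : ℕ := 2 * n + 8 * v + k

/-- The expression for `cell n k v`, where register `5` holds `2 * n`. -/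
def cellE (k : ℕ) (e : Expr) : Expr := .reg 5 + .lit 8 * e + .lit k

theorem cell_inj {n k v k' v' : ℕ} (hk : k < 8) (hk' : k' < 8) :
    cell n k v = cell n k' v' ↔ k = k' ∧ v = v' := by
  unfold cell; omega

theorem cost_cellE (k : ℕ) (e : Expr) : (cellE k e).cost = e.cost + 6 := by
  simp only [cellE, cost_add, cost_mul, cost_reg, cost_lit]; omega

theorem eval_cellE {n k v : ℕ} (hb : s.reg 5 = 2 * n) (hv : e.eval w s = v)
    (h : cell n k v < 2 ^ w) (h8 : 8 < 2 ^ w) : (cellE k e).eval w s = cell n k v := by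
  unfold cell at h
  simp only [cellE, eval_add, eval_mul, eval_reg, eval_lit, hb, hv]
  rw [Nat.mod_eq_of_lt h8, Nat.mod_eq_of_lt (a := 8 * v) (by omega),
    Nat.mod_eq_of_lt (a := 2 * n + 8 * v) (by omega), Nat.mod_eq_of_lt (a := k) (by omega),
    Nat.mod_eq_of_lt h, cell]

/-! ### Longest increasing subsequences -/

theorem card_le_lis {S T : Finset (ℕ × ℕ)} (hT : T ⊆ S) (hi : IsIncreasing T) :
    T.card ≤ lis S :=
  Finset.le_sup (f := Finset.card) (Finset.mem_filter.2 ⟨Finset.mem_powerset.2 hT, hi⟩)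

theorem exists_card_eq_lis (S : Finset (ℕ × ℕ)) :
    ∃ T ⊆ S, IsIncreasing T ∧ T.card = lis S := by
  have hne : (S.powerset.filter IsIncreasing).Nonempty :=
    ⟨∅, Finset.mem_filter.2 ⟨by simp, by simp [IsIncreasing]⟩⟩
  obtain ⟨T, hT, h⟩ := Finset.exists_mem_eq_sup _ hne Finset.card
  rw [Finset.mem_filter, Finset.mem_powerset] at hT
  exact ⟨T, hT.1, hT.2, h.symm⟩

theorem lis_mono {S S' : Finset (ℕ × ℕ)} (h : S ⊆ S') : lis S ≤ lis S' := by
  obtain ⟨T, hT, hi, hc⟩ := exists_card_eq_lis S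
  exact hc ▸ card_le_lis (hT.trans h) hi

theorem lis_le_card (S : Finset (ℕ × ℕ)) : lis S ≤ S.card := by
  obtain ⟨T, hT, -, hc⟩ := exists_card_eq_lis S
  exact hc ▸ Finset.card_le_card hT

/-- Only the relative order of the coordinates matters. -/
theorem lis_image_le {ι : Type*} [DecidableEq ι] (I : Finset ι) (g g' : ι → ℕ × ℕ)
    (h₁ : ∀ i ∈ I, ∀ j ∈ I, (g i).1 < (g j).1 → (g' i).1 < (g' j).1)
    (h₂ : ∀ i ∈ I, ∀ j ∈ I, (g i).2 < (g j).2 → (g' i).2 < (g' j).2) :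
    lis (I.image g) ≤ lis (I.image g') := by
  obtain rfl | ⟨i₀, -⟩ := I.eq_empty_or_nonempty
  · simp
  have : Nonempty ι := ⟨i₀⟩
  obtain ⟨T, hT, hi, hc⟩ := exists_card_eq_lis (I.image g)
  have hex : ∀ p ∈ T, ∃ i ∈ I, g i = p := fun p hp => Finset.mem_image.1 (hT hp)
  choose! k hkI hk using hex
  have hlt : ∀ p ∈ T, ∀ q ∈ T, p ≠ q →
      ((g' (k p)).1 < (g' (k q)).1 ∧ (g' (k p)).2 < (g' (k q)).2) ∨
      ((g' (k q)).1 < (g' (k p)).1 ∧ (g' (k q)).2 < (g' (k p)).2) := by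
    intro p hp q hq hpq
    have h := hi p hp q hq hpq
    rw [← hk p hp, ← hk q hq] at h
    exact h.imp
      (fun h => ⟨h₁ _ (hkI p hp) _ (hkI q hq) h.1, h₂ _ (hkI p hp) _ (hkI q hq) h.2⟩)
      (fun h => ⟨h₁ _ (hkI q hq) _ (hkI p hp) h.1, h₂ _ (hkI q hq) _ (hkI p hp) h.2⟩)
  have hinj : Set.InjOn (fun p => g' (k p)) T := by
    intro p hp q hq hpq
    by_contra hne
    have h := hlt p hp q hq hne
    simp only at hpq
    rw [hpq] at h
    omega
  rw [← hc, ← Finset.card_image_of_injOn hinj]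
  refine card_le_lis (fun p hp => ?_) ?_
  · obtain ⟨q, hq, rfl⟩ := Finset.mem_image.1 hp
    exact Finset.mem_image_of_mem _ (hkI q hq)
  · intro p hp q hq hpq
    obtain ⟨p', hp', rfl⟩ := Finset.mem_image.1 hp
    obtain ⟨q', hq', rfl⟩ := Finset.mem_image.1 hq
    exact hlt p' hp' q' hq' fun h => hpq (by rw [h])

/-- The points `(i, f i)` with `lo ≤ i < hi` and `e₁ ≤ f i < e₂`. -/
def window (f : ℕ → ℕ) (lo hi e₁ e₂ : ℕ) : Finset (ℕ × ℕ) :=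
  ((Finset.Ico lo hi).filter fun i => e₁ ≤ f i ∧ f i < e₂).image fun i => (i, f i)

theorem mem_window {f : ℕ → ℕ} {lo hi e₁ e₂ : ℕ} {p : ℕ × ℕ} :
    p ∈ window f lo hi e₁ e₂ ↔ lo ≤ p.1 ∧ p.1 < hi ∧ e₁ ≤ p.2 ∧ p.2 < e₂ ∧ p.2 = f p.1 := by
  obtain ⟨x, y⟩ := p
  simp only [window, Finset.mem_image, Finset.mem_filter, Finset.mem_Ico, Prod.mk.injEq]
  constructor
  · rintro ⟨i, h, rfl, rfl⟩; omega
  · rintro ⟨h₁, h₂, h₃, h₄, h₅⟩; subst h₅; exact ⟨x, by omega, rfl, rfl⟩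

/-- The length of a longest increasing subsequence of `f lo, …, f (hi - 1)` with values in
`[e₁, e₂)`. -/
def windowLis (f : ℕ → ℕ) (lo hi e₁ e₂ : ℕ) : ℕ := lis (window f lo hi e₁ e₂)

section Window

variable {f : ℕ → ℕ} {lo mid hi e₁ e e₂ lo' hi' e₁' e₂' : ℕ}

/-- A window can be enlarged; points outside the range of values do not matter. -/
theorem windowLis_le (h : ∀ i, lo ≤ i → i < hi → e₁ ≤ f i → f i < e₂ →
    lo' ≤ i ∧ i < hi' ∧ e₁' ≤ f i ∧ f i < e₂') :
    windowLis f lo hi e₁ e₂ ≤ windowLis f lo' hi' e₁' e₂' := by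
  refine lis_mono fun p hp => ?_
  rw [mem_window] at hp ⊢
  obtain ⟨h₁, h₂, h₃, h₄, h₅⟩ := hp
  rw [h₅] at h₃ h₄
  have := h _ h₁ h₂ h₃ h₄
  rw [← h₅] at this
  omega

theorem windowLis_le_length : windowLis f lo hi e₁ e₂ ≤ hi - lo :=
  (lis_le_card _).trans <| Finset.card_image_le.trans <|
    (Finset.card_filter_le _ _).trans (Nat.card_Ico _ _).le

theorem exists_of_windowLis_pos (h : 0 < windowLis f lo hi e₁ e₂) :
    ∃ i, lo ≤ i ∧ i < hi ∧ e₁ ≤ f i ∧ f i < e₂ := by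
  obtain ⟨p, hp⟩ := Finset.card_pos.1 (h.trans_le (lis_le_card _))
  rw [mem_window] at hp
  exact ⟨p.1, by omega⟩

/-- Increasing subsequences of a lower left and an upper right window can be joined. -/
theorem windowLis_add_le (h₁ : lo ≤ mid) (h₂ : mid ≤ hi) (h₃ : e₁ ≤ e) (h₄ : e ≤ e₂) :
    windowLis f lo mid e₁ e + windowLis f mid hi e e₂ ≤ windowLis f lo hi e₁ e₂ := by
  obtain ⟨T, hT, hinc, hc⟩ := exists_card_eq_lis (window f lo mid e₁ e)
  obtain ⟨T', hT', hinc', hc'⟩ := exists_card_eq_lis (window f mid hi e e₂)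
  have hT₁ := fun p hp => mem_window.1 (@hT p hp)
  have hT₂ := fun p hp => mem_window.1 (@hT' p hp)
  rw [windowLis, windowLis, ← hc, ← hc', ← Finset.card_union_of_disjoint]
  · refine card_le_lis (fun p hp => mem_window.2 ?_) ?_
    · rcases Finset.mem_union.1 hp with hp | hp
      · have := hT₁ p hp; omega
      · have := hT₂ p hp; omega
    · intro p hp q hq hpq
      rcases Finset.mem_union.1 hp with hp | hp <;> rcases Finset.mem_union.1 hq with hq | hq
      · exact hinc p hp q hq hpq
      · have := hT₁ p hp; have := hT₂ q hq; omega
      · have := hT₁ q hq; have := hT₂ p hp; omega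
      · exact hinc' p hp q hq hpq
  · refine Finset.disjoint_left.2 fun p hp hp' => ?_
    have := hT₁ p hp; have := hT₂ p hp'; omega

/-- An increasing subsequence passes from a left to a right window at some height `e`. -/
theorem exists_windowLis_le_add (h₃ : e₁ ≤ e₂) :
    ∃ e, e₁ ≤ e ∧ e ≤ e₂ ∧
      windowLis f lo hi e₁ e₂ ≤ windowLis f lo mid e₁ e + windowLis f mid hi e e₂ := by
  obtain ⟨T, hT, hinc, hc⟩ := exists_card_eq_lis (window f lo hi e₁ e₂)
  have hT₁ := fun p hp => mem_window.1 (@hT p hp)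
  -- just above the last point on the left
  set e := max e₁ ((T.filter fun p => p.1 < mid).sup fun p => p.2 + 1) with he
  have hlow : ∀ p ∈ T, p.1 < mid → p.2 < e := fun p hp hpm =>
    lt_max_of_lt_right (Nat.lt_of_succ_le
      (Finset.le_sup (f := fun p : ℕ × ℕ => p.2 + 1) (Finset.mem_filter.2 ⟨hp, hpm⟩)))
  have hhigh : ∀ q ∈ T, ¬ q.1 < mid → e ≤ q.2 := by
    intro q hq hqm
    refine max_le (hT₁ q hq).2.2.1 (Finset.sup_le fun p hp => ?_)
    obtain ⟨hp, hpm⟩ := Finset.mem_filter.1 hp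
    have := hinc p hp q hq (by rintro rfl; exact hqm hpm)
    omega
  refine ⟨e, le_max_left _ _, max_le h₃ (Finset.sup_le fun p hp => ?_), ?_⟩
  · have := hT₁ p (Finset.mem_filter.1 hp).1; omega
  · rw [windowLis, ← hc, ← Finset.card_filter_add_card_filter_not (s := T) fun p => p.1 < mid]
    refine Nat.add_le_add (card_le_lis (fun p hp => mem_window.2 ?_) ?_)
      (card_le_lis (fun p hp => mem_window.2 ?_) ?_)
    · obtain ⟨hp, hpm⟩ := Finset.mem_filter.1 hp
      have := hT₁ p hp; have := hlow p hp hpm; omega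
    · exact fun p hp q hq => hinc p (Finset.mem_filter.1 hp).1 q (Finset.mem_filter.1 hq).1
    · obtain ⟨hp, hpm⟩ := Finset.mem_filter.1 hp
      have := hT₁ p hp; have := hhigh p hp hpm; omega
    · exact fun p hp q hq => hinc p (Finset.mem_filter.1 hp).1 q (Finset.mem_filter.1 hq).1

end Window

/-! ### The grid of lengths -/

/-- The lengths `0, 1, …` that are distinguished: the gap above `t` is `1 + ⌊t / q⌋`. Up to `q` these
are all lengths, and from there on they grow by factors of about `1 + 1 / q`. -/
def grid (q : ℕ) : ℕ → ℕ
  | 0 => 0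
  | j + 1 => grid q j + (1 + grid q j / q)

theorem grid_succ (q j : ℕ) : grid q (j + 1) = grid q j + (1 + grid q j / q) := rfl

theorem grid_strictMono (q : ℕ) : StrictMono (grid q) :=
  strictMono_nat_of_lt_succ fun _ =>
  Nat.lt_add_of_pos_right (Nat.add_pos_left one_pos _)

theorem le_grid (q j : ℕ) : j ≤ grid q j := (grid_strictMono q).id_le j

/-- The number of grid lengths up to `n`. -/
def gridSize (q n : ℕ) : ℕ := Nat.findGreatest (fun j => grid q j ≤ n) n + 1

theorem lt_gridSize {q n j : ℕ} : j < gridSize q n ↔ grid q j ≤ n := by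
  rw [gridSize, Nat.lt_succ_iff]
  constructor
  · intro h
    exact ((grid_strictMono q).monotone h).trans
      (Nat.findGreatest_spec (P := fun j => grid q j ≤ n) (Nat.zero_le n) (Nat.zero_le n))
  · exact fun h => Nat.le_findGreatest ((le_grid q j).trans h) h

theorem gridSize_le (q n : ℕ) : gridSize q n ≤ n + 1 :=
  Nat.succ_le_succ (Nat.findGreatest_le n)

/-- The grid lengths double within `q` steps. -/
theorem grid_add_self (q j : ℕ) (hq : 0 < q) : 2 * grid q j ≤ grid q (j + q) := by
  have h : ∀ i, grid q j + i * (1 + grid q j / q) ≤ grid q (j + i) := by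
    intro i
    induction i with
    | zero => simp
    | succ i ih =>
      have : grid q j / q ≤ grid q (j + i) / q :=
        Nat.div_le_div_right ((grid_strictMono q).monotone (Nat.le_add_right j i))
      rw [← Nat.add_assoc, grid_succ, Nat.succ_mul]
      omega
  have h₁ := h q
  have h₂ := Nat.lt_mul_div_succ (grid q j) hq
  have h₃ : q * (grid q j / q + 1) = q * (1 + grid q j / q) := by ring
  omega

theorem two_pow_le_grid (q i : ℕ) (hq : 0 < q) : 2 ^ i ≤ grid q (1 + i * q) := by
  induction i with
  | zero => simp [grid]
  | succ i ih =>
    have := grid_add_self q (1 + i * q) hq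
    rw [Nat.succ_mul, ← Nat.add_assoc, pow_succ]
    omega

theorem gridSize_le_of_lt_two_pow {q n i : ℕ} (hq : 0 < q) (h : n < 2 ^ i) :
    gridSize q n ≤ 1 + i * q := by
  by_contra hlt
  have h₁ := lt_gridSize.1 (not_le.1 hlt)
  have h₂ := two_pow_le_grid q i hq
  omega

/-- Rounding down to the grid costs a factor of at most `1 + 1 / q`. -/
theorem exists_grid_le (q n v : ℕ) :
    ∃ j < gridSize q n, grid q j ≤ v ∧ ((min v n : ℕ) : ℝ) ≤ (1 + 1 / (q : ℝ)) * grid q j := by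
  set j := Nat.findGreatest (fun j => grid q j ≤ min v n) n
  have hj : grid q j ≤ min v n :=
    Nat.findGreatest_spec (P := fun j => grid q j ≤ min v n) (Nat.zero_le n) (Nat.zero_le _)
  have hj' : min v n < grid q (j + 1) := by
    by_contra h
    have := Nat.le_findGreatest (P := fun j => grid q j ≤ min v n) (n := n) (m := j + 1)
      ((le_grid q _).trans ((not_lt.1 h).trans (min_le_right _ _))) (not_lt.1 h)
    omega
  refine ⟨j, lt_gridSize.2 (hj.trans (min_le_right _ _)), hj.trans (min_le_left _ _), ?_⟩
  rw [grid_succ] at hj'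
  have h₁ : ((min v n : ℕ) : ℝ) ≤ grid q j + (grid q j / q : ℕ) := by exact_mod_cast (by omega)
  have h₂ : ((grid q j / q : ℕ) : ℝ) ≤ (grid q j : ℝ) / q := Nat.cast_div_le
  have h₃ : (1 + 1 / (q : ℝ)) * grid q j = grid q j + (grid q j : ℝ) / q := by ring
  linarith

/-! ### Rows -/

/-- A row is a compressed description of `e ↦ windowLis f lo hi e₁ e`: the entry `j` is a height
at which the length `grid q j` is reached, or `n + 1`. The heights are the best possible up to
factors `1 + 1 / q` for the lengths, `d` in number. -/
structure IsRow (f : ℕ → ℕ) (n q lo hi e₁ d : ℕ) (T : ℕ → ℕ) : Prop where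
  le_inf : ∀ j < gridSize q n, T j ≤ n + 1
  sound : ∀ j < gridSize q n, T j ≤ n → e₁ ≤ T j ∧ grid q j ≤ windowLis f lo hi e₁ (T j)
  complete : ∀ e, e₁ ≤ e → e ≤ n → ∃ j < gridSize q n, T j ≤ e ∧
    (windowLis f lo hi e₁ e : ℝ) ≤ (1 + 1 / (q : ℝ)) ^ d * grid q j

section Rows

variable {f : ℕ → ℕ} {n q lo cur hi e₁ d d' : ℕ} {T T' : ℕ → ℕ}

theorem one_le_factor (q : ℕ) : (1 : ℝ) ≤ 1 + 1 / (q : ℝ) := by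
  have : (0 : ℝ) ≤ 1 / (q : ℝ) := by positivity
  linarith

theorem IsRow.congr (h : IsRow f n q lo hi e₁ d T) (hT : ∀ j < gridSize q n, T' j = T j) :
    IsRow f n q lo hi e₁ d T' where
  le_inf j hj := by rw [hT j hj]; exact h.le_inf j hj
  sound j hj := by rw [hT j hj]; exact h.sound j hj
  complete e h₁ h₂ := by
    obtain ⟨j, hj, h₃⟩ := h.complete e h₁ h₂
    exact ⟨j, hj, by rwa [hT j hj]⟩

theorem IsRow.mono (h : IsRow f n q lo hi e₁ d T) (hd : d ≤ d') :
    IsRow f n q lo hi e₁ d' T where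
  le_inf := h.le_inf
  sound := h.sound
  complete e h₁ h₂ := by
    obtain ⟨j, hj, h₃, h₄⟩ := h.complete e h₁ h₂
    refine ⟨j, hj, h₃, h₄.trans ?_⟩
    gcongr
    exact one_le_factor q

theorem isRow_empty (he : e₁ ≤ n + 1) (hT : ∀ j, T j = if j = 0 then e₁ else n + 1) :
    IsRow f n q lo lo e₁ d T where
  le_inf j _ := by rw [hT]; split_ifs <;> omega
  sound j _ h := by
    rw [hT] at h ⊢
    split_ifs at h ⊢ with hj
    · subst hj; exact ⟨le_rfl, Nat.zero_le _⟩
    · omega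
  complete e h₁ _ := by
    refine ⟨0, lt_gridSize.2 (Nat.zero_le n), by simpa [hT] using h₁, ?_⟩
    have : windowLis f lo lo e₁ e = 0 := by
      have := windowLis_le_length (f := f) (lo := lo) (hi := lo) (e₁ := e₁) (e₂ := e); omega
    simp [this, grid]

theorem isRow_singleton (hlo : f lo < n) (hn : 1 ≤ n)
    (hT : ∀ j, T j = if j = 0 then f lo else if j = 1 then f lo + 1 else n + 1) :
    IsRow f n q lo (lo + 1) (f lo) d T where
  le_inf j _ := by rw [hT]; split_ifs <;> omega
  sound j _ h := by
    rw [hT] at h ⊢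
    split_ifs at h ⊢ with h₀ h₁
    · subst h₀; exact ⟨le_rfl, Nat.zero_le _⟩
    · subst h₁
      refine ⟨by omega, ?_⟩
      have := card_le_lis (S := window f lo (lo + 1) (f lo) (f lo + 1)) (T := {(lo, f lo)})
        (by simp [mem_window]) (by simp [IsIncreasing])
      simpa [grid, windowLis] using this
    · omega
  complete e h₁ _ := by
    by_cases he : f lo < e
    · refine ⟨1, lt_gridSize.2 (by simpa [grid] using hn), by simpa [hT] using he, ?_⟩
      have := windowLis_le_length (f := f) (lo := lo) (hi := lo + 1) (e₁ := f lo) (e₂ := e)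
      have h₂ : (windowLis f lo (lo + 1) (f lo) e : ℝ) ≤ 1 := by exact_mod_cast (by omega)
      have h₃ := one_le_pow₀ (n := d) (one_le_factor q)
      simpa [grid] using h₂.trans h₃
    · refine ⟨0, lt_gridSize.2 (Nat.zero_le n), by simpa [hT] using h₁, ?_⟩
      have : windowLis f lo (lo + 1) (f lo) e = 0 := by
        by_contra hne
        obtain ⟨i, hi⟩ := exists_of_windowLis_pos (Nat.pos_of_ne_zero hne)
        omega
      simp [this, grid]

/-- The height reached from height `e` by a subsequence of length `grid q j` of the block, where
`r e` is the first row of the block that starts at height `e` or above, if there is one. -/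
def climb (n len : ℕ) (r : ℕ → ℕ) (g : ℕ → ℕ → ℕ) (e j : ℕ) : ℕ :=
  if j = 0 then e else if r e < len then g (r e) j else n + 1

/-- The entries of `T'` are the least heights reached by climbing from entries of `T`. -/
structure IsExtension (n q len : ℕ) (r : ℕ → ℕ) (g : ℕ → ℕ → ℕ) (T T' : ℕ → ℕ) : Prop where
  le_inf : ∀ j < gridSize q n, T' j ≤ n + 1
  attained : ∀ j < gridSize q n, T' j = n + 1 ∨ ∃ j₁ < gridSize q n, ∃ j₂ < gridSize q n,
    grid q j ≤ grid q j₁ + grid q j₂ ∧ T' j = climb n len r g (T j₁) j₂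
  le : ∀ j < gridSize q n, ∀ j₁ < gridSize q n, ∀ j₂ < gridSize q n,
    grid q j ≤ grid q j₁ + grid q j₂ → T' j ≤ climb n len r g (T j₁) j₂

/-- A row for the columns from `lo` to `cur` and rows for the adjacent block of columns from `cur`
to `hi` make a row for the columns from `lo` to `hi`. The heights `a k`, in increasing order, are
those of the points of the block. -/
theorem IsExtension.isRow {len : ℕ} {r a : ℕ → ℕ} {g : ℕ → ℕ → ℕ}
    (h : IsExtension n q len r g T T') (hT : IsRow f n q lo cur e₁ d T)
    (hlo : lo ≤ cur) (hhi : cur ≤ hi) (hn : hi ≤ n)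
    (hg : ∀ k < len, IsRow f n q cur hi (a k) d (g k)) (ha : ∀ k < len, a k < n)
    (hr : ∀ e, r e < len → e ≤ a (r e))
    (hr' : ∀ e i, cur ≤ i → i < hi → e ≤ f i → r e < len ∧ a (r e) ≤ f i) :
    IsRow f n q lo hi e₁ (d + 1) T' where
  le_inf := h.le_inf
  sound j hj hle := by
    obtain h' | ⟨j₁, hj₁, j₂, hj₂, hjj, heq⟩ := h.attained j hj
    · omega
    rw [heq] at hle ⊢
    unfold climb at hle ⊢
    split_ifs at hle ⊢ with h₀ hlt
    · subst h₀
      obtain ⟨h₁, h₂⟩ := hT.sound j₁ hj₁ hle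
      refine ⟨h₁, hjj.trans ((Nat.add_le_add_right h₂ _).trans ?_)⟩
      rw [grid, Nat.add_zero]
      exact windowLis_le fun i h₃ h₄ h₅ h₆ => ⟨h₃, h₄.trans_le hhi, h₅, h₆⟩
    · -- the row of the block starts at height `a (r (T j₁)) ≥ T j₁`, so the subsequences can be joined
      have h₃ := hr _ hlt
      have h₄ := ha _ hlt
      obtain ⟨h₁, h₂⟩ := hT.sound j₁ hj₁ (by omega)
      obtain ⟨h₅, h₆⟩ := (hg _ hlt).sound j₂ hj₂ hle
      refine ⟨by omega, hjj.trans ((Nat.add_le_add h₂ (h₆.trans ?_)).trans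
        (windowLis_add_le hlo hhi h₁ (h₃.trans h₅)))⟩
      exact windowLis_le fun i h₇ h₈ h₉ h₁₀ => ⟨h₇, h₈, h₃.trans h₉, h₁₀⟩
    · omega
  complete e h₁ h₂ := by
    -- an optimal subsequence enters the block at height `e'`; both of its parts are replaced by
    -- entries of rows, and the sum of their lengths is rounded down to the grid
    obtain ⟨e', he', he'', hsplit⟩ :=
      exists_windowLis_le_add (f := f) (lo := lo) (mid := cur) (hi := hi) h₁
    obtain ⟨j₁, hj₁, hT₁, hL₁⟩ := hT.complete e' he' (he''.trans h₂)
    obtain ⟨j₂, hj₂, hc, hL₂⟩ : ∃ j₂ < gridSize q n, climb n len r g (T j₁) j₂ ≤ e ∧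
        (windowLis f cur hi e' e : ℝ) ≤ (1 + 1 / (q : ℝ)) ^ d * grid q j₂ := by
      rcases Nat.eq_zero_or_pos (windowLis f cur hi e' e) with h₀ | hpos
      · exact ⟨0, lt_gridSize.2 (Nat.zero_le n), by simpa [climb] using hT₁.trans he'',
          by simp [h₀, grid]⟩
      · obtain ⟨i, hi₁, hi₂, hi₃, hi₄⟩ := exists_of_windowLis_pos hpos
        obtain ⟨hlt, hle⟩ := hr' (T j₁) i hi₁ hi₂ (hT₁.trans hi₃)
        obtain ⟨j₂, hj₂, hc, hL⟩ := (hg _ hlt).complete e (by omega) h₂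
        refine ⟨j₂, hj₂, ?_, le_trans ?_ hL⟩
        · unfold climb
          split_ifs
          · omega
          · exact hc
        · exact_mod_cast windowLis_le fun i' h₃ h₄ h₅ h₆ =>
            ⟨h₃, h₄, (hr' (T j₁) i' h₃ h₄ (hT₁.trans h₅)).2, h₆⟩
    obtain ⟨j, hj, hle, hfac⟩ := exists_grid_le q n (grid q j₁ + grid q j₂)
    refine ⟨j, hj, (h.le j hj j₁ hj₁ j₂ hj₂ hle).trans hc, ?_⟩
    have hA := one_le_pow₀ (n := d) (one_le_factor q)
    have hlen : (windowLis f lo hi e₁ e : ℝ) ≤ n := by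
      have := windowLis_le_length (f := f) (lo := lo) (hi := hi) (e₁ := e₁) (e₂ := e)
      exact_mod_cast (by omega)
    have hsplit' : (windowLis f lo hi e₁ e : ℝ) ≤
        windowLis f lo cur e₁ e' + windowLis f cur hi e' e := by exact_mod_cast hsplit
    have hmin : (windowLis f lo hi e₁ e : ℝ) ≤
        (1 + 1 / (q : ℝ)) ^ d * ((min (grid q j₁ + grid q j₂) n : ℕ) : ℝ) := by
      rcases min_choice (grid q j₁ + grid q j₂) n with h' | h' <;> rw [h']
      · push_cast; linarith
      · nlinarith
    calc _ ≤ _ := hmin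
      _ ≤ (1 + 1 / (q : ℝ)) ^ d * ((1 + 1 / (q : ℝ)) * grid q j) := by gcongr
      _ = _ := by ring

end Rows

/-! ### Sorted blocks and binary search -/

/-- The number of values below `y` among `f s, …, f (e - 1)`. -/
def countBelow (f : ℕ → ℕ) (s e y : ℕ) : ℕ := ((Finset.Ico s e).filter fun i => f i < y).card

/-- The entries `a s, …, a (e - 1)` are `f s, …, f (e - 1)` in increasing order. -/
def Sorts (f a : ℕ → ℕ) (s e : ℕ) : Prop :=
  ∀ i, s ≤ i → i < e → a (s + countBelow f s e (f i)) = f i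

section Sorting

variable {f a : ℕ → ℕ} {s m e i y y' k k' r : ℕ}

theorem countBelow_le : countBelow f s e y ≤ e - s :=
  (Finset.card_filter_le _ _).trans (Nat.card_Ico _ _).le

theorem countBelow_mono (h : y ≤ y') : countBelow f s e y ≤ countBelow f s e y' :=
  Finset.card_le_card fun _ hi => by
    rw [Finset.mem_filter] at hi ⊢
    exact ⟨hi.1, hi.2.trans_le h⟩

theorem countBelow_lt_countBelow (h₁ : s ≤ i) (h₂ : i < e) (h : f i < y) :
    countBelow f s e (f i) < countBelow f s e y := by
  refine Finset.card_lt_card ((Finset.ssubset_iff_of_subset fun j hj => ?_).2 ⟨i, ?_, ?_⟩)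
  · rw [Finset.mem_filter] at hj ⊢
    exact ⟨hj.1, hj.2.trans h⟩
  · simp [h₁, h₂, h]
  · simp

theorem countBelow_self_lt (h₁ : s ≤ i) (h₂ : i < e) : countBelow f s e (f i) < e - s :=
  (countBelow_lt_countBelow h₁ h₂ (Nat.lt_succ_self _)).trans_le countBelow_le

theorem countBelow_add (h₁ : s ≤ m) (h₂ : m ≤ e) :
    countBelow f s e y = countBelow f s m y + countBelow f m e y := by
  rw [countBelow, ← Finset.Ico_union_Ico_eq_Ico h₁ h₂, Finset.filter_union,
    Finset.card_union_of_disjoint]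
  · rfl
  · exact Finset.disjoint_filter_filter (Finset.Ico_disjoint_Ico_consecutive s m e)

theorem exists_countBelow_eq (hf : Set.InjOn f (Set.Ico s e)) (hk : k < e - s) :
    ∃ i, s ≤ i ∧ i < e ∧ countBelow f s e (f i) = k := by
  have hinj : Set.InjOn (fun i => countBelow f s e (f i)) (Finset.Ico s e) := by
    intro i hi j hj hij
    simp only [Finset.coe_Ico, Set.mem_Ico] at hi hj hij
    refine hf hi hj (le_antisymm (not_lt.1 fun h => ?_) (not_lt.1 fun h => ?_))
    · have := countBelow_lt_countBelow hj.1 hj.2 h; omega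
    · have := countBelow_lt_countBelow hi.1 hi.2 h; omega
  have hsub : (Finset.Ico s e).image (fun i => countBelow f s e (f i)) ⊆ Finset.range (e - s) := by
    intro k hk
    obtain ⟨i, hi, rfl⟩ := Finset.mem_image.1 hk
    rw [Finset.mem_Ico] at hi
    exact Finset.mem_range.2 (countBelow_self_lt hi.1 hi.2)
  have heq := Finset.eq_of_subset_of_card_le hsub
    (by rw [Finset.card_image_of_injOn hinj, Finset.card_range, Nat.card_Ico])
  have hk' := Finset.mem_range.2 hk
  rw [← heq, Finset.mem_image] at hk'
  obtain ⟨i, hi, h⟩ := hk'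
  rw [Finset.mem_Ico] at hi
  exact ⟨i, hi.1, hi.2, h⟩

theorem Sorts.exists_eq (h : Sorts f a s e) (hf : Set.InjOn f (Set.Ico s e)) (hk : k < e - s) :
    ∃ i, s ≤ i ∧ i < e ∧ countBelow f s e (f i) = k ∧ a (s + k) = f i := by
  obtain ⟨i, h₁, h₂, rfl⟩ := exists_countBelow_eq hf hk
  exact ⟨i, h₁, h₂, rfl, h i h₁ h₂⟩

theorem Sorts.monotone (h : Sorts f a s e) (hf : Set.InjOn f (Set.Ico s e)) (hk : k ≤ k')
    (hk' : k' < e - s) : a (s + k) ≤ a (s + k') := by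
  obtain ⟨i, h₁, h₂, h₃, h₄⟩ := h.exists_eq hf (hk.trans_lt hk')
  obtain ⟨j, h₅, h₆, h₇, h₈⟩ := h.exists_eq hf hk'
  rw [h₄, h₈]
  by_contra hlt
  have := countBelow_lt_countBelow h₅ h₆ (not_le.1 hlt)
  omega

theorem Sorts.countBelow_eq (h : Sorts f a s e) (hf : Set.InjOn f (Set.Ico s e)) (hr : r ≤ e - s)
    (h₁ : ∀ k < r, a (s + k) < y) (h₂ : ∀ k, r ≤ k → k < e - s → y ≤ a (s + k)) :
    countBelow f s e y = r := by
  refine le_antisymm ?_ ?_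
  · rcases hr.lt_or_eq with hr | rfl
    · obtain ⟨i, _, _, h₅, h₆⟩ := h.exists_eq hf hr
      exact h₅ ▸ countBelow_mono (h₆ ▸ h₂ r le_rfl hr)
    · exact countBelow_le
  · rcases r with _ | r
    · exact Nat.zero_le _
    · obtain ⟨i, h₃, h₄, h₅, h₆⟩ := h.exists_eq hf (Nat.lt_of_succ_le hr)
      exact h₅ ▸ countBelow_lt_countBelow h₃ h₄ (h₆ ▸ h₁ r r.lt_succ_self)

/-- The entry behind the values below `y` is the least value not below `y`. -/
theorem Sorts.le_of_countBelow_lt (h : Sorts f a s e) (hf : Set.InjOn f (Set.Ico s e))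
    (hr : countBelow f s e y < e - s) : y ≤ a (s + countBelow f s e y) := by
  obtain ⟨i, h₃, h₄, h₅, h₆⟩ := h.exists_eq hf hr
  rw [h₆]
  by_contra hlt
  have := countBelow_lt_countBelow h₃ h₄ (not_le.1 hlt)
  omega

theorem Sorts.countBelow_le_of_le (h : Sorts f a s e) (hf : Set.InjOn f (Set.Ico s e))
    (h₁ : s ≤ i) (h₂ : i < e) (hy : y ≤ f i) :
    countBelow f s e y < e - s ∧ a (s + countBelow f s e y) ≤ f i := by
  have h₃ := countBelow_mono (f := f) (s := s) (e := e) hy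
  have h₄ := countBelow_self_lt (f := f) h₁ h₂
  exact ⟨by omega, (h.monotone hf h₃ h₄).trans_eq (h i h₁ h₂)⟩

end Sorting

/-- Binary search in the entries of the array `k` that start at index `off` and are `len` in
number, where `off`, `len` and the key `y` are in the registers `30`, `31` and `32`. The number of
entries below `y + fl` goes to register `33`. -/
def bsearch (k fl : ℕ) : Cmd :=
  .block [.assign 33 (.lit 0), .assign 34 (.reg 31),
    .loop (.bin .lt (.reg 33) (.reg 34)) (.block [
      .assign 35 ((.reg 33 + .reg 34) / .lit 2),
      .ite (.bin .lt (.load (cellE k (.reg 30 + .reg 35))) (.reg 32) +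
          .lit fl * .bin .eq (.load (cellE k (.reg 30 + .reg 35))) (.reg 32))
        (.assign 33 (.reg 35 + .lit 1)) (.assign 34 (.reg 35))])]

theorem runs_bsearch {w n k fl off len y F : ℕ} {s : State} {a : ℕ → ℕ}
    (h5 : s.reg 5 = 2 * n) (h30 : s.reg 30 = off) (h31 : s.reg 31 = len) (h32 : s.reg 32 = y)
    (hF : len < 2 ^ F) (hk : k < 8) (hfl : fl ≤ 1) (hw : cell n 8 (off + len) < 2 ^ w)
    (ha : ∀ i < len, s.mem (cell n k (off + i)) = a i)
    (hmono : ∀ i j, i ≤ j → j < len → a i ≤ a j) :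
    Runs w (bsearch k fl) s fun t s' => t ≤ 50 * F + 50 ∧ s'.mem = s.mem ∧
      (∀ r < 33, s'.reg r = s.reg r) ∧ s'.reg 33 ≤ len ∧
      (∀ i < s'.reg 33, a i < y + fl) ∧ ∀ i, s'.reg 33 ≤ i → i < len → y + fl ≤ a i := by
  unfold cell at hw
  refine runs_cons (runs_assign 0 (by simp [eval_lit]) (runs_cons (runs_assign len
    (by simp [eval_reg, h31]) (runs_cons (?_ : Runs _ _ _ _)))))
  refine (runs_loop (fun N s' => s'.mem = s.mem ∧ (∀ r < 33, s'.reg r = s.reg r) ∧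
    s'.reg 33 ≤ s'.reg 34 ∧ s'.reg 34 ≤ len ∧ s'.reg 34 - s'.reg 33 < 2 ^ N ∧
    (∀ i < s'.reg 33, a i < y + fl) ∧ ∀ i, s'.reg 34 ≤ i → i < len → y + fl ≤ a i) 45 (N := F)
    ?_ ?_ ?_).mono ?_
  · refine ⟨rfl, fun r hr => ?_, by simp, by simp, by simpa using hF, by simp, ?_⟩
    · simp [show r ≠ 33 by omega, show r ≠ 34 by omega]
    · simp only [State.set_reg, if_true]; omega
  · rintro N s' ⟨hm, hreg, h₁, h₂, h₃, h₄, h₅⟩ he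
    have hlt : s'.reg 33 < s'.reg 34 := by
      simpa [eval_lt_ne_zero _ _ _ _ (show 1 < 2 ^ w by omega), eval_reg] using he
    set lo := s'.reg 33
    set hi := s'.reg 34
    refine runs_cons (runs_assign ((lo + hi) / 2) ?_ (runs_cons ?_))
    · simp only [eval_div, eval_add, eval_reg, eval_lit]
      rw [Nat.mod_eq_of_lt (a := 2) (by omega), Nat.mod_eq_of_lt (a := s'.reg 33 + s'.reg 34)
        (by omega), Nat.mod_eq_of_lt (by omega)]
    set mid := (lo + hi) / 2 with hmid
    have hmid₁ : lo ≤ mid := by omega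
    have hmid₂ : mid < hi := by omega
    have hload : Expr.eval w (s'.set 35 mid) (.load (cellE k (.reg 30 + .reg 35))) = a mid := by
      rw [eval_load, eval_cellE (n := n) (v := off + mid), State.set_mem, hm, ha _ (by omega)]
      · simp [hreg, h5]
      · simp only [eval_add, eval_reg, State.set_reg]
        norm_num
        rw [hreg 30 (by omega), h30, Nat.mod_eq_of_lt (by omega)]
      · unfold cell; omega
      · omega
    have htest : Expr.eval w (s'.set 35 mid)
        (.bin .lt (.load (cellE k (.reg 30 + .reg 35))) (.reg 32) +
          .lit fl * .bin .eq (.load (cellE k (.reg 30 + .reg 35))) (.reg 32)) ≠ 0 ↔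
        a mid < y + fl := by
      have hy : Expr.eval w (s'.set 35 mid) (.reg 32) = y := by
        simp [eval_reg, hreg 32 (by omega), h32]
      rw [eval_add, eval_mul, eval_lt _ _ _ _ (by omega), eval_eq _ _ _ _ (by omega), eval_lit,
        hload, hy, Nat.mod_eq_of_lt (a := fl) (by omega)]
      obtain rfl | rfl : fl = 0 ∨ fl = 1 := by omega
      · split_ifs <;> simp [Nat.mod_eq_of_lt (show 1 < 2 ^ w by omega)] <;> omega
      · split_ifs <;> simp [Nat.mod_eq_of_lt (show 1 < 2 ^ w by omega)] <;> omega
    rw [pow_succ] at h₃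
    refine runs_ite (fun h => ?_) (fun h => ?_)
    · have hlow := htest.1 h
      refine runs_assign (mid + 1) ?_ (runs_nil ⟨?_, hm, ?_, ?_, ?_, ?_, ?_, ?_⟩)
      · rw [eval_add, eval_reg, eval_lit, Nat.mod_eq_of_lt (a := 1) (by omega)]
        simp only [State.set_reg, if_true]
        rw [Nat.mod_eq_of_lt (by omega)]
      · simp [cost_bin, cost_add, cost_mul, cost_div, cost_load, cost_cellE, cost_reg, cost_lit]
      · intro r hr
        simp [show r ≠ 33 by omega, show r ≠ 35 by omega, hreg r hr]
      · simpa using hmid₂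
      · simpa using h₂
      · simp only [State.set_reg]; norm_num; omega
      · simp only [State.set_reg, if_true]
        exact fun i hi => (hmono i mid (by omega) (by omega)).trans_lt hlow
      · simpa using h₅
    · have hhigh : y + fl ≤ a mid := by
        by_contra hlt
        exact htest.2 (not_le.1 hlt) h
      refine runs_assign mid (by simp [eval_reg]) (runs_nil ⟨?_, hm, ?_, ?_, ?_, ?_, ?_, ?_⟩)
      · simp [cost_bin, cost_add, cost_mul, cost_div, cost_load, cost_cellE, cost_reg, cost_lit]
      · intro r hr
        simp [show r ≠ 34 by omega, show r ≠ 35 by omega, hreg r hr]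
      · simpa using hmid₁
      · simp only [State.set_reg, if_true]; omega
      · simp only [State.set_reg]; norm_num; omega
      · simpa using h₄
      · simp only [State.set_reg, if_true]
        exact fun i hi hl => hhigh.trans (hmono mid i hi hl)
  · rintro s' ⟨-, -, h₁, -, h₃, -⟩
    rw [eval_lt _ _ _ _ (by omega), eval_reg, eval_reg, if_neg (by omega)]
  · rintro t s' ⟨ht, he, N, -, hm, hreg, h₁, h₂, -, h₄, h₅⟩
    have hlt : ¬ s'.reg 33 < s'.reg 34 := by
      simpa [eval_lt_eq_zero _ _ _ _ (show 1 < 2 ^ w by omega), eval_reg] using he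
    refine runs_nil ⟨?_, hm, hreg, by omega, h₄, fun i hi => h₅ i (by omega)⟩
    simp only [cost_bin, cost_reg, cost_lit] at ht ⊢
    omega

/-- Binary search in a sorted block counts the values below the key. -/
theorem runs_bsearch_sorted {w n k fl base b e y F : ℕ} {s : State} {f : ℕ → ℕ}
    (h5 : s.reg 5 = 2 * n) (h30 : s.reg 30 = base + b) (h31 : s.reg 31 = e - b)
    (h32 : s.reg 32 = y) (hF : e - b < 2 ^ F) (hk : k < 8) (hfl : fl ≤ 1)
    (hw : cell n 8 (base + b + (e - b)) < 2 ^ w) (hf : Set.InjOn f (Set.Ico b e))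
    (ha : Sorts f (fun p => s.mem (cell n k (base + p))) b e) :
    Runs w (bsearch k fl) s fun t s' => t ≤ 50 * F + 50 ∧ s'.mem = s.mem ∧
      (∀ r < 33, s'.reg r = s.reg r) ∧ s'.reg 33 = countBelow f b e (y + fl) := by
  refine (runs_bsearch (a := fun i => s.mem (cell n k (base + (b + i)))) h5 h30 h31 h32 hF hk hfl
    hw (fun i _ => by rw [Nat.add_assoc]) fun i j hij hj => ha.monotone hf hij hj).mono ?_
  rintro t s' ⟨ht, hm, hreg, h₁, h₂, h₃⟩
  exact ⟨ht, hm, hreg, (ha.countBelow_eq hf h₁ h₂ h₃).symm⟩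

/-! ### Sorting the blocks of all levels -/

/-- The first column of the block of level `h`, that is of length `2 ^ h`, around column `i`. -/
def blockStart (h i : ℕ) : ℕ := i / 2 ^ h * 2 ^ h

/-- The position of `f i` when the block of level `h` around column `i` is sorted. -/
def levelPos (n : ℕ) (f : ℕ → ℕ) (h i : ℕ) : ℕ :=
  blockStart h i + countBelow f (blockStart h i) (min n (blockStart h i + 2 ^ h)) (f i)

/-- The array `a` holds the values `f i` for `i < n`, sorted within each block of level `h`. -/
def IsLevel (n : ℕ) (f : ℕ → ℕ) (h : ℕ) (a : ℕ → ℕ) : Prop := ∀ i < n, a (levelPos n f h i) = f i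

section Levels

variable {n h i j b : ℕ} {f a : ℕ → ℕ}

theorem blockStart_le : blockStart h i ≤ i := Nat.div_mul_le_self _ _

theorem lt_blockStart_add : i < blockStart h i + 2 ^ h := by
  have := Nat.lt_div_mul_add (a := i) (Nat.two_pow_pos h)
  unfold blockStart
  omega

theorem dvd_blockStart : 2 ^ h ∣ blockStart h i := Dvd.intro_left _ rfl

theorem blockStart_eq (hb : 2 ^ h ∣ b) (h₁ : b ≤ i) (h₂ : i < b + 2 ^ h) :
    blockStart h i = b := by
  obtain ⟨c, rfl⟩ := hb
  rw [blockStart, Nat.div_eq_of_lt_le (k := c) (by linarith) (by linarith), Nat.mul_comm]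

theorem levelPos_bounds (hi : i < n) :
    blockStart h i ≤ levelPos n f h i ∧
      levelPos n f h i < min n (blockStart h i + 2 ^ h) := by
  have h₁ : blockStart h i ≤ i := blockStart_le
  have h₂ : i < blockStart h i + 2 ^ h := lt_blockStart_add
  have := countBelow_self_lt (f := f) h₁ (show i < min n (blockStart h i + 2 ^ h) by omega)
  unfold levelPos
  omega

theorem levelPos_lt (hi : i < n) : levelPos n f h i < n :=
  (levelPos_bounds hi).2.trans_le (min_le_left _ _)

theorem IsLevel.congr {a' : ℕ → ℕ} (h' : IsLevel n f h a) (ha : ∀ p < n, a' p = a p) :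
    IsLevel n f h a' := fun i hi => (ha _ (levelPos_lt hi)).trans (h' i hi)

theorem eq_of_levelPos_eq (hi : i < n) (hj : j < n) (hij : levelPos n f h i = levelPos n f h j) :
    f i = f j := by
  have hi' := levelPos_bounds (f := f) (h := h) hi
  have hj' := levelPos_bounds (f := f) (h := h) hj
  have hb : blockStart h i = blockStart h j := by
    rw [← blockStart_eq (i := levelPos n f h i) dvd_blockStart hi'.1 (by omega), hij,
      blockStart_eq dvd_blockStart hj'.1 (by omega)]
  have h₁ : blockStart h i ≤ i := blockStart_le
  have h₂ : i < blockStart h i + 2 ^ h := lt_blockStart_add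
  have h₃ : blockStart h j ≤ j := blockStart_le
  have h₄ : j < blockStart h j + 2 ^ h := lt_blockStart_add
  unfold levelPos at hij
  rw [hb] at hij h₁ h₂
  refine le_antisymm (not_lt.1 fun hlt => ?_) (not_lt.1 fun hlt => ?_)
  · have := countBelow_lt_countBelow (f := f) (e := min n (blockStart h j + 2 ^ h)) h₃ (by omega) hlt
    omega
  · have := countBelow_lt_countBelow (f := f) (e := min n (blockStart h j + 2 ^ h)) h₁ (by omega) hlt
    omega

theorem isLevel_zero (ha : ∀ i < n, a i = f i) : IsLevel n f 0 a := by
  intro i hi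
  have h := levelPos_bounds (f := f) (h := 0) hi
  have hb : blockStart 0 i = i := by simp [blockStart]
  rw [hb] at h
  rw [show levelPos n f 0 i = i by simp at h; omega, ha i hi]

theorem IsLevel.sorts (ha : IsLevel n f h a) (hb : 2 ^ h ∣ b) :
    Sorts f a b (min n (b + 2 ^ h)) := by
  intro i h₁ h₂
  have h₃ := ha i (by omega)
  rwa [levelPos, blockStart_eq hb h₁ (by omega)] at h₃

/-- The halves of a block of level `h + 1`. -/
theorem IsLevel.sorts_halves (ha : IsLevel n f h a) (hb : 2 ^ (h + 1) ∣ b) :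
    Sorts f a b (min n (b + 2 ^ h)) ∧
      Sorts f a (min n (b + 2 ^ h)) (min n (b + 2 ^ (h + 1))) := by
  have hb' : 2 ^ h ∣ b := (pow_dvd_pow 2 h.le_succ).trans hb
  refine ⟨ha.sorts hb', fun i h₁ h₂ => ?_⟩
  have hm : min n (b + 2 ^ h) = b + 2 ^ h := by omega
  rw [hm] at h₁ ⊢
  rw [pow_succ] at h₂ ⊢
  rw [show b + 2 ^ h * 2 = b + 2 ^ h + 2 ^ h by ring] at h₂ ⊢
  exact ha.sorts (Nat.dvd_add hb' dvd_rfl) i h₁ h₂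

theorem levelPos_succ : levelPos n f (h + 1) i = blockStart (h + 1) i +
    countBelow f (blockStart (h + 1) i) (min n (blockStart (h + 1) i + 2 ^ h)) (f i) +
    countBelow f (min n (blockStart (h + 1) i + 2 ^ h))
      (min n (blockStart (h + 1) i + 2 ^ (h + 1))) (f i) := by
  have hpos := Nat.two_pow_pos h
  have hpow : 2 ^ (h + 1) = 2 ^ h * 2 := pow_succ 2 h
  by_cases hn : blockStart (h + 1) i ≤ n
  · rw [levelPos, countBelow_add (m := min n (blockStart (h + 1) i + 2 ^ h)), Nat.add_assoc]
    · exact le_min hn (Nat.le_add_right _ _)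
    · omega
  · have h₁ : ∀ b e, e ≤ b → countBelow f b e (f i) = 0 := fun b e h => by
      have := countBelow_le (f := f) (s := b) (e := e) (y := f i); omega
    rw [levelPos, h₁, h₁, h₁] <;> omega

end Levels

/-- With a level `B = 2 ^ h` in register `10` and a column in register `13`, the borders of the two
halves of the block of length `2 * B` around the column, cut off at `n`, go to the registers `14`,
`15` and `16`. Truncated subtraction yields `n - (n - v) = min n v`. -/
def halves : Cmd :=
  .block [.assign 14 (.reg 13 / (.reg 10 + .reg 10) * (.reg 10 + .reg 10)),
    .assign 15 (.reg 4 - (.reg 4 - (.reg 14 + .reg 10))),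
    .assign 16 (.reg 4 - (.reg 4 - (.reg 14 + (.reg 10 + .reg 10))))]

theorem runs_halves {w n h i : ℕ} {s : State} (h4 : s.reg 4 = n) (h10 : s.reg 10 = 2 ^ h)
    (h13 : s.reg 13 = i) (hi : i < n) (hh : 2 ^ h ≤ n) (hw : 4 * n < 2 ^ w) :
    Runs w halves s fun t s' => t ≤ 50 ∧ s'.mem = s.mem ∧
      (∀ r, r ≠ 14 → r ≠ 15 → r ≠ 16 → s'.reg r = s.reg r) ∧
      s'.reg 14 = blockStart (h + 1) i ∧ s'.reg 15 = min n (blockStart (h + 1) i + 2 ^ h) ∧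
      s'.reg 16 = min n (blockStart (h + 1) i + 2 ^ (h + 1)) := by
  have hb : blockStart (h + 1) i ≤ i := blockStart_le
  have hpow : 2 ^ (h + 1) = 2 ^ h + 2 ^ h := by ring
  refine runs_cons (runs_assign (blockStart (h + 1) i) ?_ (runs_cons (runs_assign
    (min n (blockStart (h + 1) i + 2 ^ h)) ?_ (runs_cons (runs_assign
    (min n (blockStart (h + 1) i + 2 ^ (h + 1))) ?_ (runs_nil ⟨?_, rfl, ?_, ?_, ?_, ?_⟩))))))
  · simp only [eval_mul, eval_div, eval_add, eval_reg, h10, h13]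
    rw [Nat.mod_eq_of_lt (a := 2 ^ h + 2 ^ h) (by omega), ← hpow,
      Nat.mod_eq_of_lt (a := i / 2 ^ (h + 1)) ((Nat.div_le_self _ _).trans_lt (by omega))]
    exact Nat.mod_eq_of_lt (hb.trans_lt (by omega))
  · simp only [eval_sub, eval_add, eval_reg, State.set_reg]
    norm_num
    rw [h4, h10, Nat.mod_eq_of_lt (a := blockStart (h + 1) i + 2 ^ h) (by omega),
      Nat.mod_eq_of_lt (a := n - (blockStart (h + 1) i + 2 ^ h)) (by omega),
      Nat.mod_eq_of_lt (by omega)]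
    omega
  · simp only [eval_sub, eval_add, eval_reg, State.set_reg]
    norm_num
    rw [h4, h10, ← hpow,
      Nat.mod_eq_of_lt (a := blockStart (h + 1) i + 2 ^ (h + 1)) (by omega),
      Nat.mod_eq_of_lt (a := n - (blockStart (h + 1) i + 2 ^ (h + 1))) (by omega),
      Nat.mod_eq_of_lt (by omega)]
    omega
  · simp [cost_add, cost_mul, cost_sub, cost_div, cost_reg]
  · intro r h₁ h₂ h₃; simp [h₁, h₂, h₃]
  · simp
  · simp
  · simp

/-- The array `k` holds `n` values at the indices below `n`. The command puts these values, sorted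
within the blocks of level `h`, at the indices from `h * n` on, for every level `h` up to the
number in register `7`. The place of a value is found by binary search in the halves of its
block. -/
def sortLevels (k : ℕ) : Cmd :=
  .block [.assign 10 (.lit 1), .assign 11 (.lit 0),
    .for 12 (.reg 7) (.block [
      .for 13 (.reg 4) (.block [
        halves,
        .assign 32 (.load (cellE k (.reg 13))),
        .assign 30 (.reg 11 + .reg 14),
        .assign 31 (.reg 15 - .reg 14),
        bsearch k 0,
        .assign 17 (.reg 14 + .reg 33),
        .assign 30 (.reg 11 + .reg 15),
        .assign 31 (.reg 16 - .reg 15),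
        bsearch k 0,
        .assign 17 (.reg 17 + .reg 33),
        .store (cellE k (.reg 11 + .reg 4 + .reg 17)) (.reg 32)]),
      .assign 10 (.reg 10 + .reg 10),
      .assign 11 (.reg 11 + .reg 4)])]

/-- One placement: the value of column `i` goes to its position in level `h + 1`. -/
theorem runs_sortLevels_body {w n H h k i : ℕ} {s : State} {f : ℕ → ℕ}
    (h4 : s.reg 4 = n) (h5 : s.reg 5 = 2 * n) (h10 : s.reg 10 = 2 ^ h) (h11 : s.reg 11 = h * n)
    (h13 : s.reg 13 = i) (hi : i < n) (hh : h < H) (hpow : 2 ^ h ≤ n) (hH : n ≤ 2 ^ H) (hk : k < 8)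
    (hw : cell n 8 ((H + 1) * n) < 2 ^ w) (hf : Set.InjOn f (Set.Ico 0 n))
    (hval : s.mem (cell n k i) = f i)
    (hlev : IsLevel n f h fun p => s.mem (cell n k (h * n + p))) :
    Runs w (.block [
        halves,
        .assign 32 (.load (cellE k (.reg 13))),
        .assign 30 (.reg 11 + .reg 14),
        .assign 31 (.reg 15 - .reg 14),
        bsearch k 0,
        .assign 17 (.reg 14 + .reg 33),
        .assign 30 (.reg 11 + .reg 15),
        .assign 31 (.reg 16 - .reg 15),
        bsearch k 0,
        .assign 17 (.reg 17 + .reg 33),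
        .store (cellE k (.reg 11 + .reg 4 + .reg 17)) (.reg 32)]) s fun t s' =>
      t ≤ 100 * H + 400 ∧ (∀ r < 14, s'.reg r = s.reg r) ∧
      s'.mem = (s.put (cell n k ((h + 1) * n + levelPos n f (h + 1) i)) (f i)).mem := by
  have hhn : (h + 1) * n + n ≤ (H + 1) * n := by
    rw [← Nat.succ_mul]; exact Nat.mul_le_mul_right n (by omega)
  rw [Nat.succ_mul] at hhn
  unfold cell at hw
  have hF : ∀ b e, e ≤ n → e - b < 2 ^ (H + 1) := fun b e he => by
    have := Nat.two_pow_pos H; rw [pow_succ]; omega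
  have hpos := levelPos_lt (f := f) (h := h + 1) hi
  have hlp := levelPos_succ (n := n) (f := f) (h := h) (i := i)
  have hsi : blockStart (h + 1) i ≤ i := blockStart_le
  have hsort := hlev.sorts_halves (b := blockStart (h + 1) i) dvd_blockStart
  refine runs_cons ((runs_halves h4 h10 h13 hi hpow (by omega)).mono ?_)
  rintro t₁ s₁ ⟨ht₁, hm₁, hr₁, h14, h15, h16⟩
  set b := blockStart (h + 1) i
  set m := min n (b + 2 ^ h) with hmdef
  set e := min n (b + 2 ^ (h + 1)) with hedef
  have hbm : b ≤ m := by omega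
  have hme : m ≤ e := by rw [pow_succ] at hedef; omega
  have hen : e ≤ n := by omega
  have hfb : Set.InjOn f (Set.Ico b m) := hf.mono (Set.Ico_subset_Ico (Nat.zero_le _) (by omega))
  have hfm : Set.InjOn f (Set.Ico m e) := hf.mono (Set.Ico_subset_Ico (Nat.zero_le _) (by omega))
  have e4 : s₁.reg 4 = n := by rw [hr₁ 4] <;> simp [h4]
  have e5 : s₁.reg 5 = 2 * n := by rw [hr₁ 5] <;> simp [h5]
  have e11 : s₁.reg 11 = h * n := by rw [hr₁ 11] <;> simp [h11]
  have e13 : s₁.reg 13 = i := by rw [hr₁ 13] <;> simp [h13]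
  refine runs_cons (runs_assign (f i) ?_ (runs_cons (runs_assign (h * n + b) ?_ (runs_cons
    (runs_assign (m - b) ?_ (runs_cons ((runs_bsearch_sorted (n := n) (base := h * n) (b := b)
    (e := m) (y := f i) (F := H + 1) (f := f) ?_ ?_ ?_ ?_ (hF _ _ (by omega)) hk (by omega) ?_ hfb
    ?_).mono ?_)))))))
  · rw [eval_load, eval_cellE e5 (by rw [eval_reg, e13]) (by unfold cell; omega) (by omega), hm₁,
      hval]
  · simp [eval_add, eval_reg, e11, h14, Nat.mod_eq_of_lt (show h * n + b < 2 ^ w by omega)]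
  · simp [eval_sub, eval_reg, h14, h15, Nat.mod_eq_of_lt (show m - b < 2 ^ w by omega)]
  · simpa using e5
  · simp
  · simp
  · simp
  · unfold cell; omega
  · simpa [hm₁] using hsort.1
  rintro t₂ s₂ ⟨ht₂, hm₂, hr₂, h33⟩
  refine runs_cons (runs_assign (b + countBelow f b m (f i)) ?_ (runs_cons (runs_assign
    (h * n + m) ?_ (runs_cons (runs_assign (e - m) ?_ (runs_cons ((runs_bsearch_sorted (n := n)
    (base := h * n) (b := m) (e := e) (y := f i) (F := H + 1) (f := f) ?_ ?_ ?_ ?_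
    (hF _ _ hen) hk (by omega) ?_ hfm ?_).mono ?_)))))))
  · simp [eval_add, eval_reg, hr₂, h14, h33]
    exact Nat.mod_eq_of_lt (by omega)
  · simp [eval_add, eval_reg, hr₂, h15, e11]
    exact Nat.mod_eq_of_lt (by omega)
  · simp [eval_sub, eval_reg, hr₂, h15, h16]
    exact Nat.mod_eq_of_lt (by omega)
  · simp [hr₂, e5]
  · simp
  · simp
  · simp [hr₂]
  · unfold cell; omega
  · simpa [hm₁, hm₂] using hsort.2
  rintro t₃ s₃ ⟨ht₃, hm₃, hr₃, h33'⟩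
  refine runs_cons (runs_assign (levelPos n f (h + 1) i) ?_ (runs_cons (runs_store
    (cell n k ((h + 1) * n + levelPos n f (h + 1) i)) (f i) ?_ ?_ (runs_nil ⟨?_, ?_, ?_⟩))))
  · simp [eval_add, eval_reg, hr₃, h33']
    rw [hlp]
    exact Nat.mod_eq_of_lt (by omega)
  · refine eval_cellE (by simp [hr₂, hr₃, e5]) ?_ ?_ (by omega)
    · simp [eval_add, eval_reg, hr₂, hr₃, e11, e4]
      rw [Nat.succ_mul]
      exact Nat.mod_eq_of_lt (by omega)
    · rw [Nat.succ_mul]; unfold cell; omega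
  · simp [eval_reg, hr₂, hr₃]
  · simp only [cost_add, cost_sub, cost_load, cost_reg, cost_cellE]
    omega
  · intro r hr
    have h₁ : r ≠ 17 := by omega
    have h₂ : r ≠ 30 := by omega
    have h₃ : r ≠ 31 := by omega
    have h₄ : r ≠ 32 := by omega
    simp [h₁, h₂, h₃, h₄, hr₂ r (by omega), hr₃ r (by omega), hr₁ r (by omega) (by omega) (by omega)]
  · simp [State.put, hm₁, hm₂, hm₃]

/-- The array `k` of the memory `μ` holds all levels up to `H`. -/
def HasLevels (n H k : ℕ) (f : ℕ → ℕ) (μ : ℕ → ℕ) : Prop :=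
  ∀ h ≤ H, IsLevel n f h fun p => μ (cell n k (h * n + p))

theorem runs_sortLevels {w n H k : ℕ} {s : State} {f : ℕ → ℕ}
    (h4 : s.reg 4 = n) (h5 : s.reg 5 = 2 * n) (h7 : s.reg 7 = H)
    (hpow : ∀ h < H, 2 ^ h < n) (hH : n ≤ 2 ^ H) (hk : k < 8)
    (hw : cell n 8 ((H + 1) * n) < 2 ^ w) (hHw : H < 2 ^ w) (hf : Set.InjOn f (Set.Ico 0 n))
    (hval : ∀ i < n, s.mem (cell n k i) = f i) :
    Runs w (sortLevels k) s fun t s' => t ≤ (H + 1) * (n + 1) * (100 * H + 600) ∧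
      (∀ r < 10, s'.reg r = s.reg r) ∧ HasLevels n H k f s'.mem ∧
      ∀ x, (∀ v, x ≠ cell n k v) → s'.mem x = s.mem x := by
  have hcell : 2 * n + 8 * ((H + 1) * n) + 8 < 2 ^ w := hw
  have hnH : n ≤ (H + 1) * n := Nat.le_mul_of_pos_left n (Nat.succ_pos H)
  refine runs_cons (runs_assign 1 (by rw [eval_lit]; exact Nat.mod_eq_of_lt (by omega)) (runs_cons
    (runs_assign 0 (by simp [eval_lit]) (runs_cons ((runs_for (fun h s' =>
      (∀ r < 10, s'.reg r = s.reg r) ∧ s'.reg 10 = 2 ^ h ∧ s'.reg 11 = h * n ∧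
      (∀ h' ≤ h, IsLevel n f h' fun p => s'.mem (cell n k (h' * n + p))) ∧
      ∀ x, (∀ v, x ≠ cell n k v) → s'.mem x = s.mem x) (n * (100 * H + 409) + 30) H hHw ?_ ?_
      ?_).mono ?_)))))
  · refine ⟨fun r hr => ?_, by simp, by simp, ?_, by simp⟩
    · simp [show r ≠ 10 by omega, show r ≠ 11 by omega, show r ≠ 12 by omega]
    · intro h' hh'
      obtain rfl : h' = 0 := by omega
      exact isLevel_zero (by simpa using hval)
  · rintro h s' - - ⟨hr, -⟩
    rw [eval_reg, hr 7 (by omega), h7]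
  · rintro h s₁ hh h12 ⟨hr, h10, h11, hlev, hmem⟩
    have hhn : (h + 1) * n ≤ H * n := Nat.mul_le_mul_right n (by omega)
    have hHn : (H + 1) * n = H * n + n := Nat.succ_mul H n
    have hhn' : (h + 1) * n = h * n + n := Nat.succ_mul h n
    have hph := hpow h hh
    refine runs_cons ((runs_for (fun i s' => (∀ r < 13, s'.reg r = s₁.reg r) ∧
      (∀ h' ≤ h, IsLevel n f h' fun p => s'.mem (cell n k (h' * n + p))) ∧
      (∀ i' < i, s'.mem (cell n k ((h + 1) * n + levelPos n f (h + 1) i')) = f i') ∧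
      ∀ x, (∀ v, x ≠ cell n k v) → s'.mem x = s.mem x) (100 * H + 400) n (by omega) ?_ ?_
      ?_).mono ?_)
    · refine ⟨fun r hr => by simp [show r ≠ 13 by omega], hlev, by simp, hmem⟩
    · rintro i s₂ - - ⟨hr', -⟩
      rw [eval_reg, hr' 4 (by omega), hr 4 (by omega), h4]
    · rintro i s₂ hi h13 ⟨hr', hlev', hdone, hmem'⟩
      have hlv : ∀ j, s₂.mem (cell n k j) = s₂.mem (cell n k (0 * n + j)) := fun j => by simp
      have hval' : s₂.mem (cell n k i) = f i := by
        rw [hlv]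
        have := hlev' 0 (Nat.zero_le _) i hi
        have hb := levelPos_bounds (f := f) (h := 0) hi
        have hbi : blockStart 0 i = i := by simp [blockStart]
        rw [hbi] at hb
        rwa [show levelPos n f 0 i = i by simp at hb; omega] at this
      refine (runs_sortLevels_body (f := f) (h := h) (H := H) (k := k)
        ((hr' 4 (by omega)).trans ((hr 4 (by omega)).trans h4))
        ((hr' 5 (by omega)).trans ((hr 5 (by omega)).trans h5))
        ((hr' 10 (by omega)).trans h10) ((hr' 11 (by omega)).trans h11) h13 hi hh hph.le hH hk hw hf
        hval' (hlev' h le_rfl)).mono ?_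
      rintro t s₃ ⟨ht, hr'', hm⟩
      refine ⟨ht, (hr'' 13 (by omega)).trans h13, fun r hlt => ?_, ?_, ?_, ?_⟩
      · simp [show r ≠ 13 by omega, hr'' r (by omega), hr' r hlt]
      · intro h' hh'
        refine (hlev' h' hh').congr fun p hp => ?_
        have : h' * n ≤ h * n := Nat.mul_le_mul_right n hh'
        rw [State.set_mem, hm, State.put_mem, if_neg]
        rw [cell_inj hk hk]; omega
      · intro i' hi'
        rw [State.set_mem, hm, State.put_mem]
        simp only [cell_inj hk hk]
        split_ifs with heq
        · exact eq_of_levelPos_eq (n := n) (h := h + 1) hi (by omega) (by omega)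
        · refine hdone i' ?_
          by_contra hlt
          obtain rfl : i' = i := by omega
          simp at heq
      · intro x hx
        rw [State.set_mem, hm, State.put_mem, if_neg (hx _), hmem' x hx]
    · rintro t s₂ ⟨ht, -, hr', hlev', hdone, hmem'⟩
      refine runs_cons (runs_assign (2 ^ (h + 1)) ?_ (runs_cons (runs_assign ((h + 1) * n) ?_
        (runs_nil ⟨?_, ?_, ?_, ?_, ?_, ?_, ?_⟩))))
      · rw [eval_add, eval_reg, hr' 10 (by omega), h10, pow_succ, Nat.mod_eq_of_lt (by omega)]
        ring
      · simp [eval_add, eval_reg, hr' 11 (by omega), h11, hr' 4 (by omega), hr 4 (by omega), h4]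
        rw [hhn']
        exact Nat.mod_eq_of_lt (by omega)
      · simp only [cost_add, cost_reg] at ht ⊢
        have : n * (100 * H + 400 + 1 + 8) = n * (100 * H + 409) := by ring
        omega
      · simp [hr' 12 (by omega), h12]
      · intro r hlt
        simp [show r ≠ 10 by omega, show r ≠ 11 by omega, show r ≠ 12 by omega, hr' r (by omega),
          hr r hlt]
      · simp
      · simp
      · intro h' hh'
        rcases Nat.lt_or_eq_of_le hh' with hlt | rfl
        · exact hlev' h' (by omega)
        · exact fun i hi => hdone i hi
      · exact hmem'
  · rintro t s₁ ⟨ht, -, hr, -, -, hlev, hmem⟩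
    refine runs_nil ⟨?_, hr, hlev, hmem⟩
    simp only [cost_lit, cost_reg] at ht ⊢
    have h₁ : H * (n * (100 * H + 409) + 30 + 1 + 8) ≤ H * ((n + 1) * (100 * H + 600)) :=
      Nat.mul_le_mul_left H (by ring_nf; omega)
    have h₂ : (H + 1) * (n + 1) * (100 * H + 600) =
        H * ((n + 1) * (100 * H + 600)) + (n + 1) * (100 * H + 600) := by ring
    have h₃ : 1 * (100 * H + 600) ≤ (n + 1) * (100 * H + 600) :=
      Nat.mul_le_mul_right _ (by omega)
    omega

/-! ### Extending a row by a block -/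

/-- The step of `extendRow` for one pair of entries. Their indices are the quotient and the
remainder of register `25` by the length of a row. The least height found so far is in register
`26`. -/
def tryPair : Cmd :=
  .ite (.bin .lt (.load (cellE 3 (.reg 25 / .reg 6)) + .load (cellE 3 (.reg 25 % .reg 6)))
      (.load (cellE 3 (.reg 24))))
    .skip
    (.block [
      .assign 27 (.load (cellE 4 (.reg 20 + .reg 25 / .reg 6))),
      .ite (.reg 25 % .reg 6)
        (.block [
          .assign 30 (.reg 22),
          .assign 31 (.reg 23),
          .assign 32 (.reg 27),
          bsearch 2 0,
          .ite (.bin .lt (.reg 33) (.reg 23))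
            (.assign 27 (.load (cellE 4 ((.reg 22 + .reg 33) * .reg 6 + .reg 25 % .reg 6))))
            (.assign 27 (.reg 4 + .lit 1))])
        .skip,
      .ite (.bin .lt (.reg 27) (.reg 26)) (.assign 26 (.reg 27)) .skip])

/-- Array `4` holds rows of equal length, which is in register `6`. The command extends the row that
starts at index `reg 20` by a block of `reg 23` columns, and writes the result to the indices from
`reg 21` on. The sorted values of the block start at index `reg 22` of array `2`, and its rows are
those of the same numbers in array `4`. -/
def extendRow : Cmd :=
  .for 24 (.reg 6) (.block [
    .assign 26 (.reg 4 + .lit 1),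
    .for 25 (.reg 6 * .reg 6) tryPair,
    .store (cellE 4 (.reg 21 + .reg 24)) (.reg 26)])

section Extend

variable {w n q base b e src dst j F Z : ℕ} {s : State} {f : ℕ → ℕ}

/-- The registers and the memory that `extendRow` reads, for the block of the columns from `b` to
`e - 1` in the level that starts at index `base`. -/
structure ExtendInput (n q base b e src dst : ℕ) (f : ℕ → ℕ) (s : State) : Prop where
  h4 : s.reg 4 = n
  h5 : s.reg 5 = 2 * n
  h6 : s.reg 6 = gridSize q n
  h20 : s.reg 20 = src
  h21 : s.reg 21 = dst
  h22 : s.reg 22 = base + b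
  h23 : s.reg 23 = e - b
  grid : ∀ j < gridSize q n, s.mem (cell n 3 j) = grid q j
  sorts : Sorts f (fun p => s.mem (cell n 2 (base + p))) b e

/-- The sizes for which `extendRow` works: `Z` is a bound for all indices that occur, the length of
the block has at most `F` binary digits, and the row written is disjoint from the rows read. -/
structure ExtendBounds (w n q base b e src dst F Z : ℕ) (f : ℕ → ℕ) : Prop where
  inj : Set.InjOn f (Set.Ico b e)
  pow : e - b < 2 ^ F
  n_le : n + 1 ≤ Z
  src_le : src + gridSize q n ≤ Z
  dst_le : dst + gridSize q n ≤ Z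
  block_le : (base + b + (e - b)) * gridSize q n ≤ Z
  size_le : gridSize q n * gridSize q n ≤ Z
  word : cell n 8 Z < 2 ^ w
  src_dst : src + gridSize q n ≤ dst ∨ dst + gridSize q n ≤ src
  block_dst : (base + b + (e - b)) * gridSize q n ≤ dst

theorem gridSize_pos : 0 < gridSize q n := Nat.succ_pos _

theorem ExtendInput.congr {s' : State} (h : ExtendInput n q base b e src dst f s)
    (hr : ∀ r < 24, s'.reg r = s.reg r)
    (hm : ∀ k v, k < 4 → s'.mem (cell n k v) = s.mem (cell n k v)) :
    ExtendInput n q base b e src dst f s' where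
  h4 := (hr 4 (by omega)).trans h.h4
  h5 := (hr 5 (by omega)).trans h.h5
  h6 := (hr 6 (by omega)).trans h.h6
  h20 := (hr 20 (by omega)).trans h.h20
  h21 := (hr 21 (by omega)).trans h.h21
  h22 := (hr 22 (by omega)).trans h.h22
  h23 := (hr 23 (by omega)).trans h.h23
  grid j hj := (hm 3 j (by omega)).trans (h.grid j hj)
  sorts i h₁ h₂ := (hm 2 _ (by omega)).trans (h.sorts i h₁ h₂)

/-- One pair costs one binary search, for the first row of the block that starts high enough. -/
theorem runs_tryPair {best j₁ j₂ : ℕ} (h : ExtendInput n q base b e src dst f s)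
    (hB : ExtendBounds w n q base b e src dst F Z f) (h24 : s.reg 24 = j)
    (h25 : s.reg 25 = j₁ * gridSize q n + j₂) (h26 : s.reg 26 = best)
    (hj : j < gridSize q n) (hj₁ : j₁ < gridSize q n) (hj₂ : j₂ < gridSize q n) :
    Runs w tryPair s fun t s' => t ≤ 50 * F + 200 ∧ (∀ r < 26, s'.reg r = s.reg r) ∧
      s'.mem = s.mem ∧ s'.reg 26 = if QueryLIS.grid q j ≤ QueryLIS.grid q j₁ + QueryLIS.grid q j₂
        then min best (climb n (e - b) (countBelow f b e)
          (fun r i => s.mem (cell n 4 ((base + b + r) * gridSize q n + i)))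
          (s.mem (cell n 4 (src + j₁))) j₂) else best := by
  obtain ⟨h4, h5, h6, h20, h21, h22, h23, hgrid, hsorts⟩ := h
  obtain ⟨hinj, hpow, hZn, hZsrc, hZdst, hZblock, hZsize, hword, -, -⟩ := hB
  have hm := gridSize_pos (q := q) (n := n)
  have hmn := gridSize_le q n
  have hblk : base + b + (e - b) ≤ (base + b + (e - b)) * gridSize q n :=
    Nat.le_mul_of_pos_right _ hm
  have hg := fun j (hj : j < gridSize q n) => lt_gridSize.1 hj
  set m := gridSize q n with hmdef
  unfold cell at hword
  have hlt : j₁ * m + j₂ < m * m := by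
    have : (j₁ + 1) * m ≤ m * m := Nat.mul_le_mul_right m hj₁
    rw [Nat.succ_mul] at this; omega
  have hdiv : (j₁ * m + j₂) / m = j₁ := by
    rw [Nat.mul_comm, Nat.mul_add_div hm, Nat.div_eq_of_lt hj₂, Nat.add_zero]
  have hmod : (j₁ * m + j₂) % m = j₂ := by
    rw [Nat.mul_comm, Nat.mul_add_mod, Nat.mod_eq_of_lt hj₂]
  have ediv : ∀ s' : State, s'.reg 25 = s.reg 25 → s'.reg 6 = s.reg 6 →
      Expr.eval w s' (.reg 25 / .reg 6) = j₁ := fun s' h₁ h₂ => by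
    rw [eval_div, eval_reg, eval_reg, h₁, h₂, h25, h6, hdiv, Nat.mod_eq_of_lt (by omega)]
  have emod : ∀ s' : State, s'.reg 25 = s.reg 25 → s'.reg 6 = s.reg 6 →
      Expr.eval w s' (.reg 25 % .reg 6) = j₂ := fun s' h₁ h₂ => by
    rw [eval_mod, eval_reg, eval_reg, h₁, h₂, h25, h6, hmod, Nat.mod_eq_of_lt (by omega)]
  have egrid : ∀ (x : Expr) i, i < m → x.eval w s = i →
      Expr.eval w s (.load (cellE 3 x)) = grid q i := fun x i hi hx => by
    rw [eval_load, eval_cellE h5 hx (by unfold cell; omega) (by omega), hgrid i hi]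
  have etest : Expr.eval w s (.bin .lt (.load (cellE 3 (.reg 25 / .reg 6)) +
      .load (cellE 3 (.reg 25 % .reg 6))) (.load (cellE 3 (.reg 24)))) = 0 ↔
      grid q j ≤ grid q j₁ + grid q j₂ := by
    rw [eval_lt_eq_zero _ _ _ _ (by omega), eval_add, egrid _ _ hj₁ (ediv s rfl rfl),
      egrid _ _ hj₂ (emod s rfl rfl), egrid _ _ hj (by rw [eval_reg, h24]), Nat.mod_eq_of_lt]
    have := hg _ hj₁
    have := hg _ hj₂
    omega
  refine runs_ite (fun he => ?_) (fun he => ?_)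
  · rw [ne_eq, etest] at he
    refine runs_skip ⟨?_, fun _ _ => rfl, rfl, by rw [if_neg he, h26]⟩
    simp only [cost_bin, cost_add, cost_div, cost_mod, cost_load, cost_cellE, cost_reg]
    omega
  rw [if_pos (etest.1 he)]
  set E := s.mem (cell n 4 (src + j₁)) with hE
  set g : ℕ → ℕ → ℕ := fun r i => s.mem (cell n 4 ((base + b + r) * m + i)) with hgdef
  -- the candidate arrives in register `27`
  suffices H : ∀ s₁ : State, (∀ r, r ≠ 27 → s₁.reg r = s.reg r) → s₁.reg 27 = E →
      s₁.mem = s.mem → Runs w (.ite (.reg 25 % .reg 6)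
        (.block [
          .assign 30 (.reg 22),
          .assign 31 (.reg 23),
          .assign 32 (.reg 27),
          bsearch 2 0,
          .ite (.bin .lt (.reg 33) (.reg 23))
            (.assign 27 (.load (cellE 4 ((.reg 22 + .reg 33) * .reg 6 + .reg 25 % .reg 6))))
            (.assign 27 (.reg 4 + .lit 1))])
        .skip) s₁ fun t s' => t ≤ 50 * F + 100 ∧ (∀ r < 27, s'.reg r = s.reg r) ∧
          s'.mem = s.mem ∧ s'.reg 27 = climb n (e - b) (countBelow f b e) g E j₂ by
    refine runs_cons (runs_assign E ?_ (runs_cons ((H (s.set 27 E) ?_ ?_ rfl).mono ?_)))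
    · rw [eval_load, eval_cellE (v := src + j₁) h5 ?_ (by unfold cell; omega) (by omega)]
      rw [eval_add, eval_reg, ediv s rfl rfl, h20, Nat.mod_eq_of_lt (by omega)]
    · exact fun r hr => by simp [hr]
    · simp
    rintro t s₂ ⟨ht, hr, hm₂, h27⟩
    refine runs_cons (runs_ite (fun hc => ?_) (fun hc => ?_))
    · rw [eval_lt_ne_zero _ _ _ _ (by omega), eval_reg, eval_reg, h27, hr 26 (by omega), h26] at hc
      refine runs_assign _ (by rw [eval_reg, h27]) (runs_nil ⟨?_, fun r hr' => ?_, hm₂, ?_⟩)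
      · simp only [cost_bin, cost_add, cost_div, cost_mod, cost_load, cost_cellE, cost_reg]
        omega
      · simp [show r ≠ 26 by omega, hr r (by omega)]
      · simp only [State.set_reg, if_true]
        exact (min_eq_right hc.le).symm
    · rw [eval_lt_eq_zero _ _ _ _ (by omega), eval_reg, eval_reg, h27, hr 26 (by omega), h26] at hc
      refine runs_skip (runs_nil ⟨?_, fun r hr' => hr r (by omega), hm₂, ?_⟩)
      · simp only [cost_bin, cost_add, cost_div, cost_mod, cost_load, cost_cellE, cost_reg]
        omega
      · rw [hr 26 (by omega), h26, min_eq_left hc]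
  intro s₁ hr₁ h27 hm₁
  refine runs_ite (fun hc => ?_) (fun hc => ?_)
  · rw [emod s₁ (hr₁ 25 (by omega)) (hr₁ 6 (by omega))] at hc
    refine runs_cons (runs_assign (base + b) (by rw [eval_reg, hr₁ 22 (by omega), h22]) (runs_cons
      (runs_assign (e - b) (by simp [eval_reg, hr₁, h23]) (runs_cons (runs_assign E
      (by simp [eval_reg, h27]) (runs_cons ((runs_bsearch_sorted (n := n) (base := base)
      (b := b) (e := e) (y := E) (F := F) (f := f) ?_ ?_ ?_ ?_ hpow (by omega) (by omega) ?_ hinj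
      ?_).mono ?_)))))))
    · simp [hr₁, h5]
    · simp
    · simp
    · simp
    · unfold cell; omega
    · simpa [hm₁] using hsorts
    rintro t₂ s₂ ⟨ht₂, hm₂, hr₂, h33⟩
    have e22 : s₂.reg 22 = base + b := by simp [hr₂, hr₁, h22]
    have e23 : s₂.reg 23 = e - b := by simp [hr₂, hr₁, h23]
    have e6 : s₂.reg 6 = s.reg 6 := by simp [hr₂, hr₁]
    have e25 : s₂.reg 25 = s.reg 25 := by simp [hr₂, hr₁]
    have ereg : ∀ r < 27, s₂.reg r = s.reg r := fun r hr => by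
      rw [hr₂ r (by omega)]
      simp [show r ≠ 30 by omega, show r ≠ 31 by omega, show r ≠ 32 by omega, hr₁ r (by omega)]
    have em : s₂.mem = s.mem := by simp [hm₂, hm₁]
    rw [Nat.add_zero] at h33
    refine runs_cons (runs_ite (fun hc' => ?_) (fun hc' => ?_))
    · rw [eval_lt_ne_zero _ _ _ _ (by omega), eval_reg, eval_reg, h33, e23] at hc'
      have hrow : (base + b + countBelow f b e E) * m + m ≤ (base + b + (e - b)) * m := by
        rw [← Nat.succ_mul]; exact Nat.mul_le_mul_right m (by omega)
      refine runs_assign _ rfl (runs_nil ⟨?_, fun r hr => ?_, em, ?_⟩)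
      · simp only [cost_add, cost_mul, cost_mod, cost_load, cost_cellE, cost_reg, cost_bin]
        omega
      · simp [show r ≠ 27 by omega, ereg r hr]
      · simp only [State.set_reg, if_true, climb, if_neg hc, if_pos hc']
        rw [eval_load, eval_cellE (n := n) (v := (base + b + countBelow f b e E) * m + j₂), em]
        · rw [ereg 5 (by omega), h5]
        · rw [eval_add, eval_mul, emod s₂ e25 e6, eval_add, eval_reg, eval_reg, eval_reg, h33, e22,
            e6, h6, Nat.mod_eq_of_lt (a := base + b + _) (by omega),
            Nat.mod_eq_of_lt (a := _ * m) (by omega), Nat.mod_eq_of_lt (by omega)]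
        · unfold cell; omega
        · omega
    · rw [eval_lt_eq_zero _ _ _ _ (by omega), eval_reg, eval_reg, h33, e23] at hc'
      refine runs_assign (n + 1) ?_ (runs_nil ⟨?_, fun r hr => ?_, em, ?_⟩)
      · rw [eval_add, eval_reg, eval_lit, ereg 4 (by omega), h4, Nat.mod_eq_of_lt (a := 1) (by omega),
          Nat.mod_eq_of_lt (by omega)]
      · simp only [cost_add, cost_mod, cost_reg, cost_bin, cost_lit]
        omega
      · simp [show r ≠ 27 by omega, ereg r hr]
      · simp only [State.set_reg, if_true, climb, if_neg hc, if_neg (not_lt.2 hc')]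
  · rw [emod s₁ (hr₁ 25 (by omega)) (hr₁ 6 (by omega))] at hc
    refine runs_skip ⟨?_, fun r hr => hr₁ r (by omega), hm₁, ?_⟩
    · simp only [cost_mod, cost_reg]; omega
    · rw [h27, climb, if_pos hc]

theorem climb_congr {len n e j : ℕ} {r : ℕ → ℕ} {g g' : ℕ → ℕ → ℕ}
    (h : ∀ i < len, g i j = g' i j) : climb n len r g e j = climb n len r g' e j := by
  unfold climb
  split_ifs with h₁ h₂
  · rfl
  · exact h _ h₂
  · rfl

/-- For every grid length, `extendRow` finds the least height by trying all pairs of a grid length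
of the row and a grid length of the block. -/
theorem runs_extendRow (h : ExtendInput n q base b e src dst f s)
    (hB : ExtendBounds w n q base b e src dst F Z f) :
    Runs w extendRow s fun t s' =>
      t ≤ gridSize q n * (gridSize q n * gridSize q n * (50 * F + 250) + 100) + 10 ∧
      (∀ r < 24, s'.reg r = s.reg r) ∧
      (∀ x, (∀ j < gridSize q n, x ≠ cell n 4 (dst + j)) → s'.mem x = s.mem x) ∧
      IsExtension n q (e - b) (countBelow f b e)
        (fun r i => s.mem (cell n 4 ((base + b + r) * gridSize q n + i)))
        (fun i => s.mem (cell n 4 (src + i))) (fun i => s'.mem (cell n 4 (dst + i))) := by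
  have hm := gridSize_pos (q := q) (n := n)
  have hword : 2 * n + 8 * Z + 8 < 2 ^ w := hB.word
  have hn := hB.n_le
  have hsize := hB.size_le
  have hmm : gridSize q n ≤ gridSize q n * gridSize q n := Nat.le_mul_of_pos_right _ hm
  set m := gridSize q n with hmdef
  set g : ℕ → ℕ → ℕ := fun r i => s.mem (cell n 4 ((base + b + r) * m + i)) with hg
  set T : ℕ → ℕ := fun i => s.mem (cell n 4 (src + i)) with hT
  have hrow : ∀ r < e - b, ∀ i < m, (base + b + r) * m + i < dst := fun r hr i hi => by
    have : (base + b + r + 1) * m ≤ (base + b + (e - b)) * m := Nat.mul_le_mul_right m (by omega)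
    rw [Nat.succ_mul] at this
    have := hB.block_dst
    rw [← hmdef] at this
    omega
  refine (runs_for (fun j s' => (∀ r < 24, s'.reg r = s.reg r) ∧
    (∀ x, (∀ j < m, x ≠ cell n 4 (dst + j)) → s'.mem x = s.mem x) ∧
    (∀ i < j, s'.mem (cell n 4 (dst + i)) ≤ n + 1) ∧
    (∀ i < j, s'.mem (cell n 4 (dst + i)) = n + 1 ∨ ∃ j₁ < m, ∃ j₂ < m,
      QueryLIS.grid q i ≤ QueryLIS.grid q j₁ + QueryLIS.grid q j₂ ∧
      s'.mem (cell n 4 (dst + i)) = climb n (e - b) (countBelow f b e) g (T j₁) j₂) ∧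
    (∀ i < j, ∀ j₁ < m, ∀ j₂ < m,
      QueryLIS.grid q i ≤ QueryLIS.grid q j₁ + QueryLIS.grid q j₂ →
      s'.mem (cell n 4 (dst + i)) ≤ climb n (e - b) (countBelow f b e) g (T j₁) j₂))
    (m * m * (50 * F + 250) + 50) m (by omega) ?_ ?_ ?_).mono ?_
  · exact ⟨fun r hr => by simp [show r ≠ 24 by omega], fun _ _ => rfl, by simp, by simp, by simp⟩
  · rintro k s' - - ⟨hr, -⟩
    rw [eval_reg, hr 6 (by omega), h.h6]
  · rintro j s₁ hj h24 ⟨hr₁, hm₁, hle, hatt, hmin⟩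
    have hmem₁ : ∀ k v, k < 4 → s₁.mem (cell n k v) = s.mem (cell n k v) := fun k v hk =>
      hm₁ _ fun i _ => by unfold cell; omega
    have hT₁ : ∀ i < m, s₁.mem (cell n 4 (src + i)) = T i := fun i hi =>
      hm₁ _ fun i' hi' => by
        have := hB.src_dst
        rw [← hmdef] at this
        unfold cell; omega
    have hg₁ : ∀ r < e - b, ∀ i < m, s₁.mem (cell n 4 ((base + b + r) * m + i)) = g r i :=
      fun r hr i hi => hm₁ _ fun i' hi' => by
        have := hrow r hr i hi
        unfold cell; omega
    refine runs_cons (runs_assign (n + 1) ?_ (runs_cons ((runs_for (fun c s' =>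
      (∀ r < 25, s'.reg r = s₁.reg r) ∧ s'.mem = s₁.mem ∧ s'.reg 26 ≤ n + 1 ∧
      (s'.reg 26 = n + 1 ∨ ∃ j₁ < m, ∃ j₂ < m,
        QueryLIS.grid q j ≤ QueryLIS.grid q j₁ + QueryLIS.grid q j₂ ∧
        s'.reg 26 = climb n (e - b) (countBelow f b e) g (T j₁) j₂) ∧
      (∀ j₁ < m, ∀ j₂ < m, j₁ * m + j₂ < c →
        QueryLIS.grid q j ≤ QueryLIS.grid q j₁ + QueryLIS.grid q j₂ →
        s'.reg 26 ≤ climb n (e - b) (countBelow f b e) g (T j₁) j₂))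
      (50 * F + 200) (m * m) (by omega) ?_ ?_ ?_).mono ?_)))
    · rw [eval_add, eval_reg, eval_lit, hr₁ 4 (by omega), h.h4, Nat.mod_eq_of_lt (a := 1) (by omega),
        Nat.mod_eq_of_lt (by omega)]
    · exact ⟨fun r hr => by simp [show r ≠ 25 by omega, show r ≠ 26 by omega], rfl, by simp,
        by simp, by simp⟩
    · rintro k s₂ - - ⟨hr₂, -⟩
      rw [eval_mul, eval_reg, hr₂ 6 (by omega), hr₁ 6 (by omega), h.h6, ← hmdef,
        Nat.mod_eq_of_lt (by omega)]
    · rintro c s₂ hc h25 ⟨hr₂, hm₂, hle₂, hatt₂, hmin₂⟩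
      have hc₁ : c / m < m := (Nat.div_lt_iff_lt_mul hm).2 hc
      have hc₂ : c % m < m := Nat.mod_lt c hm
      have hin : ExtendInput n q base b e src dst f s₂ := h.congr
        (fun r hr => (hr₂ r (by omega)).trans (hr₁ r hr))
        (fun k v hk => by rw [hm₂, hmem₁ k v hk])
      refine (runs_tryPair hin hB ((hr₂ 24 (by omega)).trans h24)
        (h25.trans (by rw [Nat.mul_comm]; exact (Nat.div_add_mod c m).symm)) rfl hj hc₁ hc₂).mono ?_
      rintro t s₃ ⟨ht, hr₃, hm₃, h26⟩
      rw [hm₂, ← hmdef, hT₁ _ hc₁, climb_congr (g' := g) fun r hr => hg₁ r hr _ hc₂] at h26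
      refine ⟨ht, (hr₃ 25 (by omega)).trans h25, fun r hr => ?_, hm₃.trans hm₂, ?_, ?_, ?_⟩
      · simp [show r ≠ 25 by omega, hr₃ r (by omega), hr₂ r hr]
      · simp only [State.set_reg]
        norm_num
        rw [h26]
        split_ifs
        · exact (min_le_left _ _).trans hle₂
        · exact hle₂
      · simp only [State.set_reg]
        norm_num
        rw [h26]
        split_ifs with hjj
        · rcases min_choice (s₂.reg 26) (climb n (e - b) (countBelow f b e) g (T (c / m)) (c % m))
            with h' | h' <;> rw [h']
          · exact hatt₂
          · exact Or.inr ⟨_, hc₁, _, hc₂, hjj, rfl⟩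
        · exact hatt₂
      · simp only [State.set_reg]
        norm_num
        intro j₁ hj₁ j₂ hj₂ hlt hjj
        rw [h26]
        rcases Nat.lt_or_eq_of_le hlt with hlt | rfl
        · have := hmin₂ j₁ hj₁ j₂ hj₂ hlt hjj
          split_ifs
          · exact (min_le_left _ _).trans this
          · exact this
        · have hdiv : (j₁ * m + j₂) / m = j₁ := by
            rw [Nat.mul_comm, Nat.mul_add_div hm, Nat.div_eq_of_lt hj₂, Nat.add_zero]
          have hmod : (j₁ * m + j₂) % m = j₂ := by
            rw [Nat.mul_comm, Nat.mul_add_mod, Nat.mod_eq_of_lt hj₂]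
          rw [hdiv, hmod, if_pos hjj]
          exact min_le_right _ _
    rintro t s₂ ⟨ht, -, hr₂, hm₂, hle₂, hatt₂, hmin₂⟩
    have hdst := hB.dst_le
    rw [← hmdef] at hdst
    refine runs_cons (runs_store (cell n 4 (dst + j)) (s₂.reg 26) ?_ rfl
      (runs_nil ⟨?_, ?_, ?_, ?_, ?_, ?_, ?_⟩))
    · refine eval_cellE ?_ ?_ (by unfold cell; omega) (by omega)
      · rw [hr₂ 5 (by omega), hr₁ 5 (by omega), h.h5]
      · rw [eval_add, eval_reg, eval_reg, hr₂ 21 (by omega), hr₁ 21 (by omega), hr₂ 24 (by omega),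
          h.h21, h24, Nat.mod_eq_of_lt (by omega)]
    · simp only [cost_add, cost_mul, cost_reg, cost_lit, cost_cellE] at ht ⊢
      have : m * m * (50 * F + 200 + (1 + 1 + 1) + 8) ≤ m * m * (50 * F + 250) :=
        Nat.mul_le_mul_left _ (by omega)
      omega
    · exact (hr₂ 24 (by omega)).trans h24
    · intro r hr
      simp [show r ≠ 24 by omega, hr₂ r (by omega), hr₁ r hr]
    · intro x hx
      rw [State.set_mem, State.put_mem, if_neg (hx j hj), hm₂, hm₁ x hx]
    all_goals
      intro i hi
      rw [State.set_mem, State.put_mem]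
      split_ifs with heq
      · rw [cell_inj (by omega) (by omega)] at heq
        obtain rfl : i = j := by omega
        first
          | exact hle₂
          | exact hatt₂
          | exact fun j₁ hj₁ j₂ hj₂ => hmin₂ j₁ hj₁ j₂ hj₂ (by
              have : (j₁ + 1) * m ≤ m * m := Nat.mul_le_mul_right m hj₁
              rw [Nat.succ_mul] at this; omega)
      · rw [cell_inj (by omega) (by omega)] at heq
        have hij : i < j := by omega
        rw [hm₂]
        first
          | exact hle i hij
          | exact hatt i hij
          | exact hmin i hij
  · rintro t s' ⟨ht, -, hr, hm', hle, hatt, hmin⟩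
    refine ⟨ht.trans ?_, hr, hm', hle, hatt, hmin⟩
    have : m * (m * m * (50 * F + 250) + 50 + 1 + 8) ≤ m * (m * m * (50 * F + 250) + 100) :=
      Nat.mul_le_mul_left _ (by omega)
    simp only [cost_reg]
    linarith

end Extend

/-! ### The rows of all blocks -/

/-- The entries of array `4` from index `idx` on. -/
def rowAt (n idx : ℕ) (μ : ℕ → ℕ) (j : ℕ) : ℕ := μ (cell n 4 (idx + j))

/-- The rows of level `h`: the row with number `h * n + p` describes the block around column `p`,
from the height of the `p`-th entry of the sorted level `h` on. -/
def HasRows (n q : ℕ) (f : ℕ → ℕ) (μ : ℕ → ℕ) (h : ℕ) : Prop :=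
  ∀ p < n, IsRow f n q (blockStart h p) (min n (blockStart h p + 2 ^ h)) (μ (cell n 2 (h * n + p)))
    (2 * h) (rowAt n ((h * n + p) * gridSize q n) μ)

/-- The sizes involved: `H` is the number of the top level, and `Z` bounds all indices. -/
structure Sizes (w n q H Z : ℕ) (f : ℕ → ℕ) : Prop where
  pos : 0 < n
  lt : ∀ h < H, 2 ^ h < n
  le : n ≤ 2 ^ H
  inj : Set.InjOn f (Set.Ico 0 n)
  val : ∀ i < n, f i < n
  rows_le : ((H + 1) * n + (2 * H + 4)) * gridSize q n ≤ Z
  size_le : gridSize q n * gridSize q n ≤ Z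
  n_le : n + 1 ≤ Z
  word : cell n 8 Z < 2 ^ w

/-- The constants, the grid and the sorted levels are in their places. -/
structure Ready (n q H : ℕ) (f : ℕ → ℕ) (s : State) : Prop where
  h4 : s.reg 4 = n
  h5 : s.reg 5 = 2 * n
  h6 : s.reg 6 = gridSize q n
  h7 : s.reg 7 = H
  h8 : s.reg 8 = (H + 1) * n * gridSize q n
  grid : ∀ j < gridSize q n, s.mem (cell n 3 j) = grid q j
  levels : HasLevels n H 2 f s.mem

section Fill

variable {w n q H Z : ℕ} {s s' : State} {f : ℕ → ℕ}

theorem Ready.congr (h : Ready n q H f s) (hr : ∀ r < 10, s'.reg r = s.reg r)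
    (hm : ∀ x, (∀ v, x ≠ cell n 4 v) → s'.mem x = s.mem x) : Ready n q H f s' where
  h4 := (hr 4 (by omega)).trans h.h4
  h5 := (hr 5 (by omega)).trans h.h5
  h6 := (hr 6 (by omega)).trans h.h6
  h7 := (hr 7 (by omega)).trans h.h7
  h8 := (hr 8 (by omega)).trans h.h8
  grid j hj := (hm _ fun v => by unfold cell; omega).trans (h.grid j hj)
  levels h' hh' := (h.levels h' hh').congr fun p _ => hm _ fun v => by unfold cell; omega

/-- `extendRow` on the level of rows. -/
theorem runs_extendRow_isRow {base b e src dst F lo e₁ d : ℕ}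
    (h : ExtendInput n q base b e src dst f s)
    (hB : ExtendBounds w n q base b e src dst F Z f)
    (hlo : lo ≤ b) (hbe : b ≤ e) (hen : e ≤ n) (hval : ∀ i < n, f i < n)
    (hT : IsRow f n q lo b e₁ d (rowAt n src s.mem))
    (hg : ∀ r < e - b, IsRow f n q b e (s.mem (cell n 2 (base + (b + r)))) d
      (rowAt n ((base + (b + r)) * gridSize q n) s.mem)) :
    Runs w extendRow s fun t s' =>
      t ≤ gridSize q n * (gridSize q n * gridSize q n * (50 * F + 250) + 100) + 10 ∧
      (∀ r < 24, s'.reg r = s.reg r) ∧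
      (∀ x, (∀ j < gridSize q n, x ≠ cell n 4 (dst + j)) → s'.mem x = s.mem x) ∧
      IsRow f n q lo e e₁ (d + 1) (rowAt n dst s'.mem) := by
  refine (runs_extendRow h hB).mono ?_
  rintro t s' ⟨ht, hr, hm, hext⟩
  refine ⟨ht, hr, hm, ?_⟩
  have hs := h.sorts
  refine hext.isRow (a := fun k => s.mem (cell n 2 (base + (b + k)))) hT hlo hbe hen ?_ ?_ ?_ ?_
  · intro k hk
    exact (hg k hk).congr fun j _ => by rw [rowAt, Nat.add_assoc base b k]
  · intro k hk
    obtain ⟨i, _, h₂, -, h₄⟩ := hs.exists_eq hB.inj hk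
    exact h₄ ▸ hval i (by omega)
  · exact fun y hy => hs.le_of_countBelow_lt hB.inj hy
  · exact fun y i h₁ h₂ hy => hs.countBelow_le_of_le hB.inj h₁ h₂ hy

/-- Writes the row of an empty block: the height in register `28`, and then `n + 1` everywhere. The
row starts at the index in register `21`. -/
def initRow : Cmd :=
  .block [.for 24 (.reg 6) (.store (cellE 4 (.reg 21 + .reg 24)) (.reg 4 + .lit 1)),
    .store (cellE 4 (.reg 21)) (.reg 28)]

theorem runs_initRow {dst e₁ : ℕ} (h4 : s.reg 4 = n) (h5 : s.reg 5 = 2 * n)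
    (h6 : s.reg 6 = gridSize q n) (h21 : s.reg 21 = dst) (h28 : s.reg 28 = e₁)
    (hdst : dst + gridSize q n ≤ Z) (hw : cell n 8 Z < 2 ^ w) :
    Runs w initRow s fun t s' => t ≤ gridSize q n * 50 + 50 ∧
      (∀ r, r ≠ 24 → s'.reg r = s.reg r) ∧
      (∀ x, (∀ j < gridSize q n, x ≠ cell n 4 (dst + j)) → s'.mem x = s.mem x) ∧
      ∀ j < gridSize q n, rowAt n dst s'.mem j = if j = 0 then e₁ else n + 1 := by
  have hm := gridSize_pos (q := q) (n := n)
  have hmn := gridSize_le q n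
  unfold cell at hw
  refine runs_cons ((runs_for (fun j s' => (∀ r, r ≠ 24 → s'.reg r = s.reg r) ∧
    (∀ x, (∀ j < gridSize q n, x ≠ cell n 4 (dst + j)) → s'.mem x = s.mem x) ∧
    ∀ i < j, rowAt n dst s'.mem i = n + 1) 20 (gridSize q n) (by omega) ?_ ?_ ?_).mono ?_)
  · exact ⟨fun r hr => by simp [hr], fun _ _ => rfl, by simp⟩
  · rintro k s' - - ⟨hr, -⟩
    rw [eval_reg, hr 6 (by omega), h6]
  · rintro j s₁ hj h24 ⟨hr, hm₁, hrow⟩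
    refine runs_store (cell n 4 (dst + j)) (n + 1) ?_ ?_ ⟨?_, h24, fun r hr' => ?_, ?_, ?_⟩
    · refine eval_cellE ((hr 5 (by omega)).trans h5) ?_ (by unfold cell; omega) (by omega)
      rw [eval_add, eval_reg, eval_reg, hr 21 (by omega), h21, h24, Nat.mod_eq_of_lt (by omega)]
    · rw [eval_add, eval_reg, eval_lit, hr 4 (by omega), h4, Nat.mod_eq_of_lt (a := 1) (by omega),
        Nat.mod_eq_of_lt (by omega)]
    · simp [cost_cellE, cost_add, cost_reg, cost_lit]
    · simp [hr', hr r hr']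
    · intro x hx
      rw [State.set_mem, State.put_mem, if_neg (hx j hj), hm₁ x hx]
    · intro i hi
      rw [rowAt, State.set_mem, State.put_mem]
      split_ifs with heq
      · rfl
      · rw [cell_inj (by omega) (by omega)] at heq
        exact hrow i (by omega)
  · rintro t s₁ ⟨ht, -, hr, hm₁, hrow⟩
    refine runs_cons (runs_store (cell n 4 dst) e₁ ?_ ?_ (runs_nil ⟨?_, hr, ?_, ?_⟩))
    · exact eval_cellE ((hr 5 (by omega)).trans h5) (by rw [eval_reg, hr 21 (by omega), h21])
        (by unfold cell; omega) (by omega)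
    · rw [eval_reg, hr 28 (by omega), h28]
    · simp only [cost_cellE, cost_reg] at ht ⊢
      omega
    · intro x hx
      rw [State.put_mem, if_neg (by simpa using hx 0 hm), hm₁ x hx]
    · intro j hj
      rw [rowAt, State.put_mem]
      split_ifs with heq hj₀ hj₀
      · rfl
      · rw [cell_inj (by omega) (by omega)] at heq; omega
      · rw [cell_inj (by omega) (by omega)] at heq; omega
      · exact hrow j hj

/-- The rows of level `0`: single columns. -/
def leafRows : Cmd :=
  .for 13 (.reg 4) (.block [
    .assign 21 (.reg 13 * .reg 6),
    .assign 28 (.load (cellE 2 (.reg 13))),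
    initRow,
    .store (cellE 4 (.reg 21 + .lit 1)) (.reg 28 + .lit 1)])

theorem runs_leafRows (hS : Sizes w n q H Z f) (h : Ready n q H f s) :
    Runs w leafRows s fun t s' => t ≤ n * (gridSize q n * 50 + 200) + 20 ∧
      (∀ r < 10, s'.reg r = s.reg r) ∧ (∀ x, (∀ v, x ≠ cell n 4 v) → s'.mem x = s.mem x) ∧
      HasRows n q f s'.mem 0 := by
  have hword : 2 * n + 8 * Z + 8 < 2 ^ w := hS.word
  have hZn := hS.n_le
  have hm := gridSize_pos (q := q) (n := n)
  have hm₁ : 1 < gridSize q n := lt_gridSize.2 (by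
    have := hS.pos
    simp [grid]; omega)
  have hrows := hS.rows_le
  have hnm : n * gridSize q n ≤ ((H + 1) * n + (2 * H + 4)) * gridSize q n :=
    Nat.mul_le_mul_right _ ((Nat.le_mul_of_pos_left n (Nat.succ_pos H)).trans (Nat.le_add_right _ _))
  have hstart : ∀ p, blockStart 0 p = p := by simp [blockStart]
  refine (runs_for (fun p s' => (∀ r < 10, s'.reg r = s.reg r) ∧
    (∀ x, (∀ v, x ≠ cell n 4 v) → s'.mem x = s.mem x) ∧
    ∀ p' < p, IsRow f n q (blockStart 0 p') (min n (blockStart 0 p' + 2 ^ 0))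
      (s'.mem (cell n 2 (0 * n + p'))) (2 * 0) (rowAt n ((0 * n + p') * gridSize q n) s'.mem))
    (gridSize q n * 50 + 150) n (by omega) ?_ ?_ ?_).mono ?_
  · exact ⟨fun r hr => by simp [show r ≠ 13 by omega], fun _ _ => rfl, by simp⟩
  · rintro k s' - - ⟨hr, -⟩
    rw [eval_reg, hr 4 (by omega), h.h4]
  · rintro p s₁ hp h13 ⟨hr, hmem, hrow⟩
    have hR := h.congr hr hmem
    have hpm : (p + 1) * gridSize q n ≤ n * gridSize q n := Nat.mul_le_mul_right _ hp
    rw [Nat.succ_mul] at hpm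
    have hfp : s₁.mem (cell n 2 p) = f p := by
      have h₁ := hR.levels 0 (Nat.zero_le _) p hp
      have h₂ := levelPos_bounds (f := f) (h := 0) hp
      rw [hstart] at h₂
      rw [show levelPos n f 0 p = p by simp at h₂; omega] at h₁
      simpa using h₁
    refine runs_cons (runs_assign (p * gridSize q n) ?_ (runs_cons (runs_assign (f p) ?_ (runs_cons
      ((runs_initRow (n := n) (q := q) (Z := Z) (dst := p * gridSize q n) (e₁ := f p) ?_ ?_ ?_ ?_ ?_
      (by omega) hS.word).mono ?_)))))
    · rw [eval_mul, eval_reg, eval_reg, h13, hR.h6, Nat.mod_eq_of_lt (by omega)]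
    · rw [eval_load, eval_cellE (n := n) (v := p) (by simp [hR.h5]) (by simp [eval_reg, h13])
        (by unfold cell; omega) (by omega), State.set_mem, hfp]
    · simp [hR.h4]
    · simp [hR.h5]
    · simp [hR.h6]
    · simp
    · simp
    rintro t s₂ ⟨ht, hr₂, hm₂, hrow₂⟩
    have hfp' := hS.val p hp
    refine runs_cons (runs_store (cell n 4 (p * gridSize q n + 1)) (f p + 1) ?_ ?_
      (runs_nil ⟨?_, ?_, fun r hr' => ?_, ?_, ?_⟩))
    · refine eval_cellE (by simp [hr₂, hR.h5]) ?_ (by unfold cell; omega) (by omega)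
      simp only [eval_add, eval_reg, eval_lit]
      rw [hr₂ 21 (by omega), Nat.mod_eq_of_lt (a := 1) (by omega)]
      simp only [State.set_reg]
      norm_num
      exact Nat.mod_eq_of_lt (by omega)
    · simp only [eval_add, eval_reg, eval_lit]
      rw [hr₂ 28 (by omega), Nat.mod_eq_of_lt (a := 1) (by omega)]
      simp only [State.set_reg]
      norm_num
      exact Nat.mod_eq_of_lt (by omega)
    · simp only [cost_mul, cost_add, cost_load, cost_cellE, cost_reg, cost_lit]
      omega
    · simp [hr₂, h13]
    · have h₁ : r ≠ 13 := by omega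
      have h₂ : r ≠ 21 := by omega
      have h₃ : r ≠ 28 := by omega
      have h₄ : r ≠ 24 := by omega
      simp [h₁, h₂, h₃, hr₂ r h₄, hr r hr']
    · intro x hx
      rw [State.set_mem, State.put_mem, if_neg (hx _), hm₂ x fun j _ => hx _]
      exact hmem x hx
    · intro p' hp'
      have h2 : (((s₂.put (cell n 4 (p * gridSize q n + 1)) (f p + 1)).set 13 (p + 1)).mem
          (cell n 2 (0 * n + p'))) = s₁.mem (cell n 2 (0 * n + p')) := by
        rw [State.set_mem, State.put_mem, if_neg (by unfold cell; omega),
          hm₂ _ fun j _ => by unfold cell; omega]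
        rfl
      rw [h2]
      rcases Nat.lt_or_eq_of_le (Nat.le_of_lt_succ hp') with hlt | rfl
      · refine (hrow p' hlt).congr fun j hj => ?_
        have : (p' + 1) * gridSize q n ≤ p * gridSize q n := Nat.mul_le_mul_right _ hlt
        rw [Nat.succ_mul] at this
        rw [Nat.zero_mul, Nat.zero_add, rowAt, rowAt, State.set_mem, State.put_mem,
          if_neg (by unfold cell; omega), hm₂ _ fun j' _ => by unfold cell; omega]
        rfl
      · rw [Nat.zero_mul, Nat.zero_add, hstart, hfp, pow_zero, min_eq_right hp]
        refine IsRow.congr (isRow_singleton (T := fun j => if j = 0 then f p' else if j = 1 then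
          f p' + 1 else n + 1) hfp' hS.pos fun j => rfl) fun j hj => ?_
        rw [rowAt, State.set_mem, State.put_mem]
        have := hrow₂ j hj
        rw [rowAt] at this
        rw [this]
        by_cases hj₁ : j = 1
        · simp [hj₁]
        · rw [if_neg, if_neg hj₁]
          rw [cell_inj (by omega) (by omega)]
          omega
  · rintro t s' ⟨ht, -, hr, hmem, hrow⟩
    refine ⟨ht.trans ?_, hr, hmem, hrow⟩
    have : n * (gridSize q n * 50 + 150 + 1 + 8) ≤ n * (gridSize q n * 50 + 200) :=
      Nat.mul_le_mul_left _ (by omega)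
    simp only [cost_reg]
    linarith

end Fill

section Fill

variable {w n q H Z : ℕ} {s s' : State} {f : ℕ → ℕ}

theorem Sizes.extendBounds {base b e src dst : ℕ} (hS : Sizes w n q H Z f) (hbe : b ≤ e)
    (hen : e ≤ n) (hbase : (base + n) * gridSize q n ≤ dst) (hsrc : src + gridSize q n ≤ Z)
    (hdst : dst + gridSize q n ≤ Z)
    (hsd : src + gridSize q n ≤ dst ∨ dst + gridSize q n ≤ src) :
    ExtendBounds w n q base b e src dst (H + 1) Z f := by
  have h : (base + b + (e - b)) * gridSize q n ≤ (base + n) * gridSize q n :=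
    Nat.mul_le_mul_right _ (by omega)
  refine ⟨hS.inj.mono (Set.Ico_subset_Ico (Nat.zero_le _) hen), ?_, hS.n_le, hsrc, hdst, by omega,
    hS.size_le, hS.word, hsd, by omega⟩
  have := hS.le
  have := Nat.two_pow_pos H
  rw [pow_succ]
  omega

/-- The row in register `13` of the level above that of register `10`, which starts at index
`reg 11`. Two scratch rows are used from index `reg 8` on: the row of an empty block, and the
first extension, by the left half of the block. -/
def parentRow : Cmd :=
  .block [
    halves,
    .assign 28 (.load (cellE 2 (.reg 11 + .reg 4 + .reg 13))),
    .assign 21 (.reg 8),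
    initRow,
    .assign 20 (.reg 8),
    .assign 21 (.reg 8 + .reg 6),
    .assign 22 (.reg 11 + .reg 14),
    .assign 23 (.reg 15 - .reg 14),
    extendRow,
    .assign 20 (.reg 8 + .reg 6),
    .assign 21 ((.reg 11 + .reg 4 + .reg 13) * .reg 6),
    .assign 22 (.reg 11 + .reg 15),
    .assign 23 (.reg 16 - .reg 15),
    extendRow]

/-- A bound for the time of `extendRow`. -/
def extendTime (m H : ℕ) : ℕ := m * (m * m * (50 * H + 300) + 100) + 10

/-- The row of a block is that of an empty block, extended by the two halves of the block; each of
the extensions costs one more factor `1 + 1 / q`. -/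
theorem runs_parentRow {h p : ℕ} (hS : Sizes w n q H Z f) (hR : Ready n q H f s) (hh : h < H)
    (h10 : s.reg 10 = 2 ^ h) (h11 : s.reg 11 = h * n) (h13 : s.reg 13 = p) (hp : p < n)
    (hrows : HasRows n q f s.mem h) :
    Runs w parentRow s fun t s' =>
      t ≤ 2 * extendTime (gridSize q n) H + gridSize q n * 50 + 250 ∧
      (∀ r < 14, s'.reg r = s.reg r) ∧ (∀ x, (∀ v, x ≠ cell n 4 v) → s'.mem x = s.mem x) ∧
      (∀ v, v < (H + 1) * n * gridSize q n →
        (∀ j < gridSize q n, v ≠ ((h + 1) * n + p) * gridSize q n + j) →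
        s'.mem (cell n 4 v) = s.mem (cell n 4 v)) ∧
      IsRow f n q (blockStart (h + 1) p) (min n (blockStart (h + 1) p + 2 ^ (h + 1)))
        (s.mem (cell n 2 ((h + 1) * n + p))) (2 * (h + 1))
        (rowAt n (((h + 1) * n + p) * gridSize q n) s'.mem) := by
  have hword : 2 * n + 8 * Z + 8 < 2 ^ w := hS.word
  have hZn := hS.n_le
  have hZrows := hS.rows_le
  have hm := gridSize_pos (q := q) (n := n)
  have hlev := (hR.levels h hh.le).sorts_halves (b := blockStart (h + 1) p) dvd_blockStart
  set m := gridSize q n with hmdef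
  set b := blockStart (h + 1) p with hb
  set mid := min n (b + 2 ^ h) with hmid
  set e := min n (b + 2 ^ (h + 1)) with he
  set R := (H + 1) * n * m with hRdef
  have hRsum : ((H + 1) * n + (2 * H + 4)) * m = R + (2 * H + 4) * m := Nat.add_mul _ _ _
  have hRm : 4 * m ≤ (2 * H + 4) * m := Nat.mul_le_mul_right _ (by omega)
  have hhn : (h + 1) * n + n ≤ (H + 1) * n := by
    rw [← Nat.succ_mul]; exact Nat.mul_le_mul_right n (by omega)
  have hhn' : (h + 1) * n = h * n + n := Nat.succ_mul h n
  have hHnR : (H + 1) * n ≤ R := Nat.le_mul_of_pos_right _ hm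
  have hdst : ((h + 1) * n + p) * m + m ≤ R := by
    rw [← Nat.succ_mul]; exact Nat.mul_le_mul_right _ (by omega)
  have hdst' : (h * n + n) * m ≤ ((h + 1) * n + p) * m := Nat.mul_le_mul_right _ (by omega)
  have hbp : b ≤ p := blockStart_le
  have hpow := pow_succ 2 h
  have hbm : b ≤ mid := by omega
  have hme : mid ≤ e := by omega
  have hen : e ≤ n := by omega
  have hd : 2 ^ h ∣ b := (pow_dvd_pow 2 h.le_succ).trans dvd_blockStart
  refine runs_cons ((runs_halves hR.h4 h10 h13 hp (hS.lt h hh).le (by omega)).mono ?_)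
  rintro t₁ s₁ ⟨ht₁, hm₁, hr₁, h14, h15, h16⟩
  have r₁ : ∀ r < 14, s₁.reg r = s.reg r := fun r hr =>
    hr₁ r (by omega) (by omega) (by omega)
  set e₁ := s.mem (cell n 2 ((h + 1) * n + p)) with he₁
  have he₁n : e₁ ≤ n + 1 := by
    have := (hR.levels (h + 1) hh).sorts (b := b) dvd_blockStart
    have hpe : p < min n (b + 2 ^ (h + 1)) := by
      have : p < b + 2 ^ (h + 1) := lt_blockStart_add
      omega
    obtain ⟨i, _, h₂, -, h₄⟩ := this.exists_eq (k := p - b)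
      (hS.inj.mono (Set.Ico_subset_Ico (Nat.zero_le _) hen)) (by omega)
    rw [show b + (p - b) = p by omega] at h₄
    have := hS.val i (by omega)
    omega
  refine runs_cons (runs_assign e₁ ?_ (runs_cons (runs_assign R ?_ (runs_cons
    ((runs_initRow (n := n) (q := q) (Z := Z) (dst := R) (e₁ := e₁) ?_ ?_ ?_ ?_ ?_ (by omega)
    hS.word).mono ?_)))))
  · rw [eval_load, eval_cellE (n := n) (v := (h + 1) * n + p) ((r₁ 5 (by omega)).trans hR.h5) ?_
      (by unfold cell; omega) (by omega), hm₁]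
    simp only [eval_add, eval_reg, r₁ 11 (by omega), r₁ 4 (by omega), r₁ 13 (by omega), h11, h13,
      hR.h4]
    rw [Nat.mod_eq_of_lt (a := h * n + n) (by omega), Nat.mod_eq_of_lt (by omega), hhn']
  · simp [eval_reg, r₁, hR.h8, hRdef, hmdef]
  · simp [r₁, hR.h4]
  · simp [r₁, hR.h5]
  · simp [r₁, hR.h6]
  · simp
  · simp
  rintro t₂ s₂ ⟨ht₂, hr₂, hm₂, hrow₂⟩
  rw [← hmdef] at ht₂ hm₂ hrow₂
  have r₂ : ∀ r < 14, s₂.reg r = s.reg r := fun r hr => by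
    rw [hr₂ r (by omega)]
    simp [show r ≠ 21 by omega, show r ≠ 28 by omega, r₁ r hr]
  have m₂ : ∀ k v, k < 4 → s₂.mem (cell n k v) = s.mem (cell n k v) := fun k v hk => by
    rw [hm₂ _ fun j _ => by unfold cell; omega]
    simp [hm₁]
  have g₂ : ∀ v < R, s₂.mem (cell n 4 v) = s.mem (cell n 4 v) := fun v hv => by
    rw [hm₂ _ fun j _ => by unfold cell; omega]
    simp [hm₁]
  have e14 : s₂.reg 14 = b := by simp [hr₂, h14, hb]
  have e15 : s₂.reg 15 = mid := by simp [hr₂, h15, hmid, hb]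
  have e16 : s₂.reg 16 = e := by simp [hr₂, h16, he, hb]
  -- the left half
  refine runs_cons (runs_assign R ?_ (runs_cons (runs_assign (R + m) ?_ (runs_cons
    (runs_assign (h * n + b) ?_ (runs_cons (runs_assign (mid - b) ?_ (runs_cons
    ((runs_extendRow_isRow (w := w) (Z := Z) (n := n) (q := q) (f := f) (base := h * n) (b := b)
    (e := mid) (src := R) (dst := R + m) (F := H + 1) (lo := b) (e₁ := e₁) (d := 2 * h) ?_
    (hS.extendBounds hbm (by omega) (show (h * n + n) * m ≤ R + m by omega) (by omega) (by omega)
      (by omega)) le_rfl hbm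
    (by omega) hS.val ?_ ?_).mono ?_)))))))))
  · rw [eval_reg, r₂ 8 (by omega), hR.h8]
  · simp [eval_add, eval_reg, r₂, hR.h8, hR.h6, ← hmdef, ← hRdef]
    exact Nat.mod_eq_of_lt (by omega)
  · simp [eval_add, eval_reg, r₂, e14, h11]
    exact Nat.mod_eq_of_lt (by omega)
  · simp [eval_sub, eval_reg, e14, e15]
    exact Nat.mod_eq_of_lt (by omega)
  · constructor
    · simp [r₂, hR.h4]
    · simp [r₂, hR.h5]
    · simp [r₂, hR.h6]
    · simp
    · simp
    · simp
    · simp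
    · intro j hj
      simp only [State.set_mem]
      rw [m₂ 3 j (by omega), hR.grid j hj]
    · intro i h₁ h₂
      simp only [State.set_mem]
      rw [m₂ 2 _ (by omega)]
      exact hlev.1 i h₁ h₂
  · exact ((isRow_empty (T := fun j => if j = 0 then e₁ else n + 1) he₁n fun j => rfl).congr
      fun j hj => by simpa [rowAt] using hrow₂ j hj).mono (Nat.zero_le _)
  · intro r hr
    have hbs : blockStart h (b + r) = b := blockStart_eq hd (by omega) (by omega)
    have := hrows (b + r) (by omega)
    rw [hbs] at this
    simp only [State.set_mem]
    rw [m₂ 2 _ (by omega)]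
    refine this.congr fun j hj => ?_
    rw [← hmdef] at hj
    have : (h * n + (b + r) + 1) * m ≤ (h * n + n) * m := Nat.mul_le_mul_right _ (by omega)
    rw [Nat.succ_mul] at this
    simp only [rowAt, ← hmdef]
    exact g₂ _ (by omega)
  rintro t₃ s₃ ⟨ht₃, hr₃, hm₃, hrow₃⟩
  rw [← hmdef] at ht₃ hm₃
  have r₃ : ∀ r < 14, s₃.reg r = s.reg r := fun r hr => by
    rw [hr₃ r (by omega)]
    simp [show r ≠ 20 by omega, show r ≠ 21 by omega, show r ≠ 22 by omega, show r ≠ 23 by omega,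
      r₂ r hr]
  have m₃ : ∀ k v, k < 4 → s₃.mem (cell n k v) = s.mem (cell n k v) := fun k v hk => by
    rw [hm₃ _ fun j _ => by unfold cell; omega]
    exact m₂ k v hk
  have g₃ : ∀ v < R, s₃.mem (cell n 4 v) = s.mem (cell n 4 v) := fun v hv => by
    rw [hm₃ _ fun j _ => by unfold cell; omega]
    exact g₂ v hv
  -- the right half
  refine runs_cons (runs_assign (R + m) ?_ (runs_cons (runs_assign (((h + 1) * n + p) * m) ?_
    (runs_cons (runs_assign (h * n + mid) ?_ (runs_cons (runs_assign (e - mid) ?_ (runs_cons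
    ((runs_extendRow_isRow (w := w) (Z := Z) (n := n) (q := q) (f := f) (base := h * n) (b := mid)
    (e := e) (src := R + m) (dst := ((h + 1) * n + p) * m) (F := H + 1) (lo := b) (e₁ := e₁)
    (d := 2 * h + 1) ?_ (hS.extendBounds hme hen hdst' (by omega) (by omega) (by omega)) hbm hme
    hen hS.val ?_ ?_).mono ?_)))))))))
  · simp [eval_add, eval_reg, r₃, hR.h8, hR.h6, ← hmdef, ← hRdef]
    exact Nat.mod_eq_of_lt (by omega)
  · simp [eval_mul, eval_add, eval_reg, r₃, h11, hR.h4, h13, hR.h6, ← hmdef]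
    rw [← hhn']
    exact Nat.mod_eq_of_lt (by omega)
  · simp [eval_add, eval_reg, r₃, h11, hr₃, e15]
    exact Nat.mod_eq_of_lt (by omega)
  · simp [eval_sub, eval_reg, hr₃, e15, e16]
    exact Nat.mod_eq_of_lt (by omega)
  · constructor
    · simp [r₃, hR.h4]
    · simp [r₃, hR.h5]
    · simp [r₃, hR.h6]
    · simp
    · simp
    · simp
    · simp
    · intro j hj
      simp only [State.set_mem]
      rw [m₃ 3 j (by omega), hR.grid j hj]
    · intro i h₁ h₂
      simp only [State.set_mem]
      rw [m₃ 2 _ (by omega)]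
      exact hlev.2 i h₁ h₂
  · exact hrow₃
  · intro r hr
    have hmid' : mid = b + 2 ^ h := by omega
    have hbs : blockStart h (mid + r) = mid :=
      blockStart_eq (hmid' ▸ Nat.dvd_add hd dvd_rfl) (by omega) (by omega)
    have := (hrows (mid + r) (by omega)).mono (Nat.le_succ (2 * h))
    rw [hbs, show min n (mid + 2 ^ h) = e by omega] at this
    simp only [State.set_mem]
    rw [m₃ 2 _ (by omega)]
    refine this.congr fun j hj => ?_
    rw [← hmdef] at hj
    have : (h * n + (mid + r) + 1) * m ≤ (h * n + n) * m := Nat.mul_le_mul_right _ (by omega)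
    rw [Nat.succ_mul] at this
    simp only [rowAt, ← hmdef]
    exact g₃ _ (by omega)
  rintro t₄ s₄ ⟨ht₄, hr₄, hm₄, hrow₄⟩
  rw [← hmdef] at ht₄ hm₄
  refine runs_nil ⟨?_, fun r hr => ?_, fun x hx => ?_, fun v hv hv' => ?_, hrow₄⟩
  · have : extendTime m H = m * (m * m * (50 * (H + 1) + 250) + 100) + 10 := by
      rw [extendTime]; ring
    simp only [cost_mul, cost_add, cost_sub, cost_load, cost_cellE, cost_reg]
    omega
  · rw [hr₄ r (by omega)]
    simp [show r ≠ 20 by omega, show r ≠ 21 by omega, show r ≠ 22 by omega, show r ≠ 23 by omega,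
      r₃ r hr]
  · rw [hm₄ x fun j _ => hx _]
    simp only [State.set_mem]
    rw [hm₃ x fun j _ => hx _]
    simp only [State.set_mem]
    rw [hm₂ x fun j _ => hx _]
    simp [hm₁]
  · rw [hm₄ _ fun j hj => ?_]
    · exact g₃ v hv
    · rw [ne_eq, cell_inj (by omega) (by omega)]
      exact fun hc => hv' j hj hc.2

/-- All rows of the levels up to the number in register `7`. -/
def fillRows : Cmd :=
  .block [leafRows, .assign 10 (.lit 1), .assign 11 (.lit 0),
    .for 12 (.reg 7) (.block [
      .for 13 (.reg 4) parentRow,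
      .assign 10 (.reg 10 + .reg 10),
      .assign 11 (.reg 11 + .reg 4)])]

theorem runs_fillRows (hS : Sizes w n q H Z f) (hR : Ready n q H f s) :
    Runs w fillRows s fun t s' =>
      t ≤ (H + 1) * (n + 1) * (2 * extendTime (gridSize q n) H + gridSize q n * 50 + 400) ∧
      (∀ r < 10, s'.reg r = s.reg r) ∧ (∀ x, (∀ v, x ≠ cell n 4 v) → s'.mem x = s.mem x) ∧
      ∀ h ≤ H, HasRows n q f s'.mem h := by
  have hword : 2 * n + 8 * Z + 8 < 2 ^ w := hS.word
  have hZn := hS.n_le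
  have hZrows := hS.rows_le
  have hm := gridSize_pos (q := q) (n := n)
  set m := gridSize q n with hmdef
  set U := 2 * extendTime m H + m * 50 with hU
  have hRsum : ((H + 1) * n + (2 * H + 4)) * m = (H + 1) * n * m + (2 * H + 4) * m :=
    Nat.add_mul _ _ _
  have hHm : 2 * H + 4 ≤ (2 * H + 4) * m := Nat.le_mul_of_pos_right _ hm
  have hHn : (H + 1) * n ≤ (H + 1) * n * m := Nat.le_mul_of_pos_right _ hm
  have hHn' : (H + 1) * n = H * n + n := Nat.succ_mul H n
  refine runs_cons ((runs_leafRows hS hR).mono ?_)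
  rintro t₁ s₁ ⟨ht₁, hr₁, hm₁, hrow₁⟩
  refine runs_cons (runs_assign 1 (by rw [eval_lit]; exact Nat.mod_eq_of_lt (by omega)) (runs_cons
    (runs_assign 0 (by simp [eval_lit]) (runs_cons ((runs_for (fun h s' =>
      (∀ r < 10, s'.reg r = s.reg r) ∧ s'.reg 10 = 2 ^ h ∧ s'.reg 11 = h * n ∧
      (∀ x, (∀ v, x ≠ cell n 4 v) → s'.mem x = s.mem x) ∧
      ∀ h' ≤ h, HasRows n q f s'.mem h') (n * (U + 259) + 30) H (by omega) ?_ ?_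
      ?_).mono ?_)))))
  · refine ⟨fun r hr => ?_, by simp, by simp, hm₁, ?_⟩
    · simp [show r ≠ 10 by omega, show r ≠ 11 by omega, show r ≠ 12 by omega, hr₁ r hr]
    · intro h' hh'
      obtain rfl : h' = 0 := by omega
      exact hrow₁
  · rintro h s' - - ⟨hr, -⟩
    rw [eval_reg, hr 7 (by omega), hR.h7]
  · rintro h s₂ hh h12 ⟨hr, h10, h11, hmem, hrows⟩
    have hhn : (h + 1) * n ≤ H * n := Nat.mul_le_mul_right n (by omega)
    have hhn' : (h + 1) * n = h * n + n := Nat.succ_mul h n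
    have hph := hS.lt h hh
    refine runs_cons ((runs_for (fun p s' => (∀ r < 13, s'.reg r = s₂.reg r) ∧
      (∀ x, (∀ v, x ≠ cell n 4 v) → s'.mem x = s.mem x) ∧
      (∀ h' ≤ h, HasRows n q f s'.mem h') ∧
      ∀ p' < p, IsRow f n q (blockStart (h + 1) p') (min n (blockStart (h + 1) p' + 2 ^ (h + 1)))
        (s'.mem (cell n 2 ((h + 1) * n + p'))) (2 * (h + 1))
        (rowAt n (((h + 1) * n + p') * m) s'.mem)) (U + 250) n (by omega) ?_ ?_ ?_).mono ?_)
    · exact ⟨fun r hr => by simp [show r ≠ 13 by omega], hmem, hrows, by simp⟩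
    · rintro i s₂ - - ⟨hr', -⟩
      rw [eval_reg, hr' 4 (by omega), hr 4 (by omega), hR.h4]
    · rintro p s₃ hp h13 ⟨hr', hmem', hrows', hdone⟩
      have hR₃ : Ready n q H f s₃ :=
        hR.congr (fun r hlt => (hr' r (by omega)).trans (hr r hlt)) hmem'
      refine (runs_parentRow hS hR₃ hh ((hr' 10 (by omega)).trans h10)
        ((hr' 11 (by omega)).trans h11) h13 hp (hrows' h le_rfl)).mono ?_
      rintro t s₄ ⟨ht, hr'', hm'', hg, hrow⟩
      rw [← hmdef] at ht hg hrow
      have h2 : ∀ v, s₄.mem (cell n 2 v) = s₃.mem (cell n 2 v) := fun v =>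
        hm'' _ fun _ => by unfold cell; omega
      -- the other rows of the levels in question stay as they are
      have hkeep : ∀ x, x ≠ (h + 1) * n + p → x < (H + 1) * n → ∀ j < m,
          rowAt n (x * m) s₄.mem j = rowAt n (x * m) s₃.mem j := fun x hx hx' j hj => by
        refine hg _ ?_ fun j' hj' heq => ?_
        · have : (x + 1) * m ≤ (H + 1) * n * m := Nat.mul_le_mul_right _ hx'
          rw [Nat.succ_mul] at this
          omega
        · rcases Nat.lt_or_gt_of_ne hx with hlt | hlt
          · have : (x + 1) * m ≤ ((h + 1) * n + p) * m := Nat.mul_le_mul_right _ hlt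
            rw [Nat.succ_mul] at this
            omega
          · have : ((h + 1) * n + p + 1) * m ≤ x * m := Nat.mul_le_mul_right _ hlt
            rw [Nat.succ_mul] at this
            omega
      refine ⟨ht, (hr'' 13 (by omega)).trans h13, fun r hlt => ?_, ?_, ?_, ?_⟩
      · simp [show r ≠ 13 by omega, hr'' r (by omega), hr' r hlt]
      · exact fun x hx => (hm'' x hx).trans (hmem' x hx)
      · intro h' hh' p' hp'
        have : h' * n ≤ h * n := Nat.mul_le_mul_right n hh'
        have h₃ := hrows' h' hh' p' hp'
        rw [← h2] at h₃
        exact h₃.congr fun j hj => hkeep _ (by omega) (by omega) j hj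
      · intro p' hp'
        rcases Nat.lt_or_eq_of_le (Nat.le_of_lt_succ hp') with hlt | rfl
        · have h₃ := hdone p' hlt
          rw [← h2] at h₃
          exact h₃.congr fun j hj => hkeep _ (by omega) (by omega) j hj
        · rw [← h2] at hrow
          exact hrow
    · rintro t s₃ ⟨ht, -, hr', hmem', hrows', hdone⟩
      refine runs_cons (runs_assign (2 ^ (h + 1)) ?_ (runs_cons (runs_assign ((h + 1) * n) ?_
        (runs_nil ⟨?_, ?_, ?_, ?_, ?_, ?_, ?_⟩))))
      · rw [eval_add, eval_reg, hr' 10 (by omega), h10, pow_succ, Nat.mod_eq_of_lt (by omega)]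
        ring
      · simp [eval_add, eval_reg, hr' 11 (by omega), h11, hr' 4 (by omega), hr 4 (by omega), hR.h4]
        rw [hhn']
        exact Nat.mod_eq_of_lt (by omega)
      · simp only [cost_add, cost_reg] at ht ⊢
        have : n * (U + 250 + 1 + 8) = n * (U + 259) := by ring
        omega
      · simp [hr' 12 (by omega), h12]
      · intro r hlt
        simp [show r ≠ 10 by omega, show r ≠ 11 by omega, show r ≠ 12 by omega, hr' r (by omega),
          hr r hlt]
      · simp
      · simp
      · exact hmem'
      · intro h' hh'
        rcases Nat.lt_or_eq_of_le hh' with hlt | rfl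
        · exact hrows' h' (by omega)
        · exact hdone
  · rintro t s₂ ⟨ht, -, hr, -, -, hmem, hrows⟩
    refine runs_nil ⟨?_, hr, hmem, hrows⟩
    simp only [cost_lit, cost_reg] at ht ⊢
    have h₁ : H * (n * (U + 259) + 30 + 1 + 8) ≤ H * ((n + 1) * (U + 400)) :=
      Nat.mul_le_mul_left H (by ring_nf; omega)
    have h₂ : (H + 1) * (n + 1) * (U + 400) = H * ((n + 1) * (U + 400)) + (n + 1) * (U + 400) := by
      ring
    have h₃ : n * (m * 50 + 200) ≤ n * (U + 400) := Nat.mul_le_mul_left n (by omega)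
    rw [← hmdef] at ht₁
    have h₄ : (n + 1) * (U + 400) = n * (U + 400) + (U + 400) := Nat.succ_mul _ _
    omega

end Fill

/-! ### Preprocessing -/

section Setup

variable {w n H : ℕ} {s : State}

/-- The number of levels goes to register `7`: the least `H` with `n ≤ 2 ^ H`. -/
def countLevels : Cmd :=
  .block [.assign 7 (.lit 0), .assign 10 (.lit 1),
    .loop (.bin .lt (.reg 10) (.reg 4)) (.block [
      .assign 10 (.reg 10 + .reg 10), .assign 7 (.reg 7 + .lit 1)])]

theorem runs_countLevels (h4 : s.reg 4 = n) (hlt : ∀ h < H, 2 ^ h < n) (hle : n ≤ 2 ^ H)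
    (hw : 2 * n + 2 < 2 ^ w) :
    Runs w countLevels s fun t s' => t ≤ H * 20 + 20 ∧
      (∀ r, r ≠ 7 → r ≠ 10 → s'.reg r = s.reg r) ∧ s'.mem = s.mem ∧ s'.reg 7 = H := by
  refine runs_cons (runs_assign 0 (by simp [eval_lit]) (runs_cons (runs_assign 1 (by
    rw [eval_lit]; exact Nat.mod_eq_of_lt (by omega)) (runs_cons ((runs_loop_up (fun h s' =>
    (∀ r, r ≠ 7 → r ≠ 10 → s'.reg r = s.reg r) ∧ s'.mem = s.mem ∧ s'.reg 7 = h ∧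
    s'.reg 10 = 2 ^ h) 12 H ?_ ?_ ?_).mono ?_)))))
  · exact ⟨fun r h₁ h₂ => by simp [h₁, h₂], rfl, by simp, by simp⟩
  · rintro h s₁ hh ⟨hr, hm, h7, h10⟩
    have hpow := hlt h hh
    have hhp : h < 2 ^ h := Nat.lt_two_pow_self
    rw [eval_lt_ne_zero _ _ _ _ (by omega), eval_reg, eval_reg, h10, hr 4 (by omega) (by omega), h4]
    refine ⟨hpow, runs_cons (runs_assign (2 ^ (h + 1)) ?_ (runs_cons (runs_assign (h + 1) ?_
      (runs_nil ⟨?_, ?_, hm, by simp, by simp⟩))))⟩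
    · rw [eval_add, eval_reg, h10, pow_succ, Nat.mod_eq_of_lt (by omega)]
      ring
    · rw [eval_add, eval_reg, eval_lit, Nat.mod_eq_of_lt (a := 1) (by omega)]
      simp only [State.set_reg]
      norm_num
      rw [h7]
      exact Nat.mod_eq_of_lt (by omega)
    · simp [cost_add, cost_reg, cost_lit]
    · exact fun r h₁ h₂ => by simp [h₁, h₂, hr r h₁ h₂]
  · rintro s₁ ⟨hr, -, -, h10⟩
    rw [eval_lt_eq_zero _ _ _ _ (by omega), eval_reg, eval_reg, h10, hr 4 (by omega) (by omega), h4]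
    exact hle
  · rintro t s₁ ⟨ht, hr, hm, h7, -⟩
    refine runs_nil ⟨?_, hr, hm, h7⟩
    simp only [cost_lit, cost_bin, cost_reg] at ht ⊢
    omega

/-- A power of two that is too large for a word is read as `0`. A quotient by it is `0` in either
case. -/
theorem div_two_pow_mod {t l ρ : ℕ} (ht : t < 2 ^ w) :
    t / l / (2 ^ ρ % 2 ^ w) = t / (l * 2 ^ ρ) := by
  rw [← Nat.div_div_eq_div_mul]
  rcases lt_or_ge ρ w with h | h
  · rw [Nat.mod_eq_of_lt (Nat.pow_lt_pow_right (by omega) h)]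
  · rw [Nat.mod_eq_zero_of_dvd (pow_dvd_pow 2 h), Nat.div_zero, Nat.div_eq_of_lt]
    exact (Nat.div_le_self _ _).trans_lt (ht.trans_le (Nat.pow_le_pow_right (by omega) h))

/-- The parameter `q` of the grid, for top level `H` and a relative error of at most `2 ^ (-ρ)`: on
the way to an answer the lengths are rounded at most `4 * H + 2` times, each time by a factor of at
most `1 + 1 / q`. -/
def fineness (ρ H : ℕ) : ℕ := 4 * (H + 1) * 2 ^ ρ

/-- The grid lengths go to array `3`, and their number goes to register `6`. -/
def makeGrid (ρ : ℕ) : Cmd :=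
  .block [.assign 11 (.lit 4 * (.reg 7 + .lit 1)), .assign 6 (.lit 0), .assign 12 (.lit 0),
    .loop (.bin .lt (.reg 12) (.reg 4 + .lit 1)) (.block [
      .store (cellE 3 (.reg 6)) (.reg 12),
      .assign 12 (.reg 12 + (.lit 1 + .reg 12 / .reg 11 / .lit (2 ^ ρ))),
      .assign 6 (.reg 6 + .lit 1)])]

theorem runs_makeGrid {ρ : ℕ} (h4 : s.reg 4 = n) (h5 : s.reg 5 = 2 * n) (h7 : s.reg 7 = H)
    (hw : cell n 8 (n + 1) < 2 ^ w) (hH : 4 * (H + 1) < 2 ^ w) :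
    Runs w (makeGrid ρ) s fun t s' => t ≤ gridSize (fineness ρ H) n * 40 + 30 ∧
      (∀ r < 10, r ≠ 6 → s'.reg r = s.reg r) ∧ s'.reg 6 = gridSize (fineness ρ H) n ∧
      (∀ x, (∀ v, x ≠ cell n 3 v) → s'.mem x = s.mem x) ∧
      ∀ j < gridSize (fineness ρ H) n, s'.mem (cell n 3 j) = grid (fineness ρ H) j := by
  unfold cell at hw
  set q := fineness ρ H with hq
  have hmn := gridSize_le q n
  refine runs_cons (runs_assign (4 * (H + 1)) ?_ (runs_cons (runs_assign 0 (by simp [eval_lit])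
    (runs_cons (runs_assign 0 (by simp [eval_lit]) (runs_cons ((runs_loop_up (fun j s' =>
    j ≤ gridSize q n ∧
    (∀ r < 10, r ≠ 6 → s'.reg r = s.reg r) ∧ s'.reg 11 = 4 * (H + 1) ∧ s'.reg 6 = j ∧
    s'.reg 12 = grid q j ∧ (∀ x, (∀ v, x ≠ cell n 3 v) → s'.mem x = s.mem x) ∧
    ∀ i < j, s'.mem (cell n 3 i) = grid q i) 30 (gridSize q n) ?_ ?_ ?_).mono ?_)))))))
  · rw [eval_mul, eval_add, eval_reg, eval_lit, eval_lit, h7, Nat.mod_eq_of_lt (a := 1) (by omega),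
      Nat.mod_eq_of_lt (a := 4) (by omega), Nat.mod_eq_of_lt (a := H + 1) (by omega),
      Nat.mod_eq_of_lt hH]
  · refine ⟨Nat.zero_le _, fun r h₁ h₂ => ?_, by simp, by simp, by simp [grid], fun _ _ => rfl,
      by simp⟩
    simp [h₂, show r ≠ 11 by omega, show r ≠ 12 by omega]
  · rintro j s₁ hj ⟨-, hr, h11, h6, h12, hm, hg⟩
    have hgj := lt_gridSize.1 hj
    have hdiv : grid q j / q ≤ grid q j := Nat.div_le_self _ _
    have e4 : Expr.eval w s₁ (.reg 4 + .lit 1) = n + 1 := by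
      rw [eval_add, eval_reg, eval_lit, hr 4 (by omega) (by omega), h4,
        Nat.mod_eq_of_lt (a := 1) (by omega), Nat.mod_eq_of_lt (by omega)]
    rw [eval_lt_ne_zero _ _ _ _ (by omega), eval_reg, h12, e4]
    refine ⟨by omega, runs_cons (runs_store (cell n 3 j) (grid q j) ?_ ?_ (runs_cons
      (runs_assign (grid q (j + 1)) ?_ (runs_cons (runs_assign (j + 1) ?_
      (runs_nil ⟨?_, hj, ?_, ?_, by simp, by simp, ?_, ?_⟩))))))⟩
    · exact eval_cellE (by rw [hr 5 (by omega) (by omega), h5]) (by rw [eval_reg, h6])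
        (by unfold cell; omega) (by omega)
    · rw [eval_reg, h12]
    · simp only [eval_add, eval_div, eval_reg, eval_lit, State.put_reg]
      rw [h12, h11, Nat.mod_eq_of_lt (a := 1) (by omega), Nat.mod_eq_of_lt
        (a := grid q j / (4 * (H + 1))) ((Nat.div_le_self _ _).trans_lt (by omega)),
        div_two_pow_mod (by omega), ← fineness, ← hq,
        Nat.mod_eq_of_lt (a := grid q j / q) (by omega),
        Nat.mod_eq_of_lt (a := 1 + grid q j / q) (by omega), Nat.mod_eq_of_lt (by omega), grid_succ]
    · rw [eval_add, eval_reg, eval_lit, Nat.mod_eq_of_lt (a := 1) (by omega)]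
      simp only [State.set_reg, State.put_reg]
      norm_num
      rw [h6]
      exact Nat.mod_eq_of_lt (by omega)
    · simp [cost_add, cost_div, cost_reg, cost_lit, cost_cellE]
    · exact fun r h₁ h₂ => by simp [h₂, show r ≠ 12 by omega, hr r h₁ h₂]
    · simp [h11]
    · intro x hx
      simp only [State.set_mem]
      rw [State.put_mem, if_neg (hx j), hm x hx]
    · intro i hi
      simp only [State.set_mem]
      rw [State.put_mem]
      split_ifs with heq
      · rw [cell_inj (by omega) (by omega)] at heq
        rw [heq.2]
      · rw [cell_inj (by omega) (by omega)] at heq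
        exact hg i (by omega)
  · rintro s₁ ⟨-, hr, -, -, h12, -, -⟩
    have hgm : ¬ grid q (gridSize q n) ≤ n := fun h => (lt_gridSize.2 h).false
    rw [eval_lt_eq_zero _ _ _ _ (by omega), eval_reg, h12, eval_add, eval_reg, eval_lit,
      hr 4 (by omega) (by omega), h4, Nat.mod_eq_of_lt (a := 1) (by omega),
      Nat.mod_eq_of_lt (by omega)]
    omega
  · rintro t s₁ ⟨ht, -, hr, -, h6, -, hm, hg⟩
    refine runs_nil ⟨?_, hr, h6, hm, hg⟩
    simp only [cost_lit, cost_bin, cost_reg, cost_add, cost_mul] at ht ⊢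
    omega

/-- The coordinates of the input go to the arrays `0` and `1`. -/
def copyInput : Cmd :=
  .for 13 (.reg 4) (.block [
    .store (cellE 0 (.reg 13)) (.load (.reg 13 + .reg 13)),
    .store (cellE 1 (.reg 13)) (.load (.reg 13 + .reg 13 + .lit 1))])

theorem runs_copyInput (h4 : s.reg 4 = n) (h5 : s.reg 5 = 2 * n) (hw : cell n 8 n < 2 ^ w) :
    Runs w copyInput s fun t s' => t ≤ n * 50 + 20 ∧ (∀ r < 10, s'.reg r = s.reg r) ∧
      (∀ i < n, s'.mem (cell n 0 i) = s.mem (2 * i) ∧ s'.mem (cell n 1 i) = s.mem (2 * i + 1)) ∧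
      ∀ x, (∀ v, x ≠ cell n 0 v) → (∀ v, x ≠ cell n 1 v) → s'.mem x = s.mem x := by
  unfold cell at hw
  refine (runs_for (fun i s' => (∀ r < 10, s'.reg r = s.reg r) ∧
    (∀ i' < i, s'.mem (cell n 0 i') = s.mem (2 * i') ∧
      s'.mem (cell n 1 i') = s.mem (2 * i' + 1)) ∧
    ∀ x, (∀ v, x ≠ cell n 0 v) → (∀ v, x ≠ cell n 1 v) → s'.mem x = s.mem x) 40 n (by omega)
    ?_ ?_ ?_).mono ?_
  · exact ⟨fun r hr => by simp [show r ≠ 13 by omega], by simp, fun _ _ _ => rfl⟩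
  · rintro k s₁ - - ⟨hr, -⟩
    rw [eval_reg, hr 4 (by omega), h4]
  · rintro i s₁ hi h13 ⟨hr, hdone, hm⟩
    have hin : ∀ a < 2 * n, s₁.mem a = s.mem a := fun a ha =>
      hm a (fun v => by unfold cell; omega) (fun v => by unfold cell; omega)
    refine runs_cons (runs_store (cell n 0 i) (s.mem (2 * i)) ?_ ?_ (runs_cons (runs_store
      (cell n 1 i) (s.mem (2 * i + 1)) ?_ ?_ (runs_nil ⟨?_, h13, ?_, ?_, ?_⟩))))
    · exact eval_cellE (by rw [hr 5 (by omega), h5]) (by rw [eval_reg, h13])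
        (by unfold cell; omega) (by omega)
    · rw [eval_load, eval_add, eval_reg, h13, Nat.mod_eq_of_lt (by omega), ← two_mul,
        hin _ (by omega)]
    · exact eval_cellE (by simp [hr, h5]) (by simp [eval_reg, h13]) (by unfold cell; omega)
        (by omega)
    · rw [eval_load, eval_add, eval_add, eval_reg, eval_lit, State.put_reg, h13,
        Nat.mod_eq_of_lt (a := 1) (by omega), Nat.mod_eq_of_lt (a := i + i) (by omega),
        Nat.mod_eq_of_lt (by omega), ← two_mul, State.put_mem, if_neg (by unfold cell; omega),
        hin _ (by omega)]
    · simp [cost_add, cost_load, cost_reg, cost_lit, cost_cellE]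
    · exact fun r h => by simp [show r ≠ 13 by omega, hr r h]
    · intro i' hi'
      simp only [State.set_mem]
      rw [State.put_mem, State.put_mem, State.put_mem, State.put_mem]
      constructor
      · rw [if_neg (by unfold cell; omega)]
        split_ifs with heq
        · rw [cell_inj (by omega) (by omega)] at heq
          rw [heq.2]
        · rw [cell_inj (by omega) (by omega)] at heq
          exact (hdone i' (by omega)).1
      · split_ifs with heq heq'
        · rw [cell_inj (by omega) (by omega)] at heq
          rw [heq.2]
        · rw [cell_inj (by omega) (by omega)] at heq'
          omega
        · rw [cell_inj (by omega) (by omega)] at heq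
          exact (hdone i' (by omega)).2
    · intro x hx hx'
      simp only [State.set_mem]
      rw [State.put_mem, if_neg (hx' i), State.put_mem, if_neg (hx i), hm x hx hx']
  · rintro t s₁ ⟨ht, -, hr, hdone, hm⟩
    refine ⟨ht.trans ?_, hr, hdone, hm⟩
    simp only [cost_reg]
    omega

/-- Array `2` receives the permutation that takes the rank of the `x`-coordinate of a point to the
rank of its `y`-coordinate. -/
def makePermutation : Cmd :=
  .for 13 (.reg 4) (.block [
    .assign 30 (.reg 7 * .reg 4),
    .assign 31 (.reg 4),
    .assign 32 (.load (cellE 0 (.reg 13))),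
    bsearch 0 0,
    .assign 14 (.reg 33),
    .assign 32 (.load (cellE 1 (.reg 13))),
    bsearch 1 0,
    .store (cellE 2 (.reg 14)) (.reg 33)])

/-- The top level is a single block. -/
theorem HasLevels.sorts_top {k : ℕ} {f μ : ℕ → ℕ} (h : HasLevels n H k f μ) (hle : n ≤ 2 ^ H) :
    Sorts f (fun p => μ (cell n k (H * n + p))) 0 n := by
  have := (h H le_rfl).sorts (b := 0) (Nat.dvd_zero _)
  rwa [Nat.zero_add, min_eq_left hle] at this

/-- The bottom level is not permuted. -/
theorem HasLevels.bottom {k i : ℕ} {f μ : ℕ → ℕ} (h : HasLevels n H k f μ) (hi : i < n) :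
    μ (cell n k i) = f i := by
  have h₁ := h 0 (Nat.zero_le _) i hi
  have h₂ := levelPos_bounds (f := f) (h := 0) hi
  have h₃ : blockStart 0 i = i := by simp [blockStart]
  rw [h₃] at h₂
  rw [show levelPos n f 0 i = i by simp at h₂; omega] at h₁
  simpa using h₁

theorem runs_makePermutation {x y : ℕ → ℕ} (h4 : s.reg 4 = n) (h5 : s.reg 5 = 2 * n)
    (h7 : s.reg 7 = H) (hle : n ≤ 2 ^ H) (hx : HasLevels n H 0 x s.mem)
    (hy : HasLevels n H 1 y s.mem) (hxi : Set.InjOn x (Set.Ico 0 n))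
    (hyi : Set.InjOn y (Set.Ico 0 n)) (hw : cell n 8 ((H + 1) * n) < 2 ^ w) :
    Runs w makePermutation s fun t s' => t ≤ n * (100 * H + 300) + 20 ∧
      (∀ r < 10, s'.reg r = s.reg r) ∧ (∀ a, (∀ v, a ≠ cell n 2 v) → s'.mem a = s.mem a) ∧
      ∀ i < n, s'.mem (cell n 2 (countBelow x 0 n (x i))) = countBelow y 0 n (y i) := by
  unfold cell at hw
  have hHn : (H + 1) * n = H * n + n := Nat.succ_mul H n
  have hF : n - 0 < 2 ^ (H + 1) := by
    have := Nat.two_pow_pos H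
    rw [pow_succ]; omega
  refine (runs_for (fun i s' => (∀ r < 10, s'.reg r = s.reg r) ∧
    (∀ a, (∀ v, a ≠ cell n 2 v) → s'.mem a = s.mem a) ∧
    ∀ i' < i, s'.mem (cell n 2 (countBelow x 0 n (x i'))) = countBelow y 0 n (y i'))
    (100 * H + 280) n (by omega) ?_ ?_ ?_).mono ?_
  · exact ⟨fun r hr => by simp [show r ≠ 13 by omega], fun _ _ => rfl, by simp⟩
  · rintro k s₁ - - ⟨hr, -⟩
    rw [eval_reg, hr 4 (by omega), h4]
  · rintro i s₁ hi h13 ⟨hr, hm, hdone⟩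
    have m₁ : ∀ k v, k < 2 → s₁.mem (cell n k v) = s.mem (cell n k v) := fun k v hk =>
      hm _ fun v' => by unfold cell; omega
    refine runs_cons (runs_assign (H * n) ?_ (runs_cons (runs_assign n ?_ (runs_cons
      (runs_assign (x i) ?_ (runs_cons ((runs_bsearch_sorted (n := n) (base := H * n) (b := 0)
      (e := n) (y := x i) (F := H + 1) (f := x) ?_ ?_ ?_ ?_ hF (by omega) (by omega) ?_ hxi
      ?_).mono ?_)))))))
    · rw [eval_mul, eval_reg, eval_reg, hr 7 (by omega), hr 4 (by omega), h7, h4,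
        Nat.mod_eq_of_lt (by omega)]
    · simp [eval_reg, hr, h4]
    · rw [eval_load, eval_cellE (n := n) (v := i) (by simp [hr, h5]) (by simp [eval_reg, h13])
        (by unfold cell; omega) (by omega)]
      simp only [State.set_mem]
      rw [m₁ 0 i (by omega), hx.bottom hi]
    · simp [hr, h5]
    · simp
    · simp
    · simp
    · unfold cell; omega
    · simp only [State.set_mem]
      intro j h₁ h₂
      beta_reduce
      rw [m₁ 0 _ (by omega)]
      exact hx.sorts_top hle j h₁ h₂
    rintro t₂ s₂ ⟨ht₂, hm₂, hr₂, h33⟩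
    rw [Nat.add_zero] at h33
    simp only [State.set_mem] at hm₂
    have hrx := countBelow_self_lt (f := x) (Nat.zero_le i) hi
    have hry := countBelow_self_lt (f := y) (Nat.zero_le i) hi
    refine runs_cons (runs_assign (countBelow x 0 n (x i)) (by rw [eval_reg, h33]) (runs_cons
      (runs_assign (y i) ?_ (runs_cons ((runs_bsearch_sorted (n := n) (base := H * n) (b := 0)
      (e := n) (y := y i) (F := H + 1) (f := y) ?_ ?_ ?_ ?_ hF (by omega) (by omega) ?_ hyi
      ?_).mono ?_)))))
    · rw [eval_load, eval_cellE (n := n) (v := i) (by simp [hr₂, hr, h5])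
        (by simp [eval_reg, hr₂, h13]) (by unfold cell; omega) (by omega)]
      simp only [State.set_mem]
      rw [hm₂, m₁ 1 i (by omega), hy.bottom hi]
    · simp [hr₂, hr, h5]
    · simp [hr₂]
    · simp [hr₂]
    · simp
    · unfold cell; omega
    · simp only [State.set_mem, hm₂]
      intro j h₁ h₂
      beta_reduce
      rw [m₁ 1 _ (by omega)]
      exact hy.sorts_top hle j h₁ h₂
    rintro t₃ s₃ ⟨ht₃, hm₃, hr₃, h33'⟩
    rw [Nat.add_zero] at h33'
    simp only [State.set_mem] at hm₃
    refine runs_cons (runs_store (cell n 2 (countBelow x 0 n (x i))) (countBelow y 0 n (y i)) ?_ ?_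
      (runs_nil ⟨?_, ?_, ?_, ?_, ?_⟩))
    · exact eval_cellE (by simp [hr₃, hr₂, hr, h5]) (by simp [eval_reg, hr₃])
        (by unfold cell; omega) (by omega)
    · rw [eval_reg, h33']
    · simp only [cost_mul, cost_load, cost_cellE, cost_reg]
      omega
    · simp [hr₃, hr₂, h13]
    · intro r h
      simp [show r ≠ 13 by omega, show r ≠ 14 by omega, show r ≠ 30 by omega,
        show r ≠ 31 by omega, show r ≠ 32 by omega, hr₃ r (by omega), hr₂ r (by omega), hr r h]
    · intro a ha
      simp only [State.set_mem]
      rw [State.put_mem, if_neg (ha _), hm₃, hm₂, hm a ha]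
    · intro i' hi'
      simp only [State.set_mem]
      rw [State.put_mem]
      split_ifs with heq
      · rw [cell_inj (by omega) (by omega)] at heq
        obtain rfl : i' = i := by
          refine hxi ⟨Nat.zero_le _, by omega⟩ ⟨Nat.zero_le _, hi⟩ (le_antisymm ?_ ?_)
          · refine not_lt.1 fun hlt => ?_
            have := countBelow_lt_countBelow (f := x) (Nat.zero_le i) hi hlt
            omega
          · refine not_lt.1 fun hlt => ?_
            have := countBelow_lt_countBelow (f := x) (Nat.zero_le i') (show i' < n by omega) hlt
            omega
        rfl
      · rw [hm₃, hm₂]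
        refine hdone i' ?_
        by_contra hlt
        obtain rfl : i' = i := by omega
        exact heq rfl
  · rintro t s₁ ⟨ht, -, hr, hm, hdone⟩
    refine ⟨ht.trans ?_, hr, hm, hdone⟩
    have : n * (100 * H + 280 + 1 + 8) ≤ n * (100 * H + 300) := Nat.mul_le_mul_left _ (by omega)
    simp only [cost_reg]
    linarith

end Setup

/-- The preprocessing for a relative error of at most `2 ^ (-ρ)`. It ranks the points, which turns
them into a permutation, sorts the blocks of all levels, and computes the rows of all blocks. -/
def preprocess (ρ : ℕ) : Cmd :=
  .block [.assign 4 (.reg 0), .assign 5 (.reg 4 + .reg 4), countLevels, makeGrid ρ,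
    .assign 8 ((.reg 7 + .lit 1) * .reg 4 * .reg 6), copyInput, sortLevels 0, sortLevels 1,
    makePermutation, sortLevels 2, fillRows]

/-- The state after the preprocessing, for points with coordinates `x i` and `y i`, where `f` takes
the rank of an `x`-coordinate to the rank of the `y`-coordinate. -/
structure Built (n q H : ℕ) (x y f : ℕ → ℕ) (s : State) : Prop where
  ready : Ready n q H f s
  rows : ∀ h ≤ H, HasRows n q f s.mem h
  xs : HasLevels n H 0 x s.mem
  ys : HasLevels n H 1 y s.mem

section Ranks

variable {n : ℕ} {x y f : ℕ → ℕ}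

theorem rank_lt (hxi : Set.InjOn x (Set.Ico 0 n))
    (hf : ∀ i < n, f (countBelow x 0 n (x i)) = countBelow y 0 n (y i)) : ∀ p < n, f p < n := by
  intro p hp
  obtain ⟨i, -, hi, rfl⟩ := exists_countBelow_eq hxi (k := p) (by omega)
  rw [hf i hi]
  have := countBelow_self_lt (f := y) (Nat.zero_le i) hi
  omega

theorem countBelow_inj (hxi : Set.InjOn x (Set.Ico 0 n)) {i j : ℕ} (hi : i < n) (hj : j < n)
    (h : countBelow x 0 n (x i) = countBelow x 0 n (x j)) : i = j := by
  refine hxi ⟨Nat.zero_le _, hi⟩ ⟨Nat.zero_le _, hj⟩ (le_antisymm ?_ ?_)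
  · refine not_lt.1 fun hlt => ?_
    have := countBelow_lt_countBelow (f := x) (Nat.zero_le j) hj hlt
    omega
  · refine not_lt.1 fun hlt => ?_
    have := countBelow_lt_countBelow (f := x) (Nat.zero_le i) hi hlt
    omega

theorem rank_injOn (hxi : Set.InjOn x (Set.Ico 0 n)) (hyi : Set.InjOn y (Set.Ico 0 n))
    (hf : ∀ i < n, f (countBelow x 0 n (x i)) = countBelow y 0 n (y i)) :
    Set.InjOn f (Set.Ico 0 n) := by
  rintro p ⟨-, hp⟩ p' ⟨-, hp'⟩ heq
  obtain ⟨i, -, hi, rfl⟩ := exists_countBelow_eq hxi (k := p) (by omega)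
  obtain ⟨j, -, hj, rfl⟩ := exists_countBelow_eq hxi (k := p') (by omega)
  rw [hf i hi, hf j hj] at heq
  rw [countBelow_inj hyi hi hj heq]

end Ranks

/-- A bound for all indices: the rows of all levels and `2 * H + 4` scratch rows, and the loop over the
pairs of grid lengths. -/
def indexBound (n m H : ℕ) : ℕ := ((H + 1) * n + (2 * H + 4)) * m + m * m + (n + 1)

/-- Words of `10 * log n` bits are long enough for all addresses. -/
theorem cell_indexBound_lt {w n m H : ℕ} (hn : 2 ≤ n) (hH : H + 1 ≤ n) (hm : m ≤ n + 1)
    (hw : n ^ 10 ≤ 2 ^ w) : cell n 8 (indexBound n m H) < 2 ^ w := by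
  refine lt_of_lt_of_le ?_ hw
  have h₁ : indexBound n m H ≤ (n * n + 2 * (n * n)) * (2 * n) + (2 * n) * (2 * n) + 2 * n := by
    unfold indexBound
    have : (H + 1) * n ≤ n * n := Nat.mul_le_mul_right _ hH
    have : 2 * n ≤ n * n := Nat.mul_le_mul_right _ hn
    gcongr
    all_goals omega
  have h₂ : 2 ^ 7 * n ^ 3 ≤ n ^ 7 * n ^ 3 := by gcongr
  have h₃ : n ^ 10 = n ^ 7 * n ^ 3 := by ring
  have h₄ : (n * n + 2 * (n * n)) * (2 * n) + (2 * n) * (2 * n) + 2 * n =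
    6 * n ^ 3 + 4 * n ^ 2 + 2 * n := by ring
  have h₅ : 2 * n ^ 2 ≤ n ^ 3 := by rw [pow_succ n 2, Nat.mul_comm]; gcongr
  have h₆ : 2 * n ≤ n ^ 2 := by rw [pow_two]; gcongr
  unfold cell
  omega

/-- The preprocessing leaves the sorted coordinates and the rows of all blocks in the memory. -/
theorem runs_preprocess {w n ρ H : ℕ} {s : State} {x y : ℕ → ℕ} (h0 : s.reg 0 = n) (hn : 2 ≤ n)
    (hlt : ∀ h < H, 2 ^ h < n) (hle : n ≤ 2 ^ H) (hHn : H + 1 ≤ n)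
    (hw : cell n 8 (indexBound n (gridSize (fineness ρ H) n) H) < 2 ^ w)
    (hx : ∀ i < n, s.mem (2 * i) = x i) (hy : ∀ i < n, s.mem (2 * i + 1) = y i)
    (hxi : Set.InjOn x (Set.Ico 0 n)) (hyi : Set.InjOn y (Set.Ico 0 n)) :
    Runs w (preprocess ρ) s fun t s' =>
      t ≤ (H + 1) * (n + 1) * (2 * extendTime (gridSize (fineness ρ H) n) H +
        gridSize (fineness ρ H) n * 90 + 400 * H + 3000) ∧
      ∃ f, Sizes w n (fineness ρ H) H (indexBound n (gridSize (fineness ρ H) n) H) f ∧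
        (∀ i < n, f (countBelow x 0 n (x i)) = countBelow y 0 n (y i)) ∧
        Built n (fineness ρ H) H x y f s' := by
  set q := fineness ρ H with hq
  set m := gridSize q n with hm
  have hmpos : 0 < m := gridSize_pos
  have hw' : 2 * n + 8 * indexBound n m H + 8 < 2 ^ w := hw
  have hZ₁ : ((H + 1) * n + (2 * H + 4)) * m ≤ indexBound n m H := by unfold indexBound; omega
  have hZ₂ : m * m ≤ indexBound n m H := by unfold indexBound; omega
  have hZ₃ : n + 1 ≤ indexBound n m H := by unfold indexBound; omega
  have hZ₄ : (H + 1) * n * m ≤ indexBound n m H := le_trans (by gcongr; omega) hZ₁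
  have hZ₅ : (H + 1) * n ≤ (H + 1) * n * m := Nat.le_mul_of_pos_right _ hmpos
  have hwl : cell n 8 ((H + 1) * n) < 2 ^ w := by unfold cell; omega
  refine runs_cons (runs_assign n (by rw [eval_reg, h0]) (runs_cons (runs_assign (2 * n) ?_
    (runs_cons ((runs_countLevels (n := n) (H := H) ?_ hlt hle (by omega)).mono ?_)))))
  · rw [eval_add, eval_reg]
    simp only [State.set_reg, if_true]
    rw [Nat.mod_eq_of_lt (by omega), two_mul]
  · simp
  rintro t₁ s₁ ⟨ht₁, hr₁, hm₁, h7₁⟩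
  have a4 : s₁.reg 4 = n := by simp [hr₁]
  have a5 : s₁.reg 5 = 2 * n := by simp [hr₁]
  simp only [State.set_mem] at hm₁
  refine runs_cons ((runs_makeGrid (ρ := ρ) a4 a5 h7₁ (by unfold cell; omega) (by omega)).mono ?_)
  rintro t₂ s₂ ⟨ht₂, hr₂, h6₂, hm₂, hg₂⟩
  rw [← hq, ← hm] at ht₂ h6₂ hg₂
  have b4 : s₂.reg 4 = n := by simp [hr₂, a4]
  have b5 : s₂.reg 5 = 2 * n := by simp [hr₂, a5]
  have b7 : s₂.reg 7 = H := by simp [hr₂, h7₁]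
  refine runs_cons (runs_assign ((H + 1) * n * m) ?_ (runs_cons ((runs_copyInput (n := n) ?_ ?_
    (by unfold cell; omega)).mono ?_)))
  · rw [eval_mul, eval_mul, eval_add, eval_reg, eval_reg, eval_reg, eval_lit, b4, b7, h6₂,
      Nat.mod_eq_of_lt (a := 1) (by omega), Nat.mod_eq_of_lt (a := H + 1) (by omega),
      Nat.mod_eq_of_lt (a := (H + 1) * n) (by omega), Nat.mod_eq_of_lt (by omega)]
  · simp [b4]
  · simp [b5]
  rintro t₃ s₃ ⟨ht₃, hr₃, hc₃, hm₃⟩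
  simp only [State.set_mem] at hc₃ hm₃
  have hin : ∀ a < 2 * n, s₂.mem a = s.mem a := fun a ha => by
    rw [hm₂ a fun v => by unfold cell; omega, hm₁]
  have c4 : s₃.reg 4 = n := by simp [hr₃, b4]
  have c5 : s₃.reg 5 = 2 * n := by simp [hr₃, b5]
  have c6 : s₃.reg 6 = m := by simp [hr₃, h6₂]
  have c7 : s₃.reg 7 = H := by simp [hr₃, b7]
  have c8 : s₃.reg 8 = (H + 1) * n * m := by simp [hr₃]
  refine runs_cons ((runs_sortLevels (f := x) (k := 0) c4 c5 c7 hlt hle (by omega) hwl (by omega)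
    hxi fun i hi => by rw [(hc₃ i hi).1, hin _ (by omega), hx i hi]).mono ?_)
  rintro t₄ s₄ ⟨ht₄, hr₄, hl₄, hm₄⟩
  refine runs_cons ((runs_sortLevels (f := y) (k := 1) (s := s₄) ((hr₄ 4 (by omega)).trans c4)
    ((hr₄ 5 (by omega)).trans c5) ((hr₄ 7 (by omega)).trans c7) hlt hle (by omega) hwl (by omega)
    hyi fun i hi => by
      rw [hm₄ _ fun v => by unfold cell; omega, (hc₃ i hi).2, hin _ (by omega), hy i hi]).mono ?_)
  rintro t₅ s₅ ⟨ht₅, hr₅, hl₅, hm₅⟩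
  have r₅ : ∀ r < 10, s₅.reg r = s₃.reg r := fun r hr => (hr₅ r hr).trans (hr₄ r hr)
  have hx₅ : HasLevels n H 0 x s₅.mem := fun h hh => (hl₄ h hh).congr fun p _ =>
    hm₅ _ fun v => by unfold cell; omega
  refine runs_cons ((runs_makePermutation (n := n) (H := H) ((r₅ 4 (by omega)).trans c4)
    ((r₅ 5 (by omega)).trans c5) ((r₅ 7 (by omega)).trans c7) hle hx₅ hl₅ hxi hyi hwl).mono ?_)
  rintro t₆ s₆ ⟨ht₆, hr₆, hm₆, hperm⟩
  have r₆ : ∀ r < 10, s₆.reg r = s₃.reg r := fun r hr => (hr₆ r hr).trans (r₅ r hr)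
  set f : ℕ → ℕ := fun p => s₆.mem (cell n 2 p) with hf
  have hS : Sizes w n q H (indexBound n m H) f :=
    ⟨by omega, hlt, hle, rank_injOn hxi hyi hperm, rank_lt hxi hperm, hZ₁, hZ₂, hZ₃, hw⟩
  refine runs_cons ((runs_sortLevels (f := f) (k := 2) ((r₆ 4 (by omega)).trans c4)
    ((r₆ 5 (by omega)).trans c5) ((r₆ 7 (by omega)).trans c7) hlt hle (by omega) hwl (by omega)
    hS.inj fun i _ => rfl).mono ?_)
  rintro t₇ s₇ ⟨ht₇, hr₇, hl₇, hm₇⟩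
  have r₇ : ∀ r < 10, s₇.reg r = s₃.reg r := fun r hr => (hr₇ r hr).trans (r₆ r hr)
  have hR : Ready n q H f s₇ := by
    refine ⟨(r₇ 4 (by omega)).trans c4, (r₇ 5 (by omega)).trans c5, (r₇ 6 (by omega)).trans c6,
      (r₇ 7 (by omega)).trans c7, (r₇ 8 (by omega)).trans c8, fun j hj => ?_, hl₇⟩
    rw [hm₇ _ fun v => by unfold cell; omega, hm₆ _ fun v => by unfold cell; omega,
      hm₅ _ fun v => by unfold cell; omega, hm₄ _ fun v => by unfold cell; omega,
      hm₃ _ (fun v => by unfold cell; omega) fun v => by unfold cell; omega, hg₂ j hj]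
  refine runs_cons ((runs_fillRows hS hR).mono ?_)
  rintro t₈ s₈ ⟨ht₈, hr₈, hm₈, hrows⟩
  refine runs_nil ⟨?_, f, hS, hperm, hR.congr hr₈ hm₈, hrows, fun h hh => (hx₅ h hh).congr
    fun p _ => ?_, fun h hh => (hl₅ h hh).congr fun p _ => ?_⟩
  · rw [← hm] at ht₈
    simp only [cost_add, cost_mul, cost_reg, cost_lit]
    set N := (H + 1) * (n + 1) with hN
    set E := extendTime m H
    have hN₁ : n ≤ N := (Nat.le_succ n).trans (Nat.le_mul_of_pos_left _ (Nat.succ_pos H))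
    have hN₂ : H ≤ N := (Nat.le_succ H).trans (Nat.le_mul_of_pos_right _ (Nat.succ_pos n))
    have h₁ : n * (100 * H + 300) ≤ N * (100 * H + 300) := Nat.mul_le_mul_right _ hN₁
    have h₂ : 1 * (m * 40) ≤ N * (m * 40) := Nat.mul_le_mul_right _ (by omega)
    have h₃ : N * (2 * E + m * 90 + 400 * H + 3000) = N * (2 * E + m * 50 + 400) +
      3 * (N * (100 * H + 600)) + N * (100 * H + 300) + N * (m * 40) + 500 * N := by ring
    omega
  · rw [hm₈ _ fun v => by unfold cell; omega, hm₇ _ fun v => by unfold cell; omega,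
      hm₆ _ fun v => by unfold cell; omega]
  · rw [hm₈ _ fun v => by unfold cell; omega, hm₇ _ fun v => by unfold cell; omega,
      hm₆ _ fun v => by unfold cell; omega]

/-! ### Queries -/

/-- Extends the current row, at index `reg 15`, by the block of `reg 13` columns from column
`reg 10` on, if it ends at column `reg 11` or before. The level of the block starts at index
`reg 14`. -/
def advance : Cmd :=
  .ite (.bin .lt (.reg 11) (.reg 10 + .reg 13)) .skip (.block [
    .assign 20 (.reg 15),
    .assign 21 (.reg 15 + .reg 6),
    .assign 22 (.reg 14 + .reg 10),
    .assign 23 (.reg 13),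
    extendRow,
    .assign 10 (.reg 10 + .reg 13),
    .assign 15 (.reg 15 + .reg 6)])

/-- Passes on by blocks of increasing length, as long as the alignment of the current column is the
obstacle to longer blocks. -/
def ascend : Cmd :=
  .for 16 (.reg 7 + .lit 1) (.block [
    .ite (.reg 10 % (.reg 13 + .reg 13)) advance .skip,
    .assign 13 (.reg 13 + .reg 13), .assign 14 (.reg 14 + .reg 4)])

/-- Passes on by blocks of decreasing length. -/
def descend : Cmd :=
  .for 16 (.reg 7 + .lit 1) (.block [
    .assign 13 (.reg 13 / .lit 2), .assign 14 (.reg 14 - .reg 4), advance])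

/-- Reads off the greatest length that the current row reaches below the height in register `12`.
-/
def readOff : Cmd :=
  .block [.assign 0 (.lit 0),
    .for 16 (.reg 6) (.ite (.bin .lt (.reg 12) (.load (cellE 4 (.reg 15 + .reg 16)))) .skip
      (.assign 0 (.load (cellE 3 (.reg 16)))))]

/-- The ranks of the borders in the registers `0, …, 3`. The upper borders belong to the rectangle;
the search for values up to them avoids the sum of a border and `1`, which might not fit into a
word. -/
def rankBorders : Cmd :=
  .block [
    .assign 30 (.reg 7 * .reg 4), .assign 31 (.reg 4),
    .assign 32 (.reg 0), bsearch 0 0, .assign 10 (.reg 33),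
    .assign 32 (.reg 1), bsearch 0 1, .assign 11 (.reg 33),
    .assign 32 (.reg 2), bsearch 1 0, .assign 28 (.reg 33),
    .assign 32 (.reg 3), bsearch 1 1, .assign 12 (.reg 33)]

/-- The query program. It finds the ranks of the borders, passes from the first column to the last
by blocks of increasing and then of decreasing length, and reads the answer from the row obtained.
-/
def answer : Cmd :=
  .block [rankBorders, .assign 21 (.reg 8), initRow, .assign 13 (.lit 1), .assign 14 (.lit 0),
    .assign 15 (.reg 8), ascend, descend, readOff]

section Query

variable {w n q H Z : ℕ} {s s' : State} {x y f : ℕ → ℕ}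

/-- Only scratch rows and registers outside of `4, …, 9` may change. -/
theorem Built.congr (h : Built n q H x y f s) (hr : ∀ r, 4 ≤ r → r < 10 → s'.reg r = s.reg r)
    (hm : ∀ a, (∀ v, (H + 1) * n * gridSize q n ≤ v → a ≠ cell n 4 v) → s'.mem a = s.mem a) :
    Built n q H x y f s' := by
  have hlev : ∀ k g, k < 4 → HasLevels n H k g s.mem → HasLevels n H k g s'.mem :=
    fun k g hk hl h' hh' => (hl h' hh').congr fun p _ => hm _ fun v _ => by unfold cell; omega
  refine ⟨⟨?_, ?_, ?_, ?_, ?_, fun j hj => ?_, hlev 2 f (by omega) h.ready.levels⟩,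
    fun h' hh' p hp => ?_, hlev 0 x (by omega) h.xs, hlev 1 y (by omega) h.ys⟩
  · rw [hr 4 (by omega) (by omega), h.ready.h4]
  · rw [hr 5 (by omega) (by omega), h.ready.h5]
  · rw [hr 6 (by omega) (by omega), h.ready.h6]
  · rw [hr 7 (by omega) (by omega), h.ready.h7]
  · rw [hr 8 (by omega) (by omega), h.ready.h8]
  · rw [hm _ fun v _ => by unfold cell; omega, h.ready.grid j hj]
  · have := h.rows h' hh' p hp
    rw [hm _ fun v _ => by unfold cell; omega]
    refine this.congr fun j hj => hm _ fun v hv => ?_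
    have h₁ : (h' + 1) * n ≤ (H + 1) * n := Nat.mul_le_mul_right _ (by omega)
    have h₂ : (h' * n + p + 1) * gridSize q n ≤ (H + 1) * n * gridSize q n :=
      Nat.mul_le_mul_right _ (by rw [Nat.succ_mul] at h₁; omega)
    rw [Nat.succ_mul] at h₂
    rw [ne_eq, cell_inj (by omega) (by omega)]
    omega

/-- The columns from `lo` to `cur` have been dealt with in at most `k` steps, and register `15` points
to a row that describes them. The rows of the query lie one behind the other, behind the rows of the
blocks. -/
structure Progress (n q H : ℕ) (x y f : ℕ → ℕ) (lo hi e₁ e₂ k cur : ℕ) (s : State) : Prop where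
  built : Built n q H x y f s
  h10 : s.reg 10 = cur
  h11 : s.reg 11 = hi
  h12 : s.reg 12 = e₂
  row : ∃ i ≤ k, s.reg 15 = ((H + 1) * n + i) * gridSize q n ∧
    IsRow f n q lo cur e₁ (2 * H + i) (rowAt n (s.reg 15) s.mem)
  lo_le : lo ≤ cur
  cur_le : cur ≤ max lo hi

variable {lo hi e₁ e₂ k cur h : ℕ}

theorem Progress.congr (hP : Progress n q H x y f lo hi e₁ e₂ k cur s)
    (hr : ∀ r, r < 13 ∨ r = 15 → s'.reg r = s.reg r) (hm : s'.mem = s.mem) :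
    Progress n q H x y f lo hi e₁ e₂ k cur s' := by
  obtain ⟨hb, h10, h11, h12, ⟨i, hi, h15, hrow⟩, h₁, h₂⟩ := hP
  refine ⟨hb.congr (fun r h₁ h₂ => hr r (by omega)) fun a _ => by rw [hm],
    (hr 10 (by omega)).trans h10, (hr 11 (by omega)).trans h11, (hr 12 (by omega)).trans h12,
    ⟨i, hi, (hr 15 (by omega)).trans h15, ?_⟩, h₁, h₂⟩
  rw [hm, hr 15 (by omega)]
  exact hrow

theorem Progress.mono {k' : ℕ} (hP : Progress n q H x y f lo hi e₁ e₂ k cur s) (hk : k ≤ k') :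
    Progress n q H x y f lo hi e₁ e₂ k' cur s :=
  ⟨hP.built, hP.h10, hP.h11, hP.h12, hP.row.imp fun _ h => ⟨h.1.trans hk, h.2⟩, hP.lo_le,
    hP.cur_le⟩

theorem Sizes.two_pow_le (hS : Sizes w n q H Z f) (hh : h ≤ H) : 2 ^ h ≤ 2 * n := by
  rcases Nat.eq_zero_or_pos H with rfl | hpos
  · obtain rfl : h = 0 := by omega
    have := hS.pos
    rw [pow_zero]; omega
  · have h₁ := hS.lt (H - 1) (by omega)
    have h₂ : 2 ^ h ≤ 2 ^ (H - 1 + 1) := Nat.pow_le_pow_right (by omega) (by omega)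
    rw [pow_succ] at h₂
    omega

/-- A step adds one factor `1 + 1 / q` to the loss, as the rows of the blocks lose at most `2 * H`
factors. -/
theorem runs_advance (hS : Sizes w n q H Z f) (hP : Progress n q H x y f lo hi e₁ e₂ k cur s)
    (hk : k < 2 * H + 2) (hh : h ≤ H) (h13 : s.reg 13 = 2 ^ h) (h14 : s.reg 14 = h * n)
    (hlon : lo ≤ n) (hhin : hi ≤ n) (hdvd : cur + 2 ^ h ≤ hi → 2 ^ h ∣ cur) :
    Runs w advance s fun t s' => t ≤ extendTime (gridSize q n) H + 50 ∧
      (∀ r < 20, r ≠ 10 → r ≠ 15 → s'.reg r = s.reg r) ∧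
      Progress n q H x y f lo hi e₁ e₂ (k + 1)
        (if cur + 2 ^ h ≤ hi then cur + 2 ^ h else cur) s' := by
  have hP' := hP
  obtain ⟨hb, h10, h11, h12, ⟨i, hik, h15, hrow⟩, hlo, hcur⟩ := hP
  have hword : 2 * n + 8 * Z + 8 < 2 ^ w := hS.word
  have hZn := hS.n_le
  have hZrows := hS.rows_le
  have hm := gridSize_pos (q := q) (n := n)
  set m := gridSize q n with hmdef
  have hpn : 2 ^ h ≤ 2 * n := hS.two_pow_le hh
  have hhn : h * n + n ≤ (H + 1) * n := by
    rw [← Nat.succ_mul]; exact Nat.mul_le_mul_right n (by omega)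
  have hi₂ : ((H + 1) * n + i + 2) * m ≤ ((H + 1) * n + (2 * H + 4)) * m :=
    Nat.mul_le_mul_right _ (by omega)
  have hi₃ : ((H + 1) * n + i + 2) * m = ((H + 1) * n + i) * m + m + m := by ring
  have hi₄ : ((H + 1) * n + (i + 1)) * m = ((H + 1) * n + i) * m + m := by ring
  have hR : (H + 1) * n * m ≤ ((H + 1) * n + i) * m := Nat.mul_le_mul_right _ (by omega)
  have hHnR : (H + 1) * n ≤ (H + 1) * n * m := Nat.le_mul_of_pos_right _ hm
  have htest : Expr.eval w s (.bin .lt (.reg 11) (.reg 10 + .reg 13)) = 0 ↔ cur + 2 ^ h ≤ hi := by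
    rw [eval_lt_eq_zero _ _ _ _ (by omega), eval_add, eval_reg, eval_reg, eval_reg, h10, h11, h13,
      Nat.mod_eq_of_lt (by omega)]
  refine runs_ite (fun he => ?_) (fun he => ?_)
  · rw [ne_eq, htest] at he
    rw [if_neg he]
    refine runs_skip ⟨?_, fun _ _ _ _ => rfl, hP'.mono (Nat.le_succ k)⟩
    simp only [cost_bin, cost_add, cost_reg]
    omega
  rw [htest] at he
  have hd := hdvd he
  rw [if_pos he]
  set src := ((H + 1) * n + i) * m with hsrc
  have hend : min n (cur + 2 ^ h) = cur + 2 ^ h := min_eq_right (he.trans hhin)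
  have hbase : (h * n + n) * m ≤ src + m := by
    have : (h * n + n) * m ≤ (H + 1) * n * m := Nat.mul_le_mul_right _ hhn
    omega
  refine runs_cons (runs_assign src (by rw [eval_reg, h15]) (runs_cons (runs_assign (src + m) ?_
    (runs_cons (runs_assign (h * n + cur) ?_ (runs_cons (runs_assign (cur + 2 ^ h - cur) ?_
    (runs_cons ((runs_extendRow_isRow (w := w) (Z := Z) (n := n) (q := q) (f := f)
    (base := h * n) (b := cur) (e := cur + 2 ^ h) (src := src) (dst := src + m) (F := H + 1)
    (lo := lo) (e₁ := e₁) (d := 2 * H + i) ?_ (hS.extendBounds (Nat.le_add_right _ _)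
    (he.trans hhin) hbase (by omega) (by omega) (by omega)) hlo (Nat.le_add_right _ _)
    (he.trans hhin) hS.val ?_ ?_).mono ?_)))))))))
  · simp [eval_add, eval_reg, h15, hb.ready.h6, ← hmdef]
    exact Nat.mod_eq_of_lt (by omega)
  · simp [eval_add, eval_reg, h10, h14]
    exact Nat.mod_eq_of_lt (by omega)
  · simp [eval_reg, h13]
  · constructor
    · simp [hb.ready.h4]
    · simp [hb.ready.h5]
    · simp [hb.ready.h6]
    · simp
    · simp
    · simp
    · simp
    · exact hb.ready.grid
    · have := (hb.ready.levels h hh).sorts hd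
      rwa [hend] at this
  · rw [h15] at hrow
    exact hrow
  · intro r hr
    rw [Nat.add_sub_cancel_left] at hr
    have hbs : blockStart h (cur + r) = cur := blockStart_eq hd (by omega) (by omega)
    have := hb.rows h hh (cur + r) (by omega)
    rw [hbs, hend] at this
    exact this.mono (by omega)
  rintro t₁ s₁ ⟨ht₁, hr₁, hm₁, hrow₁⟩
  rw [← hmdef] at ht₁ hm₁
  simp only [State.set_mem] at hm₁
  refine runs_cons (runs_assign (cur + 2 ^ h) ?_ (runs_cons (runs_assign (src + m) ?_
    (runs_nil ⟨?_, ?_, ?_, ?_, ?_, ?_, ?_, ?_, ?_⟩))))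
  · simp [eval_add, eval_reg, hr₁, h10, h13]
    exact Nat.mod_eq_of_lt (by omega)
  · simp [eval_add, eval_reg, hr₁, h15, hb.ready.h6, ← hmdef]
    exact Nat.mod_eq_of_lt (by omega)
  · have : extendTime m H = m * (m * m * (50 * (H + 1) + 250) + 100) + 10 := by
      rw [extendTime]; ring
    simp only [cost_bin, cost_add, cost_reg]
    omega
  · intro r h₁ h₂ h₃
    simp [h₂, h₃, hr₁ r (by omega), show r ≠ 20 by omega, show r ≠ 21 by omega,
      show r ≠ 22 by omega, show r ≠ 23 by omega]
  · refine hb.congr (fun r h₁ h₂ => ?_) fun a ha => ?_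
    · simp [hr₁ r (by omega), show r ≠ 10 by omega, show r ≠ 15 by omega, show r ≠ 20 by omega,
        show r ≠ 21 by omega, show r ≠ 22 by omega, show r ≠ 23 by omega]
    · simp only [State.set_mem]
      rw [← hmdef] at ha
      exact hm₁ a fun j hj => ha _ (by omega)
  · simp
  · simp [hr₁, h11]
  · simp [hr₁, h12]
  · refine ⟨i + 1, by omega, ?_, ?_⟩
    · simp only [State.set_reg, if_true]
      rw [← hmdef, hi₄]
    · simp only [State.set_reg, if_true, State.set_mem]
      exact hrow₁
  · omega
  · omega

/-- The state of the first phase before level `h`: the current column is a multiple of `2 ^ h`, or it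
is the start of an aligned block that passes `hi`. In the second case no longer block is needed. -/
def Ascending (hi h cur : ℕ) : Prop := 2 ^ h ∣ cur ∨ ∃ a, 2 ^ a ∣ cur ∧ hi < cur + 2 ^ a

/-- The state of the second phase before level `h - 1`: fewer than `2 ^ h` columns remain, and the
current column is the start of an aligned block that passes `hi`, so that all shorter blocks are
aligned as well. -/
def Descending (hi h cur : ℕ) : Prop := hi < cur + 2 ^ h ∧ ∃ a, 2 ^ a ∣ cur ∧ hi < cur + 2 ^ a

theorem Ascending.dvd (hA : Ascending hi h cur) (hmod : cur % 2 ^ (h + 1) ≠ 0)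
    (hle : cur + 2 ^ h ≤ hi) : 2 ^ h ∣ cur := by
  obtain hd | ⟨a, hd, hlt⟩ := hA
  · exact hd
  · have : h < a := (Nat.pow_lt_pow_iff_right (a := 2) (by omega)).1 (by omega)
    exact absurd (Nat.mod_eq_zero_of_dvd ((pow_dvd_pow 2 this).trans hd)) hmod

theorem Ascending.step (hA : Ascending hi h cur) (hmod : cur % 2 ^ (h + 1) ≠ 0) :
    Ascending hi (h + 1) (if cur + 2 ^ h ≤ hi then cur + 2 ^ h else cur) := by
  split_ifs with hle
  · obtain ⟨c, rfl⟩ := hA.dvd hmod hle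
    left
    rcases Nat.even_or_odd' c with ⟨b, rfl | rfl⟩
    · exact absurd (by rw [pow_succ, ← Nat.mul_assoc]; exact Nat.mul_mod_right _ _) hmod
    · exact ⟨b + 1, by rw [pow_succ]; ring⟩
  · obtain hd | h' := hA
    · exact Or.inr ⟨h, hd, not_le.1 hle⟩
    · exact Or.inr h'

theorem Descending.dvd (hD : Descending hi (h + 1) cur) (hle : cur + 2 ^ h ≤ hi) : 2 ^ h ∣ cur := by
  obtain ⟨-, a, hd, hlt⟩ := hD
  have : h < a := (Nat.pow_lt_pow_iff_right (a := 2) (by omega)).1 (by omega)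
  exact (pow_dvd_pow 2 this.le).trans hd

theorem Descending.step (hD : Descending hi (h + 1) cur) :
    Descending hi h (if cur + 2 ^ h ≤ hi then cur + 2 ^ h else cur) := by
  split_ifs with hle
  · have h₁ := hD.1
    rw [pow_succ] at h₁
    exact ⟨by omega, h, Nat.dvd_add (hD.dvd hle) dvd_rfl, by omega⟩
  · exact ⟨not_le.1 hle, hD.2⟩

theorem runs_ascend (hS : Sizes w n q H Z f) (hP : Progress n q H x y f lo hi e₁ e₂ 0 cur s)
    (h13 : s.reg 13 = 1) (h14 : s.reg 14 = 0) (hlon : lo ≤ n) (hhin : hi ≤ n) :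
    Runs w ascend s fun t s' => t ≤ (H + 1) * (extendTime (gridSize q n) H + 100) + 20 ∧
      s'.reg 13 = 2 ^ (H + 1) ∧ s'.reg 14 = (H + 1) * n ∧
      ∃ cur', Progress n q H x y f lo hi e₁ e₂ (H + 1) cur' s' ∧ Ascending hi (H + 1) cur' := by
  have hword : 2 * n + 8 * Z + 8 < 2 ^ w := hS.word
  have hZn := hS.n_le
  have hZrows := hS.rows_le
  have hm := gridSize_pos (q := q) (n := n)
  have hHm : (H + 1) * n + (2 * H + 4) ≤ ((H + 1) * n + (2 * H + 4)) * gridSize q n :=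
    Nat.le_mul_of_pos_right _ hm
  refine (runs_for (fun h s' => s'.reg 13 = 2 ^ h ∧ s'.reg 14 = h * n ∧
    ∃ cur', Progress n q H x y f lo hi e₁ e₂ h cur' s' ∧ Ascending hi h cur')
    (extendTime (gridSize q n) H + 80) (H + 1) (by omega) ?_ ?_ ?_).mono ?_
  · refine ⟨by simp [h13], by simp [h14], cur, hP.congr (fun r hr => ?_) rfl, ?_⟩
    · simp [show r ≠ 16 by omega]
    · exact Or.inl (by simp)
  · rintro k s' - - ⟨-, -, cur', hP', -⟩
    rw [eval_add, eval_reg, eval_lit, hP'.built.ready.h7, Nat.mod_eq_of_lt (a := 1) (by omega),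
      Nat.mod_eq_of_lt (by omega)]
  · rintro h s₁ hh h16 ⟨a13, a14, cur', hP', hA⟩
    have hpn : 2 ^ h ≤ 2 * n := hS.two_pow_le (by omega)
    have hcur := hP'.cur_le
    have hpow : 2 ^ h + 2 ^ h = 2 ^ (h + 1) := by rw [pow_succ]; ring
    have hhn : (h + 1) * n ≤ (H + 1) * n := Nat.mul_le_mul_right _ (by omega)
    rw [Nat.succ_mul] at hhn
    have htest : Expr.eval w s₁ (.reg 10 % (.reg 13 + .reg 13)) = cur' % 2 ^ (h + 1) := by
      rw [eval_mod, eval_add, eval_reg, eval_reg, hP'.h10, a13, hpow,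
        Nat.mod_eq_of_lt (a := 2 ^ (h + 1)) (by omega), Nat.mod_eq_of_lt]
      exact (Nat.mod_le _ _).trans_lt (by omega)
    suffices hstep : Runs w (.ite (.reg 10 % (.reg 13 + .reg 13)) advance .skip) s₁ fun t s' =>
        t ≤ extendTime (gridSize q n) H + 60 ∧ s'.reg 13 = 2 ^ h ∧ s'.reg 14 = h * n ∧
        s'.reg 16 = h ∧ ∃ cur', Progress n q H x y f lo hi e₁ e₂ (h + 1) cur' s' ∧
          Ascending hi (h + 1) cur' by
      refine runs_cons (hstep.mono ?_)
      rintro t₂ s₂ ⟨ht₂, b13, b14, b16, cur₂, hP₂, hA₂⟩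
      refine runs_cons (runs_assign (2 ^ (h + 1)) ?_ (runs_cons (runs_assign ((h + 1) * n) ?_
        (runs_nil ⟨?_, ?_, ?_, ?_, cur₂, hP₂.congr (fun r hr => ?_) rfl, hA₂⟩))))
      · rw [eval_add, eval_reg, b13, hpow, Nat.mod_eq_of_lt (by omega)]
      · rw [eval_add, eval_reg, eval_reg]
        simp only [State.set_reg]
        rw [if_neg (by omega), if_neg (by omega), b14, hP₂.built.ready.h4, Nat.succ_mul,
          Nat.mod_eq_of_lt (by omega)]
      · simp only [cost_add, cost_reg]
        omega
      · simp [b16]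
      · simp
      · simp
      · simp [show r ≠ 16 by omega, show r ≠ 14 by omega, show r ≠ 13 by omega]
    refine runs_ite (fun he => ?_) (fun he => ?_)
    · rw [htest] at he
      refine (runs_advance hS hP' (by omega) (by omega) a13 a14 hlon hhin (hA.dvd he)).mono ?_
      rintro t₂ s₂ ⟨ht₂, hr₂, hP₂⟩
      refine ⟨?_, by rw [hr₂ 13 (by omega) (by omega) (by omega), a13],
        by rw [hr₂ 14 (by omega) (by omega) (by omega), a14],
        by rw [hr₂ 16 (by omega) (by omega) (by omega), h16], _, hP₂, hA.step he⟩
      simp only [cost_mod, cost_add, cost_reg]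
      omega
    · rw [htest] at he
      refine runs_skip ⟨?_, a13, a14, h16, cur', hP'.mono (Nat.le_succ _),
        Or.inl (Nat.dvd_of_mod_eq_zero he)⟩
      simp only [cost_mod, cost_add, cost_reg]
      omega
  · rintro t s' ⟨ht, -, b13, b14, hP'⟩
    refine ⟨?_, b13, b14, hP'⟩
    simp only [cost_add, cost_reg, cost_lit] at ht
    refine ht.trans ?_
    have : (H + 1) * (extendTime (gridSize q n) H + 80 + (1 + 1 + 1) + 8) ≤
      (H + 1) * (extendTime (gridSize q n) H + 100) := Nat.mul_le_mul_left _ (by omega)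
    omega

theorem runs_descend (hS : Sizes w n q H Z f)
    (hP : Progress n q H x y f lo hi e₁ e₂ (H + 1) cur s) (hD : Descending hi (H + 1) cur)
    (h13 : s.reg 13 = 2 ^ (H + 1)) (h14 : s.reg 14 = (H + 1) * n) (hlon : lo ≤ n) (hhin : hi ≤ n) :
    Runs w descend s fun t s' => t ≤ (H + 1) * (extendTime (gridSize q n) H + 100) + 20 ∧
      ∃ cur', Progress n q H x y f lo hi e₁ e₂ (2 * H + 2) cur' s' ∧ hi ≤ cur' := by
  have hword : 2 * n + 8 * Z + 8 < 2 ^ w := hS.word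
  have hZn := hS.n_le
  have hZrows := hS.rows_le
  have hm := gridSize_pos (q := q) (n := n)
  have hHm : (H + 1) * n + (2 * H + 4) ≤ ((H + 1) * n + (2 * H + 4)) * gridSize q n :=
    Nat.le_mul_of_pos_right _ hm
  refine (runs_for (fun i s' => ∃ h, h + i = H + 1 ∧ s'.reg 13 = 2 ^ h ∧ s'.reg 14 = h * n ∧
    ∃ cur', Progress n q H x y f lo hi e₁ e₂ (H + 1 + i) cur' s' ∧ Descending hi h cur')
    (extendTime (gridSize q n) H + 80) (H + 1) (by omega) ?_ ?_ ?_).mono ?_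
  · refine ⟨H + 1, rfl, by simp [h13], by simp [h14], cur, hP.congr (fun r hr => ?_) rfl, hD⟩
    simp [show r ≠ 16 by omega]
  · rintro k s' - - ⟨-, -, -, -, cur', hP', -⟩
    rw [eval_add, eval_reg, eval_lit, hP'.built.ready.h7, Nat.mod_eq_of_lt (a := 1) (by omega),
      Nat.mod_eq_of_lt (by omega)]
  · rintro i s₁ hi' h16 ⟨h, hhi, a13, a14, cur', hP', hD'⟩
    obtain ⟨h, rfl⟩ : ∃ h', h = h' + 1 := ⟨h - 1, by omega⟩
    have hpn : 2 ^ h ≤ 2 * n := hS.two_pow_le (by omega)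
    have hhn : (h + 1) * n ≤ (H + 1) * n := Nat.mul_le_mul_right _ (by omega)
    rw [Nat.succ_mul] at hhn a14
    have hP₁ : Progress n q H x y f lo hi e₁ e₂ (H + 1 + i) cur'
        ((s₁.set 13 (2 ^ h)).set 14 (h * n)) := hP'.congr (fun r hr => by
      simp [show r ≠ 14 by omega, show r ≠ 13 by omega]) rfl
    refine runs_cons (runs_assign (2 ^ h) ?_ (runs_cons (runs_assign (h * n) ?_
      (runs_cons ((runs_advance hS hP₁ (by omega) (by omega) (by simp) (by simp) hlon hhin
      hD'.dvd).mono ?_)))))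
    · rw [eval_div, eval_reg, eval_lit, a13, Nat.mod_eq_of_lt (a := 2) (by omega), pow_succ,
        Nat.mul_div_cancel _ (by omega), Nat.mod_eq_of_lt (by omega)]
    · rw [eval_sub, eval_reg, eval_reg]
      simp only [State.set_reg]
      rw [if_neg (by omega), if_neg (by omega), a14, hP'.built.ready.h4, Nat.add_sub_cancel,
        Nat.mod_eq_of_lt (by omega)]
    rintro t₂ s₂ ⟨ht₂, hr₂, hP₂⟩
    refine runs_nil ⟨?_, ?_, h, by omega, ?_, ?_, _, hP₂.congr (fun r hr => ?_) rfl, hD'.step⟩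
    · simp only [cost_div, cost_sub, cost_reg, cost_lit]
      omega
    · rw [hr₂ 16 (by omega) (by omega) (by omega)]
      simp [h16]
    · simp [hr₂ 13]
    · simp [hr₂ 14]
    · simp [show r ≠ 16 by omega]
  · rintro t s' ⟨ht, -, h, hh, -, -, cur', hP', hD'⟩
    obtain rfl : h = 0 := by omega
    refine ⟨?_, cur', hP'.mono (by omega), ?_⟩
    · simp only [cost_add, cost_reg, cost_lit] at ht
      refine ht.trans ?_
      have : (H + 1) * (extendTime (gridSize q n) H + 80 + (1 + 1 + 1) + 8) ≤
        (H + 1) * (extendTime (gridSize q n) H + 100) := Nat.mul_le_mul_left _ (by omega)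
      omega
    · have := hD'.1
      rw [pow_zero] at this
      omega

/-- The last entry of the current row that is at most `e₂` gives the answer. -/
theorem runs_readOff (hS : Sizes w n q H Z f)
    (hP : Progress n q H x y f lo hi e₁ e₂ (2 * H + 2) cur s) (hcur : hi ≤ cur) (he₂ : e₂ ≤ n) :
    Runs w readOff s fun t s' => t ≤ gridSize q n * 50 + 20 ∧ Built n q H x y f s' ∧
      s'.reg 0 ≤ windowLis f lo hi e₁ e₂ ∧
      (windowLis f lo hi e₁ e₂ : ℝ) ≤ (1 + 1 / (q : ℝ)) ^ (4 * H + 2) * s'.reg 0 := by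
  have hword : 2 * n + 8 * Z + 8 < 2 ^ w := hS.word
  have hZn := hS.n_le
  have hZrows := hS.rows_le
  have hm := gridSize_pos (q := q) (n := n)
  have hmn := gridSize_le q n
  obtain ⟨hb, h10, h11, h12, ⟨i, hik, h15, hrow⟩, hlo, hcur'⟩ := hP
  set m := gridSize q n with hmdef
  set src := s.reg 15 with hsrc
  have hi₂ : ((H + 1) * n + i + 1) * m ≤ ((H + 1) * n + (2 * H + 4)) * m :=
    Nat.mul_le_mul_right _ (by omega)
  rw [Nat.succ_mul, ← h15] at hi₂
  have hwin : windowLis f lo cur e₁ e₂ = windowLis f lo hi e₁ e₂ :=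
    le_antisymm (windowLis_le fun i _ _ _ _ => by omega) (windowLis_le fun i _ _ _ _ => by omega)
  refine runs_cons (runs_assign 0 (by simp [eval_lit]) (runs_cons ((runs_for (fun j s' =>
    (∀ r, r ≠ 0 → r ≠ 16 → s'.reg r = s.reg r) ∧ s'.mem = s.mem ∧
    s'.reg 0 ≤ windowLis f lo hi e₁ e₂ ∧
    ∀ j' < j, rowAt n src s.mem j' ≤ e₂ → grid q j' ≤ s'.reg 0) 40 m (by omega)
    ?_ ?_ ?_).mono ?_)))
  · exact ⟨fun r h₁ h₂ => by simp [h₁, h₂], rfl, by simp, by simp⟩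
  · rintro k s' - - ⟨hr, -⟩
    rw [eval_reg, hr 6 (by omega) (by omega), hb.ready.h6]
  · rintro j s₁ hj h16 ⟨hr₁, hm₁, hle, hmax⟩
    have hev : Expr.eval w s₁ (.load (cellE 4 (.reg 15 + .reg 16))) = rowAt n src s.mem j := by
      rw [eval_load, eval_cellE (n := n) (v := src + j), hm₁, rowAt]
      · rw [hr₁ 5 (by omega) (by omega), hb.ready.h5]
      · rw [eval_add, eval_reg, eval_reg, hr₁ 15 (by omega) (by omega), h16, ← hsrc,
          Nat.mod_eq_of_lt (by omega)]
      · unfold cell; omega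
      · omega
    have hevg : Expr.eval w s₁ (.load (cellE 3 (.reg 16))) = grid q j := by
      rw [eval_load, eval_cellE (n := n) (v := j), hm₁, hb.ready.grid j hj]
      · rw [hr₁ 5 (by omega) (by omega), hb.ready.h5]
      · rw [eval_reg, h16]
      · unfold cell; omega
      · omega
    have htest : Expr.eval w s₁ (.bin .lt (.reg 12) (.load (cellE 4 (.reg 15 + .reg 16)))) = 0 ↔
        rowAt n src s.mem j ≤ e₂ := by
      rw [eval_lt_eq_zero _ _ _ _ (by omega), hev, eval_reg, hr₁ 12 (by omega) (by omega), h12]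
    refine runs_ite (fun he => runs_skip ?_) (fun he => ?_)
    · rw [ne_eq, htest] at he
      refine ⟨?_, h16, fun r h₁ h₂ => by simp [h₂, hr₁ r h₁ h₂], hm₁, by simpa using hle, ?_⟩
      · simp only [cost_bin, cost_load, cost_cellE, cost_add, cost_reg]
        omega
      · intro j' hj' hj''
        obtain rfl | hlt := (Nat.lt_succ_iff_lt_or_eq.1 hj').symm
        · exact absurd hj'' he
        · simpa using hmax j' hlt hj''
    · rw [htest] at he
      refine runs_assign (grid q j) hevg ⟨?_, by simp [h16], fun r h₁ h₂ => by
        simp [h₁, h₂, hr₁ r h₁ h₂], hm₁, ?_, ?_⟩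
      · simp only [cost_bin, cost_load, cost_cellE, cost_add, cost_reg]
        omega
      · simp only [State.set_reg]
        have h₁ := (hrow.sound j hj (he.trans he₂)).2
        rw [← hwin]
        simpa using h₁.trans (windowLis_le fun i' h₃ h₄ h₅ h₆ => ⟨h₃, h₄, h₅, h₆.trans_le he⟩)
      · intro j' hj' _
        simpa using (grid_strictMono q).monotone (Nat.lt_succ_iff.1 hj')
  · rintro t s₁ ⟨ht, -, hr₁, hm₁, hle, hmax⟩
    refine runs_nil ⟨?_, ?_, hle, ?_⟩
    · simp only [cost_lit, cost_reg] at ht ⊢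
      omega
    · exact hb.congr (fun r h₁ h₂ => hr₁ r (by omega) (by omega)) fun a _ => by rw [hm₁]
    · rcases le_or_gt e₁ e₂ with hee | hee
      · obtain ⟨j, hj, h₁, h₂⟩ := hrow.complete e₂ hee he₂
        have h₃ : (grid q j : ℝ) ≤ s₁.reg 0 := by exact_mod_cast hmax j hj h₁
        rw [← hwin]
        refine h₂.trans (mul_le_mul (pow_le_pow_right₀ (one_le_factor q) (by omega)) h₃
          (Nat.cast_nonneg _) (by positivity))
      · have : windowLis f lo hi e₁ e₂ = 0 := by
          by_contra hne
          obtain ⟨i, hi⟩ := exists_of_windowLis_pos (Nat.pos_of_ne_zero hne)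
          omega
        rw [this, Nat.cast_zero]
        positivity

theorem runs_rankBorders {x₁ x₂ y₁ y₂ : ℕ} (hS : Sizes w n q H Z f) (hb : Built n q H x y f s)
    (hx : Set.InjOn x (Set.Ico 0 n)) (hy : Set.InjOn y (Set.Ico 0 n)) (h0 : s.reg 0 = x₁)
    (h1 : s.reg 1 = x₂) (h2 : s.reg 2 = y₁) (h3 : s.reg 3 = y₂) :
    Runs w rankBorders s fun t s' => t ≤ 200 * H + 500 ∧ s'.mem = s.mem ∧
      (∀ r < 10, s'.reg r = s.reg r) ∧
      s'.reg 10 = countBelow x 0 n x₁ ∧ s'.reg 11 = countBelow x 0 n (x₂ + 1) ∧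
      s'.reg 28 = countBelow y 0 n y₁ ∧ s'.reg 12 = countBelow y 0 n (y₂ + 1) := by
  have hword : 2 * n + 8 * Z + 8 < 2 ^ w := hS.word
  have hZrows := hS.rows_le
  have hm := gridSize_pos (q := q) (n := n)
  have hHm : (H + 1) * n + (2 * H + 4) ≤ ((H + 1) * n + (2 * H + 4)) * gridSize q n :=
    Nat.le_mul_of_pos_right _ hm
  have hHn : (H + 1) * n = H * n + n := Nat.succ_mul _ _
  have hF : n - 0 < 2 ^ (H + 1) := by
    have := hS.le; rw [pow_succ]; have := hS.pos; omega
  have key : ∀ (k fl v : ℕ) (g : ℕ → ℕ) (s₁ : State), k < 2 → fl ≤ 1 → s₁.mem = s.mem →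
      s₁.reg 5 = s.reg 5 → s₁.reg 30 = H * n → s₁.reg 31 = n → s₁.reg 32 = v →
      HasLevels n H k g s.mem → Set.InjOn g (Set.Ico 0 n) →
      Runs w (bsearch k fl) s₁ fun t s' => t ≤ 50 * (H + 1) + 50 ∧ s'.mem = s.mem ∧
        (∀ r < 33, s'.reg r = s₁.reg r) ∧ s'.reg 33 = countBelow g 0 n (v + fl) := by
    intro k fl v g s₁ hk hfl hms h5 h30 h31 h32 hl hg
    refine (runs_bsearch_sorted (n := n) (base := H * n) (b := 0) (e := n) (y := v) (F := H + 1)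
      (f := g) (by rw [h5, hb.ready.h5]) (by simp [h30]) (by simp [h31]) h32 hF (by omega) hfl
      (by unfold cell; omega) hg ?_).mono ?_
    · rw [hms]; exact hl.sorts_top hS.le
    · rintro t s' ⟨ht, hm', hr', h33⟩
      exact ⟨ht, hm'.trans hms, hr', h33⟩
  have h4 := hb.ready.h4
  have h7 := hb.ready.h7
  refine runs_cons (runs_assign (H * n) ?_ (runs_cons (runs_assign n ?_ (runs_cons
    (runs_assign x₁ ?_ (runs_cons ((key 0 0 x₁ x _ (by omega) (by omega) ?_ ?_ ?_ ?_ ?_ hb.xs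
    hx).mono ?_)))))))
  · rw [eval_mul, eval_reg, eval_reg, h7, h4, Nat.mod_eq_of_lt (by omega)]
  · simp [eval_reg, h4]
  · simp [eval_reg, h0]
  · simp
  · simp
  · simp
  · simp
  · simp
  rintro t₁ s₁ ⟨ht₁, hm₁, hr₁, a₁⟩
  refine runs_cons (runs_assign _ (by rw [eval_reg, a₁]) (runs_cons (runs_assign x₂ ?_ (runs_cons
    ((key 0 1 x₂ x _ (by omega) (by omega) ?_ ?_ ?_ ?_ ?_ hb.xs hx).mono ?_)))))
  · simp [eval_reg, hr₁, h1]
  · simp [hm₁]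
  · simp [hr₁]
  · simp [hr₁]
  · simp [hr₁]
  · simp
  rintro t₂ s₂ ⟨ht₂, hm₂, hr₂, a₂⟩
  refine runs_cons (runs_assign _ (by rw [eval_reg, a₂]) (runs_cons (runs_assign y₁ ?_ (runs_cons
    ((key 1 0 y₁ y _ (by omega) (by omega) ?_ ?_ ?_ ?_ ?_ hb.ys hy).mono ?_)))))
  · simp [eval_reg, hr₁, hr₂, h2]
  · simp [hm₂]
  · simp [hr₁, hr₂]
  · simp [hr₁, hr₂]
  · simp [hr₁, hr₂]
  · simp
  rintro t₃ s₃ ⟨ht₃, hm₃, hr₃, a₃⟩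
  refine runs_cons (runs_assign _ (by rw [eval_reg, a₃]) (runs_cons (runs_assign y₂ ?_ (runs_cons
    ((key 1 1 y₂ y _ (by omega) (by omega) ?_ ?_ ?_ ?_ ?_ hb.ys hy).mono ?_)))))
  · simp [eval_reg, hr₁, hr₂, hr₃, h3]
  · simp [hm₃]
  · simp [hr₁, hr₂, hr₃]
  · simp [hr₁, hr₂, hr₃]
  · simp [hr₁, hr₂, hr₃]
  · simp
  rintro t₄ s₄ ⟨ht₄, hm₄, hr₄, a₄⟩
  refine runs_cons (runs_assign _ (by rw [eval_reg, a₄]) (runs_nil ⟨?_, ?_, ?_, ?_, ?_, ?_, ?_⟩))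
  · simp only [cost_mul, cost_reg]
    omega
  · simp [hm₄]
  · intro r hr
    simp [hr₄ r (by omega), hr₃ r (by omega), hr₂ r (by omega), hr₁ r (by omega),
      show r ≠ 10 by omega, show r ≠ 11 by omega, show r ≠ 12 by omega, show r ≠ 28 by omega,
      show r ≠ 30 by omega, show r ≠ 31 by omega, show r ≠ 32 by omega]
  · simp [hr₄, hr₃, hr₂]
  · simp [hr₄, hr₃]
  · simp [hr₄]
  · simp

/-- A query loses at most `2 * H` factors in the rows of the blocks and one factor in each of its
`2 * H + 2` steps. -/
theorem runs_answer {x₁ x₂ y₁ y₂ : ℕ} (hS : Sizes w n q H Z f) (hb : Built n q H x y f s)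
    (hx : Set.InjOn x (Set.Ico 0 n)) (hy : Set.InjOn y (Set.Ico 0 n)) (h0 : s.reg 0 = x₁)
    (h1 : s.reg 1 = x₂) (h2 : s.reg 2 = y₁) (h3 : s.reg 3 = y₂) :
    Runs w answer s fun t s' =>
      t ≤ 2 * ((H + 1) * (extendTime (gridSize q n) H + 100)) + gridSize q n * 100 + 200 * H + 1000 ∧
      Built n q H x y f s' ∧
      s'.reg 0 ≤ windowLis f (countBelow x 0 n x₁) (countBelow x 0 n (x₂ + 1))
        (countBelow y 0 n y₁) (countBelow y 0 n (y₂ + 1)) ∧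
      (windowLis f (countBelow x 0 n x₁) (countBelow x 0 n (x₂ + 1)) (countBelow y 0 n y₁)
        (countBelow y 0 n (y₂ + 1)) : ℝ) ≤ (1 + 1 / (q : ℝ)) ^ (4 * H + 2) * s'.reg 0 := by
  have hword : 2 * n + 8 * Z + 8 < 2 ^ w := hS.word
  have hZrows := hS.rows_le
  have hm := gridSize_pos (q := q) (n := n)
  have hle : ∀ (g : ℕ → ℕ) v, countBelow g 0 n v ≤ n := fun g v => countBelow_le
  refine runs_cons ((runs_rankBorders hS hb hx hy h0 h1 h2 h3).mono ?_)
  rintro t₁ s₁ ⟨ht₁, hm₁, hr₁, a10, a11, a28, a12⟩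
  set lo := countBelow x 0 n x₁
  set hi := countBelow x 0 n (x₂ + 1)
  set e₁ := countBelow y 0 n y₁
  set e₂ := countBelow y 0 n (y₂ + 1)
  have hb₁ : Built n q H x y f s₁ := hb.congr (fun r _ h => hr₁ r h) fun a _ => by rw [hm₁]
  have hR := hb₁.ready
  have hfit : (H + 1) * n * gridSize q n + gridSize q n ≤ Z := by
    refine le_trans ?_ hZrows
    rw [← Nat.succ_mul]
    exact Nat.mul_le_mul_right _ (by omega)
  refine runs_cons (runs_assign _ (by rw [eval_reg, hR.h8]) (runs_cons ((runs_initRow (n := n)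
    (q := q) (Z := Z) (e₁ := e₁) (dst := (H + 1) * n * gridSize q n) (by simp [hR.h4])
    (by simp [hR.h5]) (by simp [hR.h6]) (by simp) (by simp [a28]) hfit hS.word).mono ?_)))
  rintro t₂ s₂ ⟨ht₂, hr₂, hm₂, hrow₂⟩
  simp only [State.set_mem] at hm₂
  have hb₂ : Built n q H x y f s₂ := hb₁.congr
    (fun r _ h => by rw [hr₂ r (by omega), State.set_reg, if_neg (by omega)])
    fun a ha => hm₂ a fun j _ => ha _ (by omega)
  have hP₂ : Progress n q H x y f lo hi e₁ e₂ 0 lo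
      (((s₂.set 13 1).set 14 0).set 15 ((H + 1) * n * gridSize q n)) := by
    refine ⟨hb₂.congr (fun r _ h => ?_) fun _ _ => rfl, ?_, ?_, ?_, ⟨0, le_rfl, ?_, ?_⟩, le_rfl,
      le_max_left _ _⟩
    · simp [show r ≠ 13 by omega, show r ≠ 14 by omega, show r ≠ 15 by omega]
    · simp [hr₂, a10]
    · simp [hr₂, a11]
    · simp [hr₂, a12]
    · simp
    · have := isRow_empty (f := f) (n := n) (q := q) (lo := lo) (d := 2 * H + 0)
        ((hle y y₁).trans (Nat.le_succ n)) fun j => rfl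
      exact this.congr fun j hj => by simpa using hrow₂ j hj
  refine runs_cons (runs_assign 1 ?_ (runs_cons (runs_assign 0 (by simp [eval_lit]) (runs_cons
    (runs_assign ((H + 1) * n * gridSize q n) ?_ (runs_cons
    ((runs_ascend hS hP₂ (by simp) (by simp) (hle _ _) (hle _ _)).mono ?_)))))))
  · rw [eval_lit, Nat.mod_eq_of_lt (by omega)]
  · simp [eval_reg, hb₂.ready.h8]
  rintro t₃ s₃ ⟨ht₃, h13, h14, cur, hP₃, hA₃⟩
  have hD : Descending hi (H + 1) cur := by
    have h₁ : hi < cur + 2 ^ (H + 1) := by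
      have := (hle x (x₂ + 1)).trans hS.le
      have := Nat.two_pow_pos H
      rw [pow_succ]; omega
    exact ⟨h₁, hA₃.elim (fun h => ⟨H + 1, h, h₁⟩) id⟩
  refine runs_cons ((runs_descend hS hP₃ hD h13 h14 (hle _ _) (hle _ _)).mono ?_)
  rintro t₄ s₄ ⟨ht₄, cur', hP₄, hcur⟩
  refine runs_cons ((runs_readOff hS hP₄ hcur (hle _ _)).mono ?_)
  rintro t₅ s₅ ⟨ht₅, hb₅, h₁, h₂⟩
  refine runs_nil ⟨?_, hb₅, h₁, h₂⟩
  simp only [cost_reg, cost_lit]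
  omega

end Query

/-! ### Passing to ranks -/

section Points

variable {n : ℕ} {x y f : ℕ → ℕ}

theorem countBelow_le_countBelow_iff {i a : ℕ} (hi : i < n) :
    countBelow x 0 n a ≤ countBelow x 0 n (x i) ↔ a ≤ x i :=
  ⟨fun h => not_lt.1 fun hlt =>
    absurd (countBelow_lt_countBelow (Nat.zero_le i) hi hlt) (not_lt.2 h), countBelow_mono⟩

theorem countBelow_lt_countBelow_iff {i a : ℕ} (hi : i < n) :
    countBelow x 0 n (x i) < countBelow x 0 n a ↔ x i < a := by
  rw [← not_le, countBelow_le_countBelow_iff hi, not_le]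

/-- A query asks for the longest increasing subsequence of a window of the permutation `f`. -/
theorem lis_points_eq_windowLis {pts : Fin n → ℕ × ℕ} (hx : ∀ i : Fin n, x i = (pts i).1)
    (hy : ∀ i : Fin n, y i = (pts i).2) (hxi : Set.InjOn x (Set.Ico 0 n))
    (hf : ∀ i < n, f (countBelow x 0 n (x i)) = countBelow y 0 n (y i)) (R : Rect) :
    lis (R.points pts) = windowLis f (countBelow x 0 n R.x₁) (countBelow x 0 n (R.x₂ + 1))
      (countBelow y 0 n R.y₁) (countBelow y 0 n (R.y₂ + 1)) := by
  set I : Finset (Fin n) := Finset.univ.filter fun i =>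
    R.x₁ ≤ (pts i).1 ∧ (pts i).1 ≤ R.x₂ ∧ R.y₁ ≤ (pts i).2 ∧ (pts i).2 ≤ R.y₂ with hI
  set g : Fin n → ℕ × ℕ := fun i => (countBelow x 0 n (x i), countBelow y 0 n (y i)) with hg
  have h₁ : R.points pts = I.image pts := by
    ext p
    simp only [Rect.points, hI, Finset.mem_filter, Finset.mem_image, Finset.mem_univ, true_and]
    constructor
    · rintro ⟨⟨i, rfl⟩, h⟩; exact ⟨i, h, rfl⟩
    · rintro ⟨i, h, rfl⟩; exact ⟨⟨i, rfl⟩, h⟩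
  have h₂ : window f (countBelow x 0 n R.x₁) (countBelow x 0 n (R.x₂ + 1))
      (countBelow y 0 n R.y₁) (countBelow y 0 n (R.y₂ + 1)) = I.image g := by
    ext p
    simp only [mem_window, hI, hg, Finset.mem_image, Finset.mem_filter, Finset.mem_univ, true_and,
      ← hx, ← hy]
    constructor
    · rintro ⟨hp₁, hp₂, hp₃, hp₄, hp₅⟩
      have hpn : p.1 < n := hp₂.trans_le countBelow_le
      obtain ⟨i, -, hi, hpi⟩ := exists_countBelow_eq hxi (k := p.1) (by omega)
      rw [← hpi, hf i hi] at hp₅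
      rw [← hpi] at hp₁ hp₂
      rw [hp₅] at hp₃ hp₄
      rw [countBelow_le_countBelow_iff hi] at hp₁ hp₃
      rw [countBelow_lt_countBelow_iff hi] at hp₂ hp₄
      exact ⟨⟨i, hi⟩, ⟨hp₁, Nat.lt_succ_iff.1 hp₂, hp₃, Nat.lt_succ_iff.1 hp₄⟩,
        Prod.ext hpi hp₅.symm⟩
    · rintro ⟨i, ⟨hp₁, hp₂, hp₃, hp₄⟩, rfl⟩
      simp only [countBelow_le_countBelow_iff i.2, countBelow_lt_countBelow_iff i.2, hf i i.2,
        and_true]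
      omega
  rw [windowLis, h₁, h₂]
  refine le_antisymm (lis_image_le I pts g (fun i _ j _ h => ?_) fun i _ j _ h => ?_)
    (lis_image_le I g pts (fun i _ j _ h => ?_) fun i _ j _ h => ?_)
  · rwa [← hx, ← hx, ← countBelow_lt_countBelow_iff i.2] at h
  · rwa [← hy, ← hy, ← countBelow_lt_countBelow_iff i.2] at h
  · rwa [← hx, ← hx, ← countBelow_lt_countBelow_iff i.2]
  · rwa [← hy, ← hy, ← countBelow_lt_countBelow_iff i.2]

end Points

/-! ### Precision and running times -/

theorem one_sub_mul_mul_one_add_pow_le_one {a : ℝ} (h₀ : 0 ≤ a) (h₁ : a ≤ 1) (k : ℕ) :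
    (1 - k * a) * (1 + a) ^ k ≤ 1 := by
  have h := one_add_mul_le_pow (a := -a) (by linarith) k
  calc (1 - k * a) * (1 + a) ^ k ≤ (1 + -a) ^ k * (1 + a) ^ k := by
        gcongr
        linarith
    _ = (1 - a * a) ^ k := by rw [← mul_pow]; ring
    _ ≤ 1 := pow_le_one₀ (by nlinarith) (by nlinarith)

/-- The losses of all `4 * H + 2` roundings together are at most `ε`. -/
theorem one_sub_mul_le_of_le_pow {ε L r : ℝ} {a H : ℕ} (hε : 0 < ε) (ha : 1 / ε ≤ 2 ^ a)
    (hL : 0 ≤ L) (hr : 0 ≤ r) (h : L ≤ (1 + 1 / (fineness a H : ℝ)) ^ (4 * H + 2) * r) :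
    (1 - ε) * L ≤ r := by
  set b : ℝ := 1 / (fineness a H : ℝ) with hb
  have hq : (fineness a H : ℝ) = 4 * (H + 1) * 2 ^ a := by simp [fineness]
  have hpos : (0 : ℝ) < 4 * (H + 1) * 2 ^ a := by positivity
  have hone : (1 : ℝ) ≤ 2 ^ a := one_le_pow₀ one_le_two
  have hb₀ : 0 ≤ b := by positivity
  have hb₁ : b ≤ 1 := by
    rw [hb, hq, div_le_one hpos]
    have : (0 : ℝ) ≤ H := Nat.cast_nonneg H
    nlinarith
  have hbε : ((4 * H + 2 : ℕ) : ℝ) * b ≤ ε := by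
    rw [div_le_iff₀ hε] at ha
    rw [hb, hq, mul_one_div, div_le_iff₀ hpos]
    push_cast
    have : (0 : ℝ) ≤ H := Nat.cast_nonneg H
    nlinarith
  have hk := one_sub_mul_mul_one_add_pow_le_one hb₀ hb₁ (4 * H + 2)
  rcases le_or_gt (1 - ε) 0 with hneg | hεp
  · exact (mul_nonpos_of_nonpos_of_nonneg hneg hL).trans hr
  calc (1 - ε) * L ≤ (1 - ε) * ((1 + b) ^ (4 * H + 2) * r) := by gcongr
    _ ≤ (1 - ((4 * H + 2 : ℕ) : ℝ) * b) * ((1 + b) ^ (4 * H + 2) * r) := by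
        gcongr
    _ = ((1 - ((4 * H + 2 : ℕ) : ℝ) * b) * (1 + b) ^ (4 * H + 2)) * r := by ring
    _ ≤ 1 * r := by gcongr
    _ = r := one_mul r

section Times

variable {z : ℝ} {n H a : ℕ}

/-- With `H + 1 ≤ 3 * z` and `2 ^ a ≤ 2 * z` the grid has at most
`1 + (H + 1) * (4 * (H + 1) * 2 ^ a) ≤ 1 + 72 * z ^ 3` lengths. -/
theorem gridSize_le_mul_pow (hz : 1 ≤ z) (hH : (H + 1 : ℝ) ≤ 3 * z) (ha : (2 : ℝ) ^ a ≤ 2 * z)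
    (hn : n ≤ 2 ^ H) : (gridSize (fineness a H) n : ℝ) ≤ 73 * z ^ 3 := by
  have h₁ : gridSize (fineness a H) n ≤ 1 + (H + 1) * fineness a H := by
    refine gridSize_le_of_lt_two_pow (by unfold fineness; positivity) ?_
    have := Nat.two_pow_pos H
    rw [pow_succ]; omega
  have h₂ : (gridSize (fineness a H) n : ℝ) ≤ 1 + (H + 1) * (4 * (H + 1) * 2 ^ a) := by
    have : (gridSize (fineness a H) n : ℝ) ≤ ((1 + (H + 1) * fineness a H : ℕ) : ℝ) := by
      exact_mod_cast h₁
    simpa [fineness] using this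
  have h₃ : (1 : ℝ) ≤ z ^ 3 := one_le_pow₀ hz
  calc _ ≤ _ := h₂
    _ ≤ 1 + (3 * z) * (4 * (3 * z) * (2 * z)) := by gcongr
    _ ≤ 73 * z ^ 3 := by linarith

theorem extendTime_le_mul_pow {m : ℕ} (hz : 1 ≤ z) (hH : (H + 1 : ℝ) ≤ 3 * z)
    (hm : (m : ℝ) ≤ 73 * z ^ 3) : (extendTime m H : ℝ) ≤ 156000000 * z ^ 10 := by
  have h₀ : (0 : ℝ) ≤ H := Nat.cast_nonneg H
  have h₁ : (1 : ℝ) ≤ z ^ 10 := one_le_pow₀ hz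
  have h₂ : z ^ 3 ≤ z ^ 10 := pow_le_pow_right₀ hz (by norm_num)
  have h₃ : (50 * H + 300 : ℝ) ≤ 400 * z := by linarith
  rw [extendTime]
  push_cast
  calc (m : ℝ) * (m * m * (50 * H + 300) + 100) + 10
      ≤ 73 * z ^ 3 * (73 * z ^ 3 * (73 * z ^ 3) * (400 * z) + 100) + 10 := by gcongr
    _ = 155606800 * z ^ 10 + 7300 * z ^ 3 + 10 := by ring
    _ ≤ 156000000 * z ^ 10 := by linarith

variable {m t : ℕ}

theorem preprocess_time_le (hz : 1 ≤ z) (hn : 1 ≤ n) (hH : (H + 1 : ℝ) ≤ 3 * z)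
    (hm : (m : ℝ) ≤ 73 * z ^ 3)
    (ht : t ≤ (H + 1) * (n + 1) * (2 * extendTime m H + m * 90 + 400 * H + 3000)) :
    (t : ℝ) ≤ 10 ^ 10 * z ^ 11 * n := by
  have hE := extendTime_le_mul_pow hz hH hm
  have hn' : (1 : ℝ) ≤ n := by exact_mod_cast hn
  have h₀ : (0 : ℝ) ≤ H := Nat.cast_nonneg H
  have h₁ : (1 : ℝ) ≤ z ^ 10 := one_le_pow₀ hz
  have h₂ : z ^ 3 ≤ z ^ 10 := pow_le_pow_right₀ hz (by norm_num)
  have h₃ : z ≤ z ^ 10 := le_self_pow₀ hz (by norm_num)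
  have h₄ : (0 : ℝ) ≤ z ^ 11 * n := by positivity
  have ht' : (t : ℝ) ≤ (H + 1) * (n + 1) * (2 * extendTime m H + m * 90 + 400 * H + 3000) := by
    exact_mod_cast ht
  calc (t : ℝ) ≤ _ := ht'
    _ ≤ 3 * z * (n + n) * (400000000 * z ^ 10) := by
        gcongr
        linarith
    _ = 2400000000 * (z ^ 11 * n) := by ring
    _ ≤ 10 ^ 10 * z ^ 11 * n := by linarith

theorem answer_time_le (hz : 1 ≤ z) (hH : (H + 1 : ℝ) ≤ 3 * z) (hm : (m : ℝ) ≤ 73 * z ^ 3)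
    (ht : t ≤ 2 * ((H + 1) * (extendTime m H + 100)) + m * 100 + 200 * H + 1000) :
    (t : ℝ) ≤ 10 ^ 10 * z ^ 11 := by
  have hE := extendTime_le_mul_pow hz hH hm
  have h₀ : (0 : ℝ) ≤ H := Nat.cast_nonneg H
  have h₁ : (1 : ℝ) ≤ z ^ 11 := one_le_pow₀ hz
  have h₂ : z ^ 3 ≤ z ^ 11 := pow_le_pow_right₀ hz (by norm_num)
  have h₃ : z ≤ z ^ 11 := le_self_pow₀ hz (by norm_num)
  have ht' : (t : ℝ) ≤ 2 * ((H + 1) * (extendTime m H + 100)) + m * 100 + 200 * H + 1000 := by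
    exact_mod_cast ht
  calc (t : ℝ) ≤ _ := ht'
    _ ≤ 2 * (3 * z * (156000000 * z ^ 10 + 100)) + 73 * z ^ 3 * 100 + 200 * (3 * z) + 1000 := by
        gcongr
        linarith
    _ = 936000000 * z ^ 11 + 7300 * z ^ 3 + 1200 * z + 1000 := by ring
    _ ≤ 10 ^ 10 * z ^ 11 := by linarith

end Times

/-- The overhead allowed exceeds any power of `log n / ε` with exponent `D`. -/
theorem pow_le_overhead {ε κ : ℝ} {n D : ℕ} (hε : 0 < ε) (hε1 : ε < 1)
    (hz : 1 ≤ Real.logb 2 n / ε) : (Real.logb 2 n / ε) ^ D ≤ overhead D ε κ n := by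
  have hL : 1 ≤ logInv κ := le_max_left _ _
  have hbase : Real.logb 2 n / ε ≤ logInv κ * Real.logb 2 n / ε := by
    rw [mul_div_assoc]
    exact le_mul_of_one_le_left (by linarith) hL
  have hexp : (D : ℝ) ≤ D * logInv κ ^ 2 / ε := by
    rw [le_div_iff₀ hε]
    exact mul_le_mul_of_nonneg_left (by nlinarith) (Nat.cast_nonneg D)
  calc _ = (Real.logb 2 n / ε) ^ (D : ℝ) := (Real.rpow_natCast _ _).symm
    _ ≤ (logInv κ * Real.logb 2 n / ε) ^ (D : ℝ) :=
        Real.rpow_le_rpow (by linarith) hbase (Nat.cast_nonneg D)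
    _ ≤ overhead D ε κ n := Real.rpow_le_rpow_of_exponent_le (hz.trans hbase) hexp

/-- All sizes and running times are compared with powers of `log n / ε`. -/
theorem clog_add_one_le {ε : ℝ} {n : ℕ} (hε : 0 < ε) (hε1 : ε < 1) (hn : 2 ≤ n) :
    1 ≤ Real.logb 2 n / ε ∧ ((Nat.clog 2 n : ℕ) + 1 : ℝ) ≤ 3 * (Real.logb 2 n / ε) ∧
      2 / ε ≤ 2 * (Real.logb 2 n / ε) := by
  have hlog : 1 ≤ Real.logb 2 n := by
    rw [Real.le_logb_iff_rpow_le (by norm_num) (by positivity), Real.rpow_one]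
    exact_mod_cast hn
  have hle : Real.logb 2 n ≤ Real.logb 2 n / ε := by
    rw [le_div_iff₀ hε]
    nlinarith
  refine ⟨hlog.trans hle, ?_, ?_⟩
  · have h₁ : ((Nat.clog 2 n - 1 : ℕ) : ℝ) ≤ Real.logb 2 n := by
      rw [Real.le_logb_iff_rpow_le (by norm_num) (by positivity), Real.rpow_natCast]
      have hpos : 0 < Nat.clog 2 n := Nat.clog_pos (by norm_num) hn
      exact_mod_cast (Nat.pow_lt_of_lt_clog (Nat.sub_lt hpos one_pos)).le
    have h₂ : ((Nat.clog 2 n : ℕ) : ℝ) ≤ ((Nat.clog 2 n - 1 : ℕ) : ℝ) + 1 := by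
      exact_mod_cast (by omega)
    linarith
  · rw [← mul_div_assoc]
    gcongr
    linarith

/-- If `2 ^ a` is `1 / ε`, up to a factor of `2`, then the two programs answer all queries. What the
preprocessing has built survives all queries, since these write to the scratch rows only. -/
theorem approximates {ε κ : ℝ} {a n w : ℕ} {pts : Fin n → ℕ × ℕ} (hε : 0 < ε) (hε1 : ε < 1)
    (hκ : 0 < κ) (ha : 1 / ε ≤ 2 ^ a) (ha' : (2 : ℝ) ^ a ≤ 2 / ε) (hn : 2 ≤ n)
    (hw : n ^ 10 ≤ 2 ^ w) (hx : Function.Injective fun i => (pts i).1)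
    (hy : Function.Injective fun i => (pts i).2) :
    (Algorithm.mk (preprocess a) answer).Approximates w pts ε
      (10 ^ 10 * overhead (11 : ℕ) ε κ n * (n : ℝ) ^ (1 + κ))
      (10 ^ 10 * overhead (11 : ℕ) ε κ n) := by
  obtain ⟨hz, hH, h2⟩ := clog_add_one_le hε hε1 hn
  set H := Nat.clog 2 n with hHdef
  have hlt : ∀ h < H, 2 ^ h < n := fun h hh => Nat.pow_lt_of_lt_clog hh
  have hle : n ≤ 2 ^ H := Nat.le_pow_clog (by norm_num) n
  have hHn : H + 1 ≤ n := by
    have : H ≤ n - 1 := Nat.clog_le_of_le_pow (by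
      have := Nat.lt_two_pow_self (n := n - 1); omega)
    omega
  have hm := gridSize_le_mul_pow hz hH (ha'.trans h2) hle
  have hover := pow_le_overhead (κ := κ) (D := 11) hε hε1 hz
  set X : ℕ → ℕ := fun i => if h : i < n then (pts ⟨i, h⟩).1 else 0 with hX
  set Y : ℕ → ℕ := fun i => if h : i < n then (pts ⟨i, h⟩).2 else 0 with hY
  have hXi : Set.InjOn X (Set.Ico 0 n) := fun i hi j hj h => by
    simp only [hX, dif_pos hi.2, dif_pos hj.2] at h
    exact Fin.mk.inj_iff.1 (hx h)
  have hYi : Set.InjOn Y (Set.Ico 0 n) := fun i hi j hj h => by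
    simp only [hY, dif_pos hi.2, dif_pos hj.2] at h
    exact Fin.mk.inj_iff.1 (hy h)
  obtain ⟨t, s, hexec, ht, f, hS, hf, hB⟩ := runs_preprocess (w := w) (ρ := a) (H := H)
    (s := inputState pts) (x := X) (y := Y) (by simp [inputState]) hn hlt hle hHn
    (cell_indexBound_lt hn hHn (gridSize_le _ _) hw)
    (fun i hi => by simp [inputState, hX, hi])
    (fun i hi => by
      simp [inputState, hY, hi, show (2 * i + 1) / 2 = i by omega]) hXi hYi
  have hquery : ∀ s R, Built n (fineness a H) H X Y f s → _ := fun s R hB =>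
    runs_answer (s := s.withQuery R) (x₁ := R.x₁) (x₂ := R.x₂) (y₁ := R.y₁) (y₂ := R.y₂)
      hS (hB.congr (fun r hr _ => by
      obtain ⟨r, rfl⟩ := Nat.exists_eq_add_of_le' hr
      rfl) fun _ _ => rfl) hXi hYi rfl rfl rfl rfl
  have hreach : ∀ s, (Algorithm.mk (preprocess a) answer).Reach w pts s →
      Built n (fineness a H) H X Y f s := by
    intro s hs
    induction hs with
    | pre h => exact (hexec.unique h).2 ▸ hB
    | @query _ _ R _ _ _ h ih =>
      obtain ⟨_, _, hexec', -, hB', -⟩ := hquery _ R ih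
      exact (hexec'.unique h).2 ▸ hB'
  refine ⟨⟨t, s, hexec, ?_⟩, fun s hs R _ => ?_⟩
  · have hn1 : (1 : ℝ) ≤ n := by exact_mod_cast (by omega : 1 ≤ n)
    refine (preprocess_time_le hz (by omega) hH hm ht).trans ?_
    have : (n : ℝ) ≤ (n : ℝ) ^ (1 + κ) := by
      conv_lhs => rw [← Real.rpow_one (n : ℝ)]
      exact Real.rpow_le_rpow_of_exponent_le hn1 (by linarith)
    have h₀ : 0 ≤ (Real.logb 2 n / ε) ^ 11 := by positivity
    exact mul_le_mul (mul_le_mul_of_nonneg_left hover (by positivity)) this (by positivity)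
      (mul_nonneg (by positivity) (h₀.trans hover))
  · obtain ⟨t', s', hexec', ht', -, h₁, h₂⟩ := hquery s R (hreach s hs)
    rw [← lis_points_eq_windowLis (pts := pts) (fun i => by simp [hX]) (fun i => by simp [hY])
      hXi hf R] at h₁ h₂
    exact ⟨t', s', hexec', (answer_time_le hz hH hm ht').trans (by gcongr),
      one_sub_mul_le_of_le_pow hε ha (Nat.cast_nonneg _) (Nat.cast_nonneg _) h₂, h₁⟩

end QueryLIS

theorem mainTheorem5 :
    ∃ (C D : ℝ) (c : ℕ), ∀ ε κ : ℝ, 0 < ε → ε < 1 → 0 < κ →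
      ∃ A : QueryLIS.Algorithm, ∀ (n w : ℕ) (pts : Fin n → ℕ × ℕ),
        2 ≤ n → n ^ c ≤ 2 ^ w →
        (∀ i, (pts i).1 < 2 ^ w ∧ (pts i).2 < 2 ^ w) →
        Function.Injective (fun i => (pts i).1) →
        Function.Injective (fun i => (pts i).2) →
        A.Approximates w pts ε
          (C * QueryLIS.overhead D ε κ n * (n : ℝ) ^ (1 + κ))
          (C * QueryLIS.overhead D ε κ n) := by
  -- the running times are `O(z ^ 11 * n)` and `O(z ^ 11)`, for `z = log n / ε`
  refine ⟨10 ^ 10, (11 : ℕ), 10, fun ε κ hε hε1 hκ => ?_⟩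
  obtain ⟨a, ha, ha'⟩ := exists_nat_pow_near (one_le_one_div hε hε1.le) one_lt_two
  have h2 : (2 : ℝ) ^ (a + 1) ≤ 2 / ε := by
    rw [pow_succ, ← mul_one_div, mul_comm]
    gcongr
  exact ⟨⟨QueryLIS.preprocess (a + 1), QueryLIS.answer⟩, fun n w pts hn hw _ hx hy =>
    QueryLIS.approximates hε hε1 hκ ha'.le h2 hn hw hx hy⟩
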